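/- **Setting.** Let $\mathcal D$ be a unitary multifusion category: a $\mathbb C$-linear rigid monoidal category with finite-dimensional morphism spaces in which every object is a finite direct sum of simple objects ($\operatorname{End}(X)=\mathbb C\,\mathrm{id}_X$), with finitely many simple objects up to isomorphism (the unit $\mathbf 1$ need not be simple), equipped with an antilinear involutive contravariant functor $\dagger$ that is the identity on objects, satisfies $(f\otimes g)^\dagger=f^\dagger\otimes g^\dagger$, has unitary associators and unitors, and is positive ($f^\dagger f=0\Rightarrow f=0$, and $f^\dagger f=g^\dagger g$ for some endomorphism $g$ of the source of $f$, i.e. the $C^*$-condition). A unitary left $\mathcal D$-module category $\mathcal M$ is a finite semisimple $\mathbb C$-linear category with such a positive $\dagger$ and a bilinear left action $\odot$ of $\mathcal D$ with $(f\odot g)^\dagger=f^\dagger\odot g^\dagger$ and unitary structure isomorphisms; right module categories are defined similarly. Choose representatives $\operatorname{Irr}(\mathcal D)$, $\operatorname{Irr}(\mathcal M)$ of the simple objects. **Dimensions.** Fix for $a\in\operatorname{Irr}(\mathcal D)$ a dual $\bar a$ with duality maps $\mathrm{ev}_a:\bar a\otimes a\to\mathbf 1$ and $\mathrm{coev}_a:\mathbf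 1\to a\otimes\bar a$. The loops $\mathrm{ev}_a\mathrm{ev}_a^\dagger$ to the right of $a$ and $\mathrm{coev}_a^\dagger\mathrm{coev}_a$ to the left of $a$ act on $a$ by positive scalars $r_a,l_a$; the quantum dimension is $d_a=\sqrt{r_al_a}$ (the common value of both loops for balanced duality maps). For $x\in\operatorname{Irr}(\mathcal M)$ put $d_x=\big(\sum_{a\in\operatorname{Irr}(\mathcal D)}d_a\dim\operatorname{Hom}(a\odot x,x)\big)^{1/2}$. The cup paired with $\mathrm{ev}_a$ is $\mathrm{cup}_a=(d_a/r_a)\,\mathrm{ev}_a^\dagger:\mathbf 1\to\bar a\otimes a$. **Diagrams.** The left boundary tube algebra is the vector space $$\tilde{\mathbf L}({}_{\mathcal D}\mathcal M)=\bigoplus_{a\in\operatorname{Irr}(\mathcal D)}\ \bigoplus_{d,e,f,g\in\operatorname{Irr}(\mathcal M)}\operatorname{Hom}(d,a\odot e)\otimes\operatorname{Hom}(a\odot f,g).$$ Write $[a;\nu,\zeta]=\nu\otimes\zeta$ for the diagram with an arc $a$ to the left of the wall, leaving it at the lower vertex $\nu:d\to a\odot e$ and returning at the upper vertex $\zeta:a\odot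 f\to g$. For an arbitrary object $A$ of $\mathcal D$ and $\nu:d\to A\odot e$, $\zeta:A\odot f\to g$, put $[A;\nu,\zeta]=\sum_s[a_s;(p_s\odot e)\circ\nu,\ \zeta\circ(i_s\odot f)]$, where $i_s:a_s\to A$, $p_s:A\to a_s$ is any decomposition of $A$ into simple objects ($p_ti_s=\delta_{s,t}\,\mathrm{id}$, $\sum_s i_sp_s=\mathrm{id}_A$); this does not depend on the decomposition. A normalised vertex basis of $\operatorname{Hom}(j,a\odot i)$ is a basis $(\sigma)$ with $\sigma'^\dagger\sigma=\delta_{\sigma,\sigma'}\sqrt{d_ad_i/d_j}\ \mathrm{id}_j$. For $\xi:x\to a\odot y$ let $\xi_\downarrow:\bar a\odot x\to y$ be obtained from it by bending the leg $a$ down with $\mathrm{ev}_a$; for $\xi:a\odot x\to y$ let $\xi^\uparrow:x\to\bar a\odot y$ be obtained by bending $a$ up with $\mathrm{cup}_a$. **$C^*$ weak Hopf algebras.** A weak Hopf algebra is a finite-dimensional unital algebra $(W,\mu,1)$ and coalgebra $(W,\Delta,\varepsilon)$ over $\mathbb C$ such that $\Delta(xy)=\Delta(x)\Delta(y)$; $(\Delta\otimes\mathrm{id})\Delta(1)=(\Delta(1)\otimes1)(1\otimes\Delta(1))=(1\otimes\Delta(1))(\Delta(1)\otimes1)$;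 $\varepsilon(xyz)=\sum\varepsilon(xy_{(1)})\varepsilon(y_{(2)}z)=\sum\varepsilon(xy_{(2)})\varepsilon(y_{(1)}z)$; together with a linear map $S:W\to W$ with $\sum x_{(1)}S(x_{(2)})=\sum\varepsilon(1_{(1)}x)1_{(2)}$, $\sum S(x_{(1)})x_{(2)}=\sum1_{(1)}\varepsilon(x1_{(2)})$ and $\sum S(x_{(1)})x_{(2)}S(x_{(3)})=S(x)$. It is a $C^*$ weak Hopf algebra if it has an antilinear involution $*$ with $(xy)^*=y^*x^*$ and $\Delta(x^*)=\Delta(x)^{*\otimes *}$, and a faithful unital $*$-representation on a Hilbert space. **Proposition.** $\tilde{\mathbf L}({}_{\mathcal D}\mathcal M)$ is a $C^*$ weak Hopf algebra with the following structure maps. For $\nu:d\to a\odot e$, $\zeta:a\odot f\to g$, $\nu':d'\to a'\odot e'$, $\zeta':a'\odot f'\to g'$ (associators and unitors of the action suppressed in compositions): * Unit: $1=\sum_{x,y\in\operatorname{Irr}(\mathcal M)}[\mathbf 1;\ x\cong\mathbf 1\odot x,\ \mathbf 1\odot y\cong y]$. * Multiplication (the second diagram is put into the gap of the first): $[a;\nu,\zeta]\,[a';\nu',\zeta']=\delta_{f,g'}\,\delta_{e,d'}\,[a\otimes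 a';\ (a\odot\nu')\circ\nu,\ \zeta\circ(a\odot\zeta')]$. * Counit: $\varepsilon([a;\nu,\zeta])\,\mathrm{id}_d=\delta_{e,f}\,\delta_{d,g}\,\zeta\circ\nu$, that is, $\frac{\delta_{e,f}\delta_{d,g}}{d_g}$ times the value of the closed diagram. In particular $\varepsilon([a;\sigma,\sigma'^\dagger])=\delta_{\sigma,\sigma'}\sqrt{d_ad_f/d_g}$ for $\sigma,\sigma'$ in a normalised vertex basis of $\operatorname{Hom}(g,a\odot f)$. * Comultiplication: $\Delta([a;\nu,\zeta])=\sum_{i,j\in\operatorname{Irr}(\mathcal M)}\sum_\sigma\sqrt{\frac{d_j}{d_ad_i}}\ [a;\sigma,\zeta]\otimes[a;\nu,\sigma^\dagger]$, where $\sigma$ runs over any normalised vertex basis of $\operatorname{Hom}(j,a\odot i)$. * Antipode: $S([a;\nu,\zeta])=\frac{d_f}{d_g}\,[\bar a;\ \zeta^\uparrow,\ \nu_\downarrow]$. * Involution: $[a;\nu,\zeta]^*=\frac{d_e}{d_d}\,[\bar a;\ (\nu^\dagger)^\uparrow,\ (\zeta^\dagger)_\downarrow]$. For a unitary right $\mathcal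 D$-module category $\mathcal M_{\mathcal D}$, the right boundary tube algebra $\tilde{\mathbf R}(\mathcal M_{\mathcal D})=\bigoplus_{b\in\operatorname{Irr}(\mathcal D)}\bigoplus_{d,e,f,g\in\operatorname{Irr}(\mathcal M)}\operatorname{Hom}(d,e\odot b)\otimes\operatorname{Hom}(f\odot b,g)$ is a $C^*$ weak Hopf algebra with the mirror-image structure maps: the product diagram has arc $b'\otimes b$, duals are taken on the other side, $d_x=\big(\sum_b d_b\dim\operatorname{Hom}(x\odot b,x)\big)^{1/2}$, and the coefficients in $\varepsilon,\Delta,S,*$ are given by the same formulas. -/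

import Mathlib

open CategoryTheory MonoidalCategory
open scoped TensorProduct DirectSum ComplexConjugate MonoidalLeftAction MonoidalRightAction

noncomputable section

namespace BoundaryTube

/-! ### Weak bialgebras, weak Hopf algebras and `C^*` weak Hopf algebras over `ℂ` -/

/-- A finite-dimensional complex weak bialgebra. -/
structure WeakBialgebra (W : Type*) [AddCommGroup W] [Module ℂ W] where
  one : W
  mul : W →ₗ[ℂ] W →ₗ[ℂ] W
  counit : W →ₗ[ℂ] ℂ
  comul : W →ₗ[ℂ] W ⊗[ℂ] W
  finiteDimensional : FiniteDimensional ℂ W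
  mul_assoc : ∀ x y z, mul (mul x y) z = mul x (mul y z)
  one_mul : ∀ x, mul one x = x
  mul_one : ∀ x, mul x one = x
  coassoc : ∀ x, TensorProduct.assoc ℂ W W W (comul.rTensor W (comul x)) =
    comul.lTensor W (comul x)
  counit_comul : ∀ x, TensorProduct.lid ℂ W (counit.rTensor W (comul x)) = x
  comul_counit : ∀ x, TensorProduct.rid ℂ W (counit.lTensor W (comul x)) = x
  /-- `Δ(xy) = Δ(x) Δ(y)`. -/
  comul_mul : ∀ x y, comul (mul x y) = TensorProduct.map₂ mul mul (comul x) (comul y)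
  /-- `(Δ ⊗ id) Δ(1) = (Δ(1) ⊗ 1) (1 ⊗ Δ(1))`. -/
  comul_one : comul.rTensor W (comul one) =
    TensorProduct.map₂ (TensorProduct.map₂ mul mul) mul (comul one ⊗ₜ[ℂ] one)
      ((TensorProduct.assoc ℂ W W W).symm (one ⊗ₜ[ℂ] comul one))
  /-- `(Δ ⊗ id) Δ(1) = (1 ⊗ Δ(1)) (Δ(1) ⊗ 1)`. -/
  comul_one' : comul.rTensor W (comul one) =
    TensorProduct.map₂ (TensorProduct.map₂ mul mul) mul
      ((TensorProduct.assoc ℂ W W W).symm (one ⊗ₜ[ℂ] comul one)) (comul one ⊗ₜ[ℂ] one)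
  /-- `ε(xyz) = ∑ ε(x y₁) ε(y₂ z)`. -/
  counit_mul : ∀ x y z, counit (mul (mul x y) z) =
    LinearMap.mul' ℂ ℂ (TensorProduct.map (counit ∘ₗ mul x) (counit ∘ₗ mul.flip z) (comul y))
  /-- `ε(xyz) = ∑ ε(x y₂) ε(y₁ z)`. -/
  counit_mul' : ∀ x y z, counit (mul (mul x y) z) =
    LinearMap.mul' ℂ ℂ (TensorProduct.map (counit ∘ₗ mul x) (counit ∘ₗ mul.flip z)
      (TensorProduct.comm ℂ W W (comul y)))

namespace WeakBialgebra

variable {W : Type*} [AddCommGroup W] [Module ℂ W] (H : WeakBialgebra W)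

/-- The left counital map `ε_L(x) = ∑ ε(1₁ x) 1₂`. -/
def counitL (x : W) : W :=
  TensorProduct.lid ℂ W ((H.counit ∘ₗ H.mul.flip x).rTensor W (H.comul H.one))

/-- The right counital map `ε_R(x) = ∑ 1₁ ε(x 1₂)`. -/
def counitR (x : W) : W :=
  TensorProduct.rid ℂ W ((H.counit ∘ₗ H.mul x).lTensor W (H.comul H.one))

end WeakBialgebra

/-- A finite-dimensional complex weak Hopf algebra. -/
structure WeakHopfAlgebra (W : Type*) [AddCommGroup W] [Module ℂ W] extends
    WeakBialgebra W where
  antipode : W →ₗ[ℂ] W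
  /-- `∑ x₁ S(x₂) = ε_L(x)`. -/
  mul_antipode : ∀ x, TensorProduct.lift mul (antipode.lTensor W (comul x)) =
    toWeakBialgebra.counitL x
  /-- `∑ S(x₁) x₂ = ε_R(x)`. -/
  antipode_mul : ∀ x, TensorProduct.lift mul (antipode.rTensor W (comul x)) =
    toWeakBialgebra.counitR x
  /-- `∑ S(x₁) x₂ S(x₃) = S(x)`. -/
  antipode_mul_antipode : ∀ x,
    TensorProduct.lift mul (TensorProduct.map (TensorProduct.lift mul ∘ₗ antipode.rTensor W)
      antipode (comul.rTensor W (comul x))) = antipode x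

/-- A `C^*` weak Hopf algebra: a weak Hopf algebra with an antilinear, antimultiplicative
involution for which `Δ` is a `*`-homomorphism, and which has a faithful `*`-representation on a
Hilbert space. -/
structure CStarWeakHopfAlgebra (W : Type*) [AddCommGroup W] [Module ℂ W] extends
    WeakHopfAlgebra W where
  star : W →ₛₗ[starRingEnd ℂ] W
  star_star : ∀ x, star (star x) = x
  star_mul : ∀ x y, star (mul x y) = mul (star y) (star x)
  comul_star : ∀ x, comul (star x) = TensorProduct.map star star (comul x)
  exists_faithful_rep : ∃ (H : Type) (_ : NormedAddCommGroup H) (_ : InnerProductSpace ℂ H)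
    (_ : CompleteSpace H) (π : W →ₗ[ℂ] (H →L[ℂ] H)),
      Function.Injective π ∧ π one = 1 ∧ (∀ x y, π (mul x y) = π x * π y) ∧
        ∀ x, π (star x) = ContinuousLinearMap.adjoint (π x)

/-! ### Unitary categories, simple objects and decompositions -/

/-- A unitary structure on a `ℂ`-linear category: an involutive antilinear contravariant functor
`†` that is the identity on objects and is positive, in the sense of `C^*`-categories. -/
class UnitaryCategory (C : Type*) [Category C] [Preadditive C] [Linear ℂ C] where
  dagger : ∀ {X Y : C}, (X ⟶ Y) → (Y ⟶ X)
  dagger_dagger : ∀ {X Y : C} (f : X ⟶ Y), dagger (dagger f) = f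
  dagger_id : ∀ X : C, dagger (𝟙 X) = 𝟙 X
  dagger_comp : ∀ {X Y Z : C} (f : X ⟶ Y) (g : Y ⟶ Z), dagger (f ≫ g) = dagger g ≫ dagger f
  dagger_add : ∀ {X Y : C} (f g : X ⟶ Y), dagger (f + g) = dagger f + dagger g
  dagger_smul : ∀ {X Y : C} (c : ℂ) (f : X ⟶ Y), dagger (c • f) = conj c • dagger f
  /-- `f† ∘ f = 0` implies `f = 0`. -/
  eq_zero_of_comp_dagger : ∀ {X Y : C} (f : X ⟶ Y), f ≫ dagger f = 0 → f = 0
  /-- `f† ∘ f` is a positive element of `End X`. -/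
  comp_dagger_pos : ∀ {X Y : C} (f : X ⟶ Y), ∃ g : X ⟶ X, f ≫ dagger f = g ≫ dagger g

open UnitaryCategory (dagger)

/-- Compatibility of a unitary structure with a monoidal structure: `(f ⊗ g)† = f† ⊗ g†`, and the
associators and unitors are unitary. -/
class UnitaryMonoidal (D : Type*) [Category D] [Preadditive D] [Linear ℂ D]
    [MonoidalCategory D] [UnitaryCategory D] : Prop where
  dagger_tensor : ∀ {X X' Y Y' : D} (f : X ⟶ Y) (g : X' ⟶ Y'),
    dagger (f ⊗ₘ g) = dagger f ⊗ₘ dagger g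
  dagger_associator : ∀ X Y Z : D, dagger (α_ X Y Z).hom = (α_ X Y Z).inv
  dagger_leftUnitor : ∀ X : D, dagger (λ_ X).hom = (λ_ X).inv
  dagger_rightUnitor : ∀ X : D, dagger (ρ_ X).hom = (ρ_ X).inv

/-- A left action of `D` on `ℳ` is a unitary module category structure if it is bilinear on
morphisms, satisfies `(f ⊙ g)† = f† ⊙ g†`, and has unitary structure isomorphisms. -/
class UnitaryLeftModule (D ℳ : Type*) [Category D] [Preadditive D] [Linear ℂ D]
    [MonoidalCategory D] [UnitaryCategory D] [Category ℳ] [Preadditive ℳ] [Linear ℂ ℳ]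
    [UnitaryCategory ℳ] [MonoidalLeftAction D ℳ] : Prop where
  action_add : ∀ (A : D) {x y : ℳ} (f g : x ⟶ y), A ⊴ₗ (f + g) = A ⊴ₗ f + A ⊴ₗ g
  action_smul : ∀ (A : D) {x y : ℳ} (c : ℂ) (f : x ⟶ y), A ⊴ₗ (c • f) = c • A ⊴ₗ f
  add_action : ∀ {A B : D} (f g : A ⟶ B) (x : ℳ), (f + g) ⊵ₗ x = f ⊵ₗ x + g ⊵ₗ x
  smul_action : ∀ {A B : D} (c : ℂ) (f : A ⟶ B) (x : ℳ), (c • f) ⊵ₗ x = c • f ⊵ₗ x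
  dagger_action : ∀ {A B : D} {x y : ℳ} (f : A ⟶ B) (g : x ⟶ y),
    dagger (f ⊙ₗₘ g) = dagger f ⊙ₗₘ dagger g
  dagger_actionAssoc : ∀ (A B : D) (x : ℳ), dagger (αₗ A B x).hom = (αₗ A B x).inv
  dagger_actionUnit : ∀ x : ℳ, dagger (λₗ[D] x).hom = (λₗ[D] x).inv

/-- A right action of `D` on `𝒩` is a unitary module category structure if it is bilinear on
morphisms, satisfies `(f ⊙ g)† = f† ⊙ g†`, and has unitary structure isomorphisms. -/
class UnitaryRightModule (D 𝒩 : Type*) [Category D] [Preadditive D] [Linear ℂ D]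
    [MonoidalCategory D] [UnitaryCategory D] [Category 𝒩] [Preadditive 𝒩] [Linear ℂ 𝒩]
    [UnitaryCategory 𝒩] [MonoidalRightAction D 𝒩] : Prop where
  add_action : ∀ {x y : 𝒩} (f g : x ⟶ y) (A : D), (f + g) ⊵ᵣ A = f ⊵ᵣ A + g ⊵ᵣ A
  smul_action : ∀ {x y : 𝒩} (c : ℂ) (f : x ⟶ y) (A : D), (c • f) ⊵ᵣ A = c • f ⊵ᵣ A
  action_add : ∀ (x : 𝒩) {A B : D} (f g : A ⟶ B), x ⊴ᵣ (f + g) = x ⊴ᵣ f + x ⊴ᵣ g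
  action_smul : ∀ (x : 𝒩) {A B : D} (c : ℂ) (f : A ⟶ B), x ⊴ᵣ (c • f) = c • x ⊴ᵣ f
  dagger_action : ∀ {x y : 𝒩} {A B : D} (g : x ⟶ y) (f : A ⟶ B),
    dagger (g ⊙ᵣₘ f) = dagger g ⊙ᵣₘ dagger f
  dagger_actionAssoc : ∀ (x : 𝒩) (A B : D), dagger (αᵣ x A B).hom = (αᵣ x A B).inv
  dagger_actionUnit : ∀ x : 𝒩, dagger (ρᵣ[D] x).hom = (ρᵣ[D] x).inv

/-- A decomposition of `A` as a finite direct sum of members of the family `S`; in diagrams, the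
identity of `A` is written as `∑ₛ incₛ ∘ projₛ`. -/
structure Decomposition {C I : Type*} [Category C] [Preadditive C] (S : I → C) (A : C) where
  n : ℕ
  label : Fin n → I
  inc : ∀ s, S (label s) ⟶ A
  proj : ∀ s, A ⟶ S (label s)
  inc_proj : ∀ s, inc s ≫ proj s = 𝟙 (S (label s))
  inc_proj_of_ne : ∀ s t, s ≠ t → inc s ≫ proj t = 0
  sum_proj_inc : ∑ s, proj s ≫ inc s = 𝟙 A

/-- `S` is a complete set of representatives of the isomorphism classes of simple objects
(`End X = ℂ`) of a semisimple `ℂ`-linear category with finite-dimensional morphism spaces.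
For a finite index type this says that the category is finite semisimple. -/
structure IsIrr {C I : Type*} [Category C] [Preadditive C] [Linear ℂ C] (S : I → C) : Prop where
  finiteDimensional : ∀ X Y : C, FiniteDimensional ℂ (X ⟶ Y)
  simple : ∀ a, Module.finrank ℂ (S a ⟶ S a) = 1
  eq_of_iso : ∀ a b, Nonempty (S a ≅ S b) → a = b
  semisimple : ∀ A : C, Nonempty (Decomposition S A)

/-- The Kronecker symbol `δ_{x,y}` as a morphism: the identity if `x = y`, and zero otherwise. -/
def kron {C J : Type*} [Category C] [Preadditive C] [DecidableEq J] (M : J → C) (x y : J) :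
    M x ⟶ M y :=
  if h : x = y then eqToHom (congrArg M h) else 0

/-- A basis of `Hom(X, Z)` normalised by the real number `Y`: `vecₜ† ∘ vecₛ = δ_{s,t} Y id`. -/
structure VertexBasis {C : Type*} [Category C] [Preadditive C] [Linear ℂ C] [UnitaryCategory C]
    (X Z : C) (Y : ℝ) where
  n : ℕ
  vec : Fin n → (X ⟶ Z)
  normalised : ∀ s t, vec s ≫ dagger (vec t) = if s = t then (Y : ℂ) • 𝟙 X else 0
  complete : Submodule.span ℂ (Set.range vec) = ⊤

/-- For a simple object `X`, the number `c` with `φ = c • 𝟙 X`, written as the trace of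
composition with `φ` on the line `End X`. -/
def scalar {C : Type*} [Category C] [Preadditive C] [Linear ℂ C] {X : C} (φ : X ⟶ X) : ℂ :=
  LinearMap.trace ℂ (X ⟶ X) (Linear.rightComp ℂ X φ)

theorem eq_scalar_smul_id {C : Type*} [Category C] [Preadditive C] [Linear ℂ C] {X : C}
    (hX : Module.finrank ℂ (X ⟶ X) = 1) (φ : X ⟶ X) : φ = scalar φ • 𝟙 X := by
  have : Module.Finite ℂ (X ⟶ X) := Module.finite_of_finrank_pos (by omega)
  have h0 : (𝟙 X : X ⟶ X) ≠ 0 := by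
    intro h
    have hz : ∀ f : X ⟶ X, f = 0 := fun f => by rw [← Category.id_comp f, h, Limits.zero_comp]
    have : Subsingleton (X ⟶ X) := ⟨fun f g => by rw [hz f, hz g]⟩
    rw [Module.finrank_zero_of_subsingleton] at hX
    exact zero_ne_one hX
  obtain ⟨c, rfl⟩ := (finrank_eq_one_iff_of_nonzero' (𝟙 X) h0).1 hX φ
  have : Linear.rightComp ℂ X (c • 𝟙 X) = c • (LinearMap.id : (X ⟶ X) →ₗ[ℂ] (X ⟶ X)) := by
    ext f
    simp
  rw [scalar, this, map_smul, LinearMap.trace_id, hX]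
  simp

/-! ### Quantum dimensions and cups in a unitary rigid monoidal category -/

section Dimensions

variable {D : Type*} [Category D] [Preadditive D] [Linear ℂ D] [MonoidalCategory D]
  [RigidCategory D] [UnitaryCategory D]

/-- The value of the closed loop `ev ∘ ev†`, placed to the right of the simple object `A`. -/
def capLoop (A : D) : ℂ :=
  scalar ((ρ_ A).inv ≫ A ◁ (dagger (ε_ A Aᘁ) ≫ ε_ A Aᘁ) ≫ (ρ_ A).hom)

/-- The value of the closed loop `coev† ∘ coev`, placed to the left of the simple object `A`. -/
def cupLoop (A : D) : ℂ :=
  scalar ((λ_ A).inv ≫ (η_ A Aᘁ ≫ dagger (η_ A Aᘁ)) ▷ A ≫ (λ_ A).hom)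

/-- The quantum dimension of a simple object: the common value of its left and right loops once
`ev` and `coev` are rescaled (by inverse factors) so that the two loops have the same value. -/
def qdim (A : D) : ℝ := Real.sqrt (‖capLoop A‖ * ‖cupLoop A‖)

/-- The cup `1 ⟶ A^∨ ⊗ A`: the multiple of `ev†` whose loop with `ev` has the value `qdim A`. -/
def leftCup (A : D) : 𝟙_ D ⟶ Aᘁ ⊗ A := ((qdim A : ℂ) / capLoop A) • dagger (ε_ A Aᘁ)

/-- The value of the closed loop formed by `A ⊗ ^∨A ⟶ 1` and its adjoint, placed to the left of
the simple object `A`. -/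
def capLoop' (A : D) : ℂ :=
  scalar ((λ_ A).inv ≫ (dagger (ε_ (ᘁA) A) ≫ ε_ (ᘁA) A) ▷ A ≫ (λ_ A).hom)

/-- The cup `1 ⟶ A ⊗ ^∨A`: the multiple of the adjoint of the evaluation `A ⊗ ^∨A ⟶ 1` whose loop
with the evaluation has the value `qdim A`. -/
def rightCup (A : D) : 𝟙_ D ⟶ A ⊗ (ᘁA) := ((qdim A : ℂ) / capLoop' A) • dagger (ε_ (ᘁA) A)

end Dimensions

/-- The labels `(a, d, e, f, g)` of a single-arc diagram: `a` is the arc, and the wall is labelled,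
from bottom to top, by `d`, `e`, (gap), `f`, `g`. -/
abbrev ArcLabel (I J : Type*) := I × J × J × J × J

/-! ### The left boundary tube algebra -/

section Left

variable {D ℳ I J : Type*} [Category D] [Preadditive D] [Linear ℂ D] [MonoidalCategory D]
  [RigidCategory D] [UnitaryCategory D] [Category ℳ] [Preadditive ℳ] [Linear ℂ ℳ]
  [UnitaryCategory ℳ] [MonoidalLeftAction D ℳ] [Fintype I] [DecidableEq I] [DecidableEq J]

/-- The space spanned by the diagrams with one arc on the left of the wall. -/
abbrev LeftTube (S : I → D) (M : J → ℳ) :=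
  ⨁ p : ArcLabel I J,
    (M p.2.1 ⟶ S p.1 ⊙ₗ M p.2.2.1) ⊗[ℂ] (S p.1 ⊙ₗ M p.2.2.2.1 ⟶ M p.2.2.2.2)

variable (S : I → D) (M : J → ℳ)

/-- The diagram with arc `a` that leaves the wall at the lower vertex `ν : d ⟶ a ⊙ e` and returns
to it at the upper vertex `ζ : a ⊙ f ⟶ g`. -/
def leftDiagram (a : I) {d e f g : J} (ν : M d ⟶ S a ⊙ₗ M e) (ζ : S a ⊙ₗ M f ⟶ M g) :
    LeftTube S M :=
  DirectSum.lof ℂ (ArcLabel I J) (fun p =>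
    (M p.2.1 ⟶ S p.1 ⊙ₗ M p.2.2.1) ⊗[ℂ] (S p.1 ⊙ₗ M p.2.2.2.1 ⟶ M p.2.2.2.2))
    (a, d, e, f, g) (ν ⊗ₜ[ℂ] ζ)

/-- The diagram whose arc is labelled by an arbitrary object `A`, evaluated as a combination of
diagrams with simple arcs by cutting the arc along a decomposition of `A`. -/
def leftArc {A : D} (t : Decomposition S A) {d e f g : J} (ν : M d ⟶ A ⊙ₗ M e)
    (ζ : A ⊙ₗ M f ⟶ M g) : LeftTube S M :=
  ∑ s, leftDiagram S M (t.label s) (ν ≫ t.proj s ⊵ₗ M e) (t.inc s ⊵ₗ M f ≫ ζ)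

/-- The dimension of a simple object `x` of the module category: the square root of the dimension
`∑ₐ d_a dim Hom(a ⊙ x, x)` of its internal endomorphism object. -/
def leftDim (x : J) : ℝ :=
  Real.sqrt (∑ a, qdim (S a) * Module.finrank ℂ (S a ⊙ₗ M x ⟶ M x))

/-- The normalisation `√(d_a d_x / d_y)` of the vertices between `y` and `a ⊙ x`. -/
def leftNorm (a : I) (x y : J) : ℝ :=
  Real.sqrt (qdim (S a) * leftDim S M x / leftDim S M y)

/-- Bending the leg `A` of a splitting vertex down. -/
def leftBendDown {A : D} {x y : ℳ} (ξ : x ⟶ A ⊙ₗ y) : Aᘁ ⊙ₗ x ⟶ y :=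
  Aᘁ ⊴ₗ ξ ≫ (αₗ Aᘁ A y).inv ≫ (ε_ A Aᘁ) ⊵ₗ y ≫ (λₗ y).hom

/-- Bending the leg `A` of a fusion vertex up. -/
def leftBendUp {A : D} {x y : ℳ} (ξ : A ⊙ₗ x ⟶ y) : x ⟶ Aᘁ ⊙ₗ y :=
  (λₗ x).inv ≫ leftCup A ⊵ₗ x ≫ (αₗ Aᘁ A x).hom ≫ Aᘁ ⊴ₗ ξ

/-- The structure maps of `H` are the diagrammatic ones. -/
structure IsLeftTubeStructure [Fintype J] (H : CStarWeakHopfAlgebra (LeftTube S M)) : Prop where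
  /-- The unit is the sum of all diagrams with a vacuum arc. -/
  one_eq : ∀ t : Decomposition S (𝟙_ D),
    H.one = ∑ x : J, ∑ y : J, leftArc S M t (λₗ (M x)).inv (λₗ (M y)).hom
  /-- The product puts the second diagram into the gap of the first one. -/
  mul_eq : ∀ (a a' : I) (t : Decomposition S (S a ⊗ S a')) {d e f g d' e' f' g' : J}
    (ν : M d ⟶ S a ⊙ₗ M e) (ζ : S a ⊙ₗ M f ⟶ M g)
    (ν' : M d' ⟶ S a' ⊙ₗ M e') (ζ' : S a' ⊙ₗ M f' ⟶ M g'),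
    H.mul (leftDiagram S M a ν ζ) (leftDiagram S M a' ν' ζ') =
      leftArc S M t
        (ν ≫ S a ⊴ₗ (kron M e d' ≫ ν') ≫ (αₗ (S a) (S a') (M e')).inv)
        ((αₗ (S a) (S a') (M f')).hom ≫ S a ⊴ₗ (ζ' ≫ kron M g' f) ≫ ζ)
  /-- The counit is `δ_{e,f} δ_{d,g} / d_g` times the value of the closed diagram, that is, the
  scalar by which `ζ ∘ ν` acts on `d = g`. -/
  counit_eq : ∀ (a : I) {d e f g : J} (ν : M d ⟶ S a ⊙ₗ M e) (ζ : S a ⊙ₗ M f ⟶ M g),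
    H.counit (leftDiagram S M a ν ζ) • 𝟙 (M d) = ν ≫ S a ⊴ₗ kron M e f ≫ ζ ≫ kron M g d
  /-- The counit on normalised vertices. -/
  counit_normalised : ∀ (a : I) (x y : J)
    (B : VertexBasis (M y) (S a ⊙ₗ M x) (leftNorm S M a x y)) (s t : Fin B.n),
    H.counit (leftDiagram S M a (B.vec s) (dagger (B.vec t))) =
      if s = t then (leftNorm S M a x y : ℂ) else 0
  comul_eq : ∀ (a : I)
    (B : ∀ i j : J, VertexBasis (M j) (S a ⊙ₗ M i) (leftNorm S M a i j))
    {d e f g : J} (ν : M d ⟶ S a ⊙ₗ M e) (ζ : S a ⊙ₗ M f ⟶ M g),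
    H.comul (leftDiagram S M a ν ζ) = ∑ i : J, ∑ j : J, ∑ s : Fin (B i j).n,
      (Real.sqrt (leftDim S M j / (qdim (S a) * leftDim S M i)) : ℂ) •
        (leftDiagram S M a ((B i j).vec s) ζ ⊗ₜ[ℂ]
          leftDiagram S M a ν (dagger ((B i j).vec s)))
  antipode_eq : ∀ (a : I) (t : Decomposition S (S a)ᘁ) {d e f g : J}
    (ν : M d ⟶ S a ⊙ₗ M e) (ζ : S a ⊙ₗ M f ⟶ M g),
    H.antipode (leftDiagram S M a ν ζ) = ((leftDim S M f / leftDim S M g : ℝ) : ℂ) •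
      leftArc S M t (leftBendUp ζ) (leftBendDown ν)
  star_eq : ∀ (a : I) (t : Decomposition S (S a)ᘁ) {d e f g : J}
    (ν : M d ⟶ S a ⊙ₗ M e) (ζ : S a ⊙ₗ M f ⟶ M g),
    H.star (leftDiagram S M a ν ζ) = ((leftDim S M e / leftDim S M d : ℝ) : ℂ) •
      leftArc S M t (leftBendUp (dagger ν)) (leftBendDown (dagger ζ))

end Left

/-! ### The right boundary tube algebra, with the arc on the right of the wall -/

section Right

variable {D 𝒩 I J : Type*} [Category D] [Preadditive D] [Linear ℂ D] [MonoidalCategory D]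
  [RigidCategory D] [UnitaryCategory D] [Category 𝒩] [Preadditive 𝒩] [Linear ℂ 𝒩]
  [UnitaryCategory 𝒩] [MonoidalRightAction D 𝒩] [Fintype I] [DecidableEq I] [DecidableEq J]

/-- The space spanned by the diagrams with one arc on the right of the wall. -/
abbrev RightTube (S : I → D) (N : J → 𝒩) :=
  ⨁ p : ArcLabel I J,
    (N p.2.1 ⟶ N p.2.2.1 ⊙ᵣ S p.1) ⊗[ℂ] (N p.2.2.2.1 ⊙ᵣ S p.1 ⟶ N p.2.2.2.2)

variable (S : I → D) (N : J → 𝒩)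

/-- The diagram with arc `b` that leaves the wall at the lower vertex `ν : d ⟶ e ⊙ b` and returns
to it at the upper vertex `ζ : f ⊙ b ⟶ g`. -/
def rightDiagram (b : I) {d e f g : J} (ν : N d ⟶ N e ⊙ᵣ S b) (ζ : N f ⊙ᵣ S b ⟶ N g) :
    RightTube S N :=
  DirectSum.lof ℂ (ArcLabel I J) (fun p =>
    (N p.2.1 ⟶ N p.2.2.1 ⊙ᵣ S p.1) ⊗[ℂ] (N p.2.2.2.1 ⊙ᵣ S p.1 ⟶ N p.2.2.2.2))
    (b, d, e, f, g) (ν ⊗ₜ[ℂ] ζ)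

/-- The diagram whose arc is labelled by an arbitrary object `A`, evaluated as a combination of
diagrams with simple arcs by cutting the arc along a decomposition of `A`. -/
def rightArc {A : D} (t : Decomposition S A) {d e f g : J} (ν : N d ⟶ N e ⊙ᵣ A)
    (ζ : N f ⊙ᵣ A ⟶ N g) : RightTube S N :=
  ∑ s, rightDiagram S N (t.label s) (ν ≫ N e ⊴ᵣ t.proj s) (N f ⊴ᵣ t.inc s ≫ ζ)

/-- The dimension of a simple object `x` of the module category: the square root of the dimension
`∑_b d_b dim Hom(x ⊙ b, x)` of its internal endomorphism object. -/
def rightDim (x : J) : ℝ :=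
  Real.sqrt (∑ b, qdim (S b) * Module.finrank ℂ (N x ⊙ᵣ S b ⟶ N x))

/-- The normalisation `√(d_b d_x / d_y)` of the vertices between `y` and `x ⊙ b`. -/
def rightNorm (b : I) (x y : J) : ℝ :=
  Real.sqrt (qdim (S b) * rightDim S N x / rightDim S N y)

/-- Bending the leg `A` of a splitting vertex down. -/
def rightBendDown {A : D} {x y : 𝒩} (ξ : x ⟶ y ⊙ᵣ A) : x ⊙ᵣ (ᘁA) ⟶ y :=
  ξ ⊵ᵣ (ᘁA) ≫ (αᵣ y A (ᘁA)).inv ≫ y ⊴ᵣ (ε_ (ᘁA) A) ≫ (ρᵣ y).hom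

/-- Bending the leg `A` of a fusion vertex up. -/
def rightBendUp {A : D} {x y : 𝒩} (ξ : x ⊙ᵣ A ⟶ y) : x ⟶ y ⊙ᵣ (ᘁA) :=
  (ρᵣ x).inv ≫ x ⊴ᵣ rightCup A ≫ (αᵣ x A (ᘁA)).hom ≫ ξ ⊵ᵣ (ᘁA)

/-- The structure maps of `H` are the diagrammatic ones. -/
structure IsRightTubeStructure [Fintype J] (H : CStarWeakHopfAlgebra (RightTube S N)) :
    Prop where
  /-- The unit is the sum of all diagrams with a vacuum arc. -/
  one_eq : ∀ t : Decomposition S (𝟙_ D),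
    H.one = ∑ x : J, ∑ y : J, rightArc S N t (ρᵣ (N x)).inv (ρᵣ (N y)).hom
  /-- The product puts the second diagram into the gap of the first one. -/
  mul_eq : ∀ (b b' : I) (t : Decomposition S (S b' ⊗ S b)) {d e f g d' e' f' g' : J}
    (ν : N d ⟶ N e ⊙ᵣ S b) (ζ : N f ⊙ᵣ S b ⟶ N g)
    (ν' : N d' ⟶ N e' ⊙ᵣ S b') (ζ' : N f' ⊙ᵣ S b' ⟶ N g'),
    H.mul (rightDiagram S N b ν ζ) (rightDiagram S N b' ν' ζ') =
      rightArc S N t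
        (ν ≫ (kron N e d' ≫ ν') ⊵ᵣ S b ≫ (αᵣ (N e') (S b') (S b)).inv)
        ((αᵣ (N f') (S b') (S b)).hom ≫ (ζ' ≫ kron N g' f) ⊵ᵣ S b ≫ ζ)
  /-- The counit is `δ_{e,f} δ_{d,g} / d_g` times the value of the closed diagram, that is, the
  scalar by which `ζ ∘ ν` acts on `d = g`. -/
  counit_eq : ∀ (b : I) {d e f g : J} (ν : N d ⟶ N e ⊙ᵣ S b) (ζ : N f ⊙ᵣ S b ⟶ N g),
    H.counit (rightDiagram S N b ν ζ) • 𝟙 (N d) = ν ≫ kron N e f ⊵ᵣ S b ≫ ζ ≫ kron N g d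
  /-- The counit on normalised vertices. -/
  counit_normalised : ∀ (b : I) (x y : J)
    (B : VertexBasis (N y) (N x ⊙ᵣ S b) (rightNorm S N b x y)) (s t : Fin B.n),
    H.counit (rightDiagram S N b (B.vec s) (dagger (B.vec t))) =
      if s = t then (rightNorm S N b x y : ℂ) else 0
  comul_eq : ∀ (b : I)
    (B : ∀ i j : J, VertexBasis (N j) (N i ⊙ᵣ S b) (rightNorm S N b i j))
    {d e f g : J} (ν : N d ⟶ N e ⊙ᵣ S b) (ζ : N f ⊙ᵣ S b ⟶ N g),
    H.comul (rightDiagram S N b ν ζ) = ∑ i : J, ∑ j : J, ∑ s : Fin (B i j).n,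
      (Real.sqrt (rightDim S N j / (qdim (S b) * rightDim S N i)) : ℂ) •
        (rightDiagram S N b ((B i j).vec s) ζ ⊗ₜ[ℂ]
          rightDiagram S N b ν (dagger ((B i j).vec s)))
  antipode_eq : ∀ (b : I) (t : Decomposition S (ᘁ(S b))) {d e f g : J}
    (ν : N d ⟶ N e ⊙ᵣ S b) (ζ : N f ⊙ᵣ S b ⟶ N g),
    H.antipode (rightDiagram S N b ν ζ) = ((rightDim S N f / rightDim S N g : ℝ) : ℂ) •
      rightArc S N t (rightBendUp ζ) (rightBendDown ν)
  star_eq : ∀ (b : I) (t : Decomposition S (ᘁ(S b))) {d e f g : J}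
    (ν : N d ⟶ N e ⊙ᵣ S b) (ζ : N f ⊙ᵣ S b ⟶ N g),
    H.star (rightDiagram S N b ν ζ) = ((rightDim S N e / rightDim S N d : ℝ) : ℂ) •
      rightArc S N t (rightBendUp (dagger ν)) (rightBendDown (dagger ζ))

end Right

end BoundaryTube

end

/-! Let W be the formal direct sum of all simple objects of the module category. The tube space is
the coend over A of Hom(W, A ⊙ W) ⊗ Hom(A ⊙ W, W): the arc may carry any object, and a morphism of
arcs slides from one vertex to the other (`arc_natural`). By Schur's lemma simple arcs suffice, so
structure maps are defined on simple arcs; when they come from a dinatural family, the same formula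
holds for every arc (`tubeLift_arc`). The axioms can then be checked with arcs such as A ⊗ B, the
unit or a dual, and no fusion coefficients occur.

The pairing of ν with ζ by the wall trace of ν ≫ ζ is perfect. The counit is this pairing and the
comultiplication inserts its canonical element, so each simple arc contributes a matrix coalgebra.
Since W contains every simple object exactly once, dual bases satisfy ∑ e'ₖ ≫ eₖ = 𝟙
(`sum_covec_comp_vec`). Hence products of dual bases are dual bases (`IsDualPair.vertMul`), which
makes Δ multiplicative; the axioms for ε are expansions in dual bases and those for Δ(1) are
coherence of the unit.

The antipode bends ν down and applies to ζ the transpose `lift` of unbending. This definition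
contains no dimensions, and its axioms are resolutions of the identity combined with zigzags. The
involution is the antipode after reflection ν ⊗ ζ ↦ ζ† ⊗ ν†. For the Hilbert space, a Haar
functional h closes the arc by dual bases of Hom(1, A) and Hom(A, 1). On a simple arc, h(x* y) is a
product of two inner products, and different simple arcs are orthogonal; left multiplication is then
a faithful `*`-representation.

It remains to identify `lift` with bending up times d_f / d_g, which amounts to the existence of a
module trace (`leftDim_mul_scalar_bend`). Balanced duality maps are compatible with †
(`dagger_mate`), so quantum dimensions obey the fusion rules (`sum_qdim_mul_finrank`), and the
dimensions of internal morphism objects from a fixed z form an eigenvector v of the fusion matrices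
(`sum_finrank_mul_homDim`). Bending followed by † is an antilinear bijection between the vertices M
j ⟶ A ⊙ M i and M i ⟶ A' ⊙ M j. A weighted sum of squares comparing it with its inverse vanishes by
the eigenvector equations for A and A', so it is antiunitary up to the ratio of v j and v i.
Comparing z = M i with z = M j turns this ratio into that of the square roots d_j and d_i.

The right tube algebra is the left one over the category with reversed tensor product; the quantum
dimensions agree because they do not depend on the balanced dual used. -/

set_option linter.unusedSectionVars false

noncomputable section

namespace BoundaryTube

open UnitaryCategory (dagger)

/-! ### Linear algebra: dual pairs and orthonormal bases -/

/-- `e` and `e'` are dual bases for the pairing `B`. -/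
structure IsDualPair {V U ι : Type*} [AddCommGroup V] [Module ℂ V] [AddCommGroup U] [Module ℂ U]
    [Fintype ι] (B : V →ₗ[ℂ] U →ₗ[ℂ] ℂ) (e : ι → V) (e' : ι → U) : Prop where
  left : ∀ v, ∑ k, B v (e' k) • e k = v
  right : ∀ u, ∑ k, B (e k) u • e' k = u

section DualPair

variable {V U V' U' X ι κ : Type*} [AddCommGroup V] [Module ℂ V] [AddCommGroup U] [Module ℂ U]
  [AddCommGroup V'] [Module ℂ V'] [AddCommGroup U'] [Module ℂ U'] [AddCommMonoid X] [Module ℂ X]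
  [Fintype ι] [Fintype κ]

/-- The canonical element ∑ eₖ ⊗ e'ₖ is basis-free, and a map may be moved across it at the cost of
its transpose. Dinaturality of the comultiplication and of the Haar functional both come from this.
-/
theorem IsDualPair.transpose {B : V →ₗ[ℂ] U →ₗ[ℂ] ℂ} {B' : V' →ₗ[ℂ] U' →ₗ[ℂ] ℂ}
    {e : ι → V} {e' : ι → U} {f : κ → V'} {f' : κ → U'}
    (h : IsDualPair B e e') (h' : IsDualPair B' f f') (F : V →ₗ[ℂ] V') (G : U' →ₗ[ℂ] U)
    (hFG : ∀ v u, B' (F v) u = B v (G u)) (Φ : V' →ₗ[ℂ] U →ₗ[ℂ] X) :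
    ∑ k, Φ (F (e k)) (e' k) = ∑ l, Φ (f l) (G (f' l)) := by
  calc ∑ k, Φ (F (e k)) (e' k) = ∑ k, ∑ l, B' (F (e k)) (f' l) • Φ (f l) (e' k) := by
        refine Finset.sum_congr rfl fun k _ => ?_
        conv_lhs => rw [← h'.left (F (e k))]
        simp
    _ = ∑ l, ∑ k, B (e k) (G (f' l)) • Φ (f l) (e' k) := by
        rw [Finset.sum_comm]
        simp only [hFG]
    _ = ∑ l, Φ (f l) (G (f' l)) := by
        refine Finset.sum_congr rfl fun l _ => ?_
        conv_rhs => rw [← h.right (G (f' l))]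
        simp

theorem IsDualPair.sum_eq {B : V →ₗ[ℂ] U →ₗ[ℂ] ℂ}
    {e : ι → V} {e' : ι → U} {f : κ → V} {f' : κ → U}
    (h : IsDualPair B e e') (h' : IsDualPair B f f') (Φ : V →ₗ[ℂ] U →ₗ[ℂ] X) :
    ∑ k, Φ (e k) (e' k) = ∑ l, Φ (f l) (f' l) :=
  h.transpose h' LinearMap.id LinearMap.id (fun _ _ => rfl) Φ

theorem exists_isDualPair [FiniteDimensional ℂ V] [FiniteDimensional ℂ U]
    (B : V →ₗ[ℂ] U →ₗ[ℂ] ℂ) (hl : ∀ v, (∀ u, B v u = 0) → v = 0)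
    (hr : ∀ u, (∀ v, B v u = 0) → u = 0) :
    ∃ (e : Fin (Module.finrank ℂ V) → V) (e' : Fin (Module.finrank ℂ V) → U),
      IsDualPair B e e' := by
  let b := Module.finBasis ℂ V
  have hinj : Function.Injective B.flip := by
    rw [injective_iff_map_eq_zero]
    intro u hu
    exact hr u fun v => by simpa using LinearMap.congr_fun hu v
  have hinj' : Function.Injective B := by
    rw [injective_iff_map_eq_zero]
    intro v hv
    exact hl v fun u => by simpa using LinearMap.congr_fun hv u
  have h1 := LinearMap.finrank_le_finrank_of_injective hinj
  have h2 := LinearMap.finrank_le_finrank_of_injective hinj'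
  rw [Subspace.dual_finrank_eq] at h1 h2
  -- The two injections force equal dimensions, so every coordinate functional of the basis `b` is
  -- represented by a vector of U; these vectors form the dual basis.
  have hsurj : Function.Surjective B.flip :=
    (LinearMap.injective_iff_surjective_of_finrank_eq_finrank
      (by rw [Subspace.dual_finrank_eq]; omega)).1 hinj
  choose e' he' using fun k => hsurj (b.coord k)
  have key : ∀ v k, B v (e' k) = b.coord k v := fun v k => by
    rw [← he']; rfl
  refine ⟨b, e', ⟨fun v => ?_, fun u => ?_⟩⟩
  · simp only [key, Module.Basis.coord_apply]
    exact b.sum_repr v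
  · apply hinj
    apply b.ext
    intro i
    simp [key, Finsupp.single_apply]

theorem IsDualPair.finrank_eq [FiniteDimensional ℂ V] [FiniteDimensional ℂ U]
    (B : V →ₗ[ℂ] U →ₗ[ℂ] ℂ) (hl : ∀ v, (∀ u, B v u = 0) → v = 0)
    (hr : ∀ u, (∀ v, B v u = 0) → u = 0) : Module.finrank ℂ V = Module.finrank ℂ U := by
  have hinj : Function.Injective B.flip := by
    rw [injective_iff_map_eq_zero]
    intro u hu
    exact hr u fun v => by simpa using LinearMap.congr_fun hu v
  have hinj' : Function.Injective B := by
    rw [injective_iff_map_eq_zero]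
    intro v hv
    exact hl v fun u => by simpa using LinearMap.congr_fun hv u
  have h1 := LinearMap.finrank_le_finrank_of_injective hinj
  have h2 := LinearMap.finrank_le_finrank_of_injective hinj'
  rw [Subspace.dual_finrank_eq] at h1 h2
  omega

theorem exists_orthonormal_basis [FiniteDimensional ℂ V] (B : V →ₗ⋆[ℂ] V →ₗ[ℂ] ℂ)
    (hsymm : ∀ x y, conj (B y x) = B x y) (hnn : ∀ x, 0 ≤ (B x x).re)
    (hdef : ∀ x, B x x = 0 → x = 0) :
    ∃ b : Module.Basis (Fin (Module.finrank ℂ V)) ℂ V,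
      ∀ i j, B (b i) (b j) = if i = j then 1 else 0 := by
  let core : InnerProductSpace.Core ℂ V :=
    { inner := fun x y => B x y
      conj_inner_symm := hsymm
      re_inner_nonneg := hnn
      add_left := fun x y z => by simp
      smul_left := fun x y r => by simp
      definite := hdef }
  let _ : NormedAddCommGroup V := core.toNormedAddCommGroup
  let _ : InnerProductSpace ℂ V := InnerProductSpace.ofCore core.toCore
  let b := stdOrthonormalBasis ℂ V
  refine ⟨b.toBasis, fun i j => ?_⟩
  have := orthonormal_iff_ite.1 b.orthonormal i j
  rw [OrthonormalBasis.coe_toBasis]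
  exact this

end DualPair

/-! ### Unitary categories -/

section Unitary

variable {C : Type*} [Category C] [Preadditive C] [Linear ℂ C]

/-- `scalar` as a linear map. -/
def scalarLin (X : C) : (X ⟶ X) →ₗ[ℂ] ℂ where
  toFun := scalar
  map_add' φ ψ := by
    have : Linear.rightComp ℂ X (φ + ψ) = Linear.rightComp ℂ X φ + Linear.rightComp ℂ X ψ := by
      ext f; simp
    rw [scalar, this, map_add]; rfl
  map_smul' c φ := by
    have : Linear.rightComp ℂ X (c • φ) = c • Linear.rightComp ℂ X φ := by
      ext f; simp
    rw [scalar, this, map_smul]; rfl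

@[simp] theorem scalarLin_apply {X : C} (φ : X ⟶ X) : scalarLin X φ = scalar φ := rfl

theorem scalar_add {X : C} (φ ψ : X ⟶ X) : scalar (φ + ψ) = scalar φ + scalar ψ :=
  (scalarLin X).map_add φ ψ

theorem scalar_smul {X : C} (c : ℂ) (φ : X ⟶ X) : scalar (c • φ) = c * scalar φ :=
  (scalarLin X).map_smul c φ

@[simp] theorem scalar_zero {X : C} : scalar (0 : X ⟶ X) = 0 :=
  (scalarLin X).map_zero

theorem scalar_sum {X : C} {ι : Type*} (s : Finset ι) (φ : ι → (X ⟶ X)) :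
    scalar (∑ i ∈ s, φ i) = ∑ i ∈ s, scalar (φ i) :=
  map_sum (scalarLin X) φ s

theorem scalar_id {X : C} (hX : Module.finrank ℂ (X ⟶ X) = 1) : scalar (𝟙 X) = 1 := by
  have : Linear.rightComp ℂ X (𝟙 X) = LinearMap.id := by ext f; simp
  have : Module.Finite ℂ (X ⟶ X) := Module.finite_of_finrank_pos (by omega)
  rw [scalar, ‹Linear.rightComp ℂ X (𝟙 X) = _›, LinearMap.trace_id, hX]; simp

theorem scalar_smul_id {X : C} (hX : Module.finrank ℂ (X ⟶ X) = 1) (c : ℂ) :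
    scalar (c • 𝟙 X) = c := by
  rw [scalar_smul, scalar_id hX, mul_one]

theorem id_ne_zero {X : C} (hX : Module.finrank ℂ (X ⟶ X) = 1) : 𝟙 X ≠ 0 := by
  intro h
  have := scalar_id hX
  rw [h, scalar_zero] at this
  exact zero_ne_one this

theorem scalar_comp {X : C} (hX : Module.finrank ℂ (X ⟶ X) = 1) (φ ψ : X ⟶ X) :
    scalar (φ ≫ ψ) = scalar φ * scalar ψ := by
  rw [eq_scalar_smul_id hX φ, eq_scalar_smul_id hX ψ]
  simp [scalar_smul, scalar_id hX, mul_comm]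

theorem scalar_eq_zero {X : C} (hX : Module.finrank ℂ (X ⟶ X) = 1) {φ : X ⟶ X}
    (h : scalar φ = 0) : φ = 0 := by
  rw [eq_scalar_smul_id hX φ, h, zero_smul]

/-- Both scalars multiply f in f ≫ g ≫ f, so they agree unless f = 0. -/
theorem scalar_comp_comm {X Y : C} (hX : Module.finrank ℂ (X ⟶ X) = 1)
    (hY : Module.finrank ℂ (Y ⟶ Y) = 1) (f : X ⟶ Y) (g : Y ⟶ X) :
    scalar (f ≫ g) = scalar (g ≫ f) := by
  have h1 : (f ≫ g) ≫ f = f ≫ (g ≫ f) := Category.assoc _ _ _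
  conv_lhs at h1 => rw [eq_scalar_smul_id hX (f ≫ g)]
  conv_rhs at h1 => rw [eq_scalar_smul_id hY (g ≫ f)]
  simp only [Linear.smul_comp, Linear.comp_smul, Category.id_comp, Category.comp_id] at h1
  by_cases hf : f = 0
  · simp [hf]
  · exact smul_left_injective ℂ hf h1

/-- Morphisms out of simple objects are jointly epic. -/
theorem IsIrr.hom_ext {I : Type*} {S : I → C} (hS : IsIrr S) {Y Z : C} {g g' : Y ⟶ Z}
    (h : ∀ a (f : S a ⟶ Y), f ≫ g = f ≫ g') : g = g' := by
  obtain ⟨t⟩ := hS.semisimple Y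
  rw [← Category.id_comp g, ← Category.id_comp g', ← t.sum_proj_inc]
  simp only [Preadditive.sum_comp, Category.assoc, h]

variable [UnitaryCategory C]

theorem dagger_injective {X Y : C} : Function.Injective (dagger : (X ⟶ Y) → (Y ⟶ X)) :=
  Function.LeftInverse.injective UnitaryCategory.dagger_dagger

@[simp] theorem dagger_zero {X Y : C} : dagger (0 : X ⟶ Y) = 0 := by
  have := UnitaryCategory.dagger_add (0 : X ⟶ Y) 0
  simpa using this

theorem dagger_sum {X Y : C} {ι : Type*} (s : Finset ι) (f : ι → (X ⟶ Y)) :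
    dagger (∑ i ∈ s, f i) = ∑ i ∈ s, dagger (f i) := by
  classical
  induction s using Finset.induction_on with
  | empty => simp
  | insert a s ha ih => rw [Finset.sum_insert ha, Finset.sum_insert ha,
      UnitaryCategory.dagger_add, ih]

theorem scalar_dagger {X : C} (hX : Module.finrank ℂ (X ⟶ X) = 1) (φ : X ⟶ X) :
    scalar (dagger φ) = conj (scalar φ) := by
  conv_lhs => rw [eq_scalar_smul_id hX φ]
  rw [UnitaryCategory.dagger_smul, UnitaryCategory.dagger_id, scalar_smul_id hX]

theorem eq_zero_of_dagger_comp {X Y : C} (f : X ⟶ Y) (h : dagger f ≫ f = 0) : f = 0 := by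
  have h2 := UnitaryCategory.eq_zero_of_comp_dagger (dagger f)
    (by rw [UnitaryCategory.dagger_dagger]; exact h)
  rw [← UnitaryCategory.dagger_dagger f, h2, dagger_zero]

/-- `f† ∘ f` is a nonnegative multiple of the identity. -/
theorem exists_comp_dagger_eq {X Y : C} (hX : Module.finrank ℂ (X ⟶ X) = 1) (f : X ⟶ Y) :
    ∃ r : ℝ, 0 ≤ r ∧ (r = 0 → f = 0) ∧ scalar (f ≫ dagger f) = r := by
  obtain ⟨g, hg⟩ := UnitaryCategory.comp_dagger_pos f
  -- The C*-condition replaces f by an endomorphism g of the simple object X, where the value is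
  -- visibly |g|².
  have h1 : scalar (f ≫ dagger f) = ((‖scalar g‖ ^ 2 : ℝ) : ℂ) := by
    rw [hg, scalar_comp hX, scalar_dagger hX, Complex.mul_conj, Complex.normSq_eq_norm_sq]
  refine ⟨_, by positivity, fun h => ?_, h1⟩
  rw [h] at h1
  exact UnitaryCategory.eq_zero_of_comp_dagger f (scalar_eq_zero hX (by simpa using h1))

theorem scalar_comp_dagger_re_nonneg {X Y : C} (hX : Module.finrank ℂ (X ⟶ X) = 1) (f : X ⟶ Y) :
    0 ≤ (scalar (f ≫ dagger f)).re := by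
  obtain ⟨r, h0, -, h⟩ := exists_comp_dagger_eq hX f
  rw [h]; simpa using h0

theorem eq_zero_of_scalar_comp_dagger {X Y : C} (hX : Module.finrank ℂ (X ⟶ X) = 1) (f : X ⟶ Y)
    (h : scalar (f ≫ dagger f) = 0) : f = 0 :=
  UnitaryCategory.eq_zero_of_comp_dagger f (scalar_eq_zero hX h)

/-- Schur's lemma: a nonzero morphism between simple objects is invertible. -/
theorem exists_iso_of_ne_zero {X Y : C} (hX : Module.finrank ℂ (X ⟶ X) = 1)
    (hY : Module.finrank ℂ (Y ⟶ Y) = 1) (f : X ⟶ Y) (hf : f ≠ 0) : Nonempty (X ≅ Y) := by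
  have h1 : scalar (f ≫ dagger f) ≠ 0 := fun h => hf (eq_zero_of_scalar_comp_dagger hX f h)
  have h2 : scalar (dagger f ≫ f) = scalar (f ≫ dagger f) := (scalar_comp_comm hX hY _ _).symm
  refine ⟨⟨f, (scalar (f ≫ dagger f))⁻¹ • dagger f, ?_, ?_⟩⟩
  · rw [Linear.comp_smul, eq_scalar_smul_id hX (f ≫ dagger f), scalar_smul_id hX, smul_smul,
      inv_mul_cancel₀ h1, one_smul]
  · rw [Linear.smul_comp, eq_scalar_smul_id hY (dagger f ≫ f), h2, smul_smul,
      inv_mul_cancel₀ h1, one_smul]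

theorem IsIrr.hom_eq_zero {I : Type*} {S : I → C} (hS : IsIrr S) {a b : I} (h : a ≠ b)
    (f : S a ⟶ S b) : f = 0 := by
  by_contra hf
  exact h (hS.eq_of_iso a b (exists_iso_of_ne_zero (hS.simple a) (hS.simple b) f hf))

/-- An orthonormal basis of `Hom(X, Y)` for a simple object `X`. -/
theorem exists_onb {X Y : C} (hX : Module.finrank ℂ (X ⟶ X) = 1)
    [FiniteDimensional ℂ (X ⟶ Y)] :
    ∃ e : Fin (Module.finrank ℂ (X ⟶ Y)) → (X ⟶ Y),
      (∀ s t, e s ≫ dagger (e t) = if s = t then 𝟙 X else 0) ∧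
      ∀ f, f = ∑ s, scalar (f ≫ dagger (e s)) • e s := by
  let B : (X ⟶ Y) →ₗ⋆[ℂ] (X ⟶ Y) →ₗ[ℂ] ℂ := LinearMap.mk₂'ₛₗ (starRingEnd ℂ) (RingHom.id ℂ)
    (fun f g => scalar (g ≫ dagger f))
    (fun f f' g => by rw [UnitaryCategory.dagger_add, Preadditive.comp_add, scalar_add])
    (fun c f g => by rw [UnitaryCategory.dagger_smul, Linear.comp_smul, scalar_smul]; rfl)
    (fun f g g' => by rw [Preadditive.add_comp, scalar_add])
    (fun c f g => by rw [Linear.smul_comp, scalar_smul]; rfl)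
  have hB : ∀ f g, B f g = scalar (g ≫ dagger f) := fun _ _ => rfl
  obtain ⟨b, hb⟩ := exists_orthonormal_basis B
    (fun f g => by rw [hB, hB, ← scalar_dagger hX, UnitaryCategory.dagger_comp,
      UnitaryCategory.dagger_dagger])
    (fun f => scalar_comp_dagger_re_nonneg hX f)
    (fun f h => eq_zero_of_scalar_comp_dagger hX f h)
  refine ⟨b, fun s t => ?_, fun f => ?_⟩
  · rw [eq_scalar_smul_id hX (b s ≫ dagger (b t)), ← hB, hb]
    by_cases h : s = t
    · simp [h]
    · simp [h, Ne.symm h]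
  · conv_lhs => rw [← b.sum_repr f]
    refine Finset.sum_congr rfl fun s _ => ?_
    congr 1
    rw [← hB]
    conv_rhs => rw [← b.sum_repr f]
    simp only [map_sum, map_smul, hb]
    simp

/-- The pairing `Hom(X, Y) × Hom(Y, X) → ℂ` for a simple object `X`. -/
def homPairing (X Y : C) : (X ⟶ Y) →ₗ[ℂ] (Y ⟶ X) →ₗ[ℂ] ℂ :=
  LinearMap.mk₂ ℂ (fun f g => scalar (f ≫ g))
    (fun f f' g => by rw [Preadditive.add_comp, scalar_add])
    (fun c f g => by rw [Linear.smul_comp, scalar_smul]; rfl)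
    (fun f g g' => by rw [Preadditive.comp_add, scalar_add])
    (fun c f g => by rw [Linear.comp_smul, scalar_smul]; rfl)

/-- The composition pairing is nondegenerate on both sides, since each morphism pairs nontrivially
with its own adjoint. -/
theorem finrank_hom_comm {X Y : C} (hX : Module.finrank ℂ (X ⟶ X) = 1)
    [FiniteDimensional ℂ (X ⟶ Y)] [FiniteDimensional ℂ (Y ⟶ X)] :
    Module.finrank ℂ (X ⟶ Y) = Module.finrank ℂ (Y ⟶ X) := by
  refine IsDualPair.finrank_eq (homPairing X Y) (fun f h => ?_) (fun g h => ?_)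
  · exact eq_zero_of_scalar_comp_dagger hX f (h (dagger f))
  · have h1 : scalar (dagger g ≫ g) = 0 := h (dagger g)
    refine eq_zero_of_dagger_comp g ?_
    rw [eq_scalar_smul_id hX (dagger g ≫ g), h1, zero_smul]

/-- The identity of `Y` is the sum of the projections onto its simple constituents. -/
theorem IsIrr.sum_onb {I : Type*} [Fintype I] {S : I → C} (hS : IsIrr S) {Y : C} {n : I → ℕ}
    (e : ∀ a, Fin (n a) → (S a ⟶ Y))
    (he : ∀ a f, f = ∑ s, scalar (f ≫ dagger (e a s)) • e a s) :
    ∑ a, ∑ s, dagger (e a s) ≫ e a s = 𝟙 Y := by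
  classical
  obtain ⟨t⟩ := hS.semisimple Y
  -- By Schur's lemma only the summand a = b sees f, and there the sum is the expansion `he` of f.
  have key : ∀ (b : I) (f : S b ⟶ Y), f ≫ ∑ a, ∑ s, dagger (e a s) ≫ e a s = f := by
    intro b f
    rw [Preadditive.comp_sum, Finset.sum_eq_single b]
    · rw [Preadditive.comp_sum]
      conv_rhs => rw [he b f]
      refine Finset.sum_congr rfl fun s _ => ?_
      rw [← Category.assoc, eq_scalar_smul_id (hS.simple b) (f ≫ dagger (e b s)),
        Linear.smul_comp, Category.id_comp, scalar_smul_id (hS.simple b)]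
    · intro a _ hab
      rw [Preadditive.comp_sum]
      refine Finset.sum_eq_zero fun s _ => ?_
      rw [← Category.assoc, hS.hom_eq_zero hab.symm (f ≫ _), Limits.zero_comp]
    · simp
  calc _ = (∑ s, t.proj s ≫ t.inc s) ≫ ∑ a, ∑ s, dagger (e a s) ≫ e a s := by
        rw [t.sum_proj_inc, Category.id_comp]
    _ = ∑ s, t.proj s ≫ t.inc s := by
        rw [Preadditive.sum_comp]
        refine Finset.sum_congr rfl fun s _ => ?_
        rw [Category.assoc, key]
    _ = 𝟙 Y := t.sum_proj_inc

end Unitary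

end BoundaryTube

end

noncomputable section

namespace BoundaryTube

open UnitaryCategory (dagger)

/-! ### Bilinear actions -/

section Action

variable {D ℳ : Type*} [Category D] [Preadditive D] [Linear ℂ D]
    [MonoidalCategory D] [UnitaryCategory D] [Category ℳ] [Preadditive ℳ] [Linear ℂ ℳ]
    [UnitaryCategory ℳ] [MonoidalLeftAction D ℳ] [UnitaryLeftModule D ℳ]

/-- The action of an object on morphisms as a linear map. -/
def actRight (A : D) (x y : ℳ) : (x ⟶ y) →ₗ[ℂ] (A ⊙ₗ x ⟶ A ⊙ₗ y) where
  toFun f := A ⊴ₗ f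
  map_add' := UnitaryLeftModule.action_add A
  map_smul' := UnitaryLeftModule.action_smul A

/-- The action of morphisms on an object as a linear map. -/
def actLeft (A B : D) (x : ℳ) : (A ⟶ B) →ₗ[ℂ] (A ⊙ₗ x ⟶ B ⊙ₗ x) where
  toFun f := f ⊵ₗ x
  map_add' f g := UnitaryLeftModule.add_action f g x
  map_smul' c f := UnitaryLeftModule.smul_action c f x

@[simp] theorem action_zero (A : D) {x y : ℳ} : A ⊴ₗ (0 : x ⟶ y) = 0 :=
  (actRight A x y).map_zero

theorem action_sum (A : D) {x y : ℳ} {ι : Type*} (s : Finset ι) (f : ι → (x ⟶ y)) :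
    A ⊴ₗ (∑ i ∈ s, f i) = ∑ i ∈ s, A ⊴ₗ f i :=
  map_sum (actRight A x y) f s

theorem sum_action {A B : D} (x : ℳ) {ι : Type*} (s : Finset ι) (f : ι → (A ⟶ B)) :
    (∑ i ∈ s, f i) ⊵ₗ x = ∑ i ∈ s, f i ⊵ₗ x :=
  map_sum (actLeft A B x) f s

theorem dagger_actionHomRight (A : D) {x y : ℳ} (f : x ⟶ y) :
    dagger (A ⊴ₗ f) = A ⊴ₗ dagger f := by
  rw [← MonoidalLeftAction.id_actionHom, UnitaryLeftModule.dagger_action,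
    UnitaryCategory.dagger_id, MonoidalLeftAction.id_actionHom]

theorem dagger_actionHomLeft {A B : D} (f : A ⟶ B) (x : ℳ) :
    dagger (f ⊵ₗ x) = dagger f ⊵ₗ x := by
  rw [← MonoidalLeftAction.actionHom_id, UnitaryLeftModule.dagger_action,
    UnitaryCategory.dagger_id, MonoidalLeftAction.actionHom_id]

theorem dagger_actionAssoc_inv (A B : D) (x : ℳ) : dagger (αₗ A B x).inv = (αₗ A B x).hom := by
  rw [← UnitaryLeftModule.dagger_actionAssoc, UnitaryCategory.dagger_dagger]

end Action

/-! ### Formal direct sums -/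

/-- Formal direct sums of families of objects indexed by `J`, with matrices of morphisms. -/
structure Fam (J ℳ : Type*) where
  obj : J → ℳ

namespace Fam

section Cat

variable {J ℳ : Type*} [Fintype J] [DecidableEq J] [Category ℳ] [Preadditive ℳ]

/-- Matrices of morphisms. -/
@[ext] structure Hom (X Y : Fam J ℳ) where
  app : ∀ i j : J, X.obj i ⟶ Y.obj j

instance : Category (Fam J ℳ) where
  Hom X Y := Hom X Y
  id X := ⟨fun i j => kron X.obj i j⟩
  comp f g := ⟨fun i k => ∑ j, f.app i j ≫ g.app j k⟩
  id_comp {X Y} f := by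
    refine Hom.ext (funext fun i => funext fun k => ?_)
    dsimp only
    rw [Finset.sum_eq_single i]
    · simp [kron]
    · intro j _ hj; simp [kron, Ne.symm hj]
    · simp
  comp_id {X Y} f := by
    refine Hom.ext (funext fun i => funext fun k => ?_)
    dsimp only
    rw [Finset.sum_eq_single k]
    · simp [kron]
    · intro j _ hj; simp [kron, hj]
    · simp
  assoc f g h := by
    refine Hom.ext (funext fun i => funext fun k => ?_)
    simp only [Preadditive.sum_comp, Preadditive.comp_sum, Category.assoc]
    exact Finset.sum_comm

/-- The entries of a morphism of formal sums. -/
def ent {X Y : Fam J ℳ} (f : X ⟶ Y) (i j : J) : X.obj i ⟶ Y.obj j := Hom.app f i j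

/-- The morphism of formal sums with given entries. -/
def ofEnt {X Y : Fam J ℳ} (f : ∀ i j : J, X.obj i ⟶ Y.obj j) : X ⟶ Y := Hom.mk f

@[simp] theorem mk_ent {X Y : Fam J ℳ} (f : ∀ i j : J, X.obj i ⟶ Y.obj j) (i j : J) :
    ent (ofEnt f) i j = f i j := rfl

@[ext] theorem hom_ext {X Y : Fam J ℳ} {f g : X ⟶ Y} (h : ∀ i j, ent f i j = ent g i j) :
    f = g :=
  Hom.ext (funext fun i => funext fun j => h i j)

theorem comp_apply {X Y Z : Fam J ℳ} (f : X ⟶ Y) (g : Y ⟶ Z) (i k : J) :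
    ent (f ≫ g) i k = ∑ j, ent f i j ≫ ent g j k := rfl

theorem id_apply (X : Fam J ℳ) (i j : J) : ent (𝟙 X) i j = kron X.obj i j := rfl

/-- Morphisms of formal sums are the same as matrices. -/
def entEquiv (X Y : Fam J ℳ) : (X ⟶ Y) ≃ (∀ i j : J, X.obj i ⟶ Y.obj j) where
  toFun f := ent f
  invFun := ofEnt
  left_inv _ := rfl
  right_inv _ := rfl

instance (X Y : Fam J ℳ) : AddCommGroup (X ⟶ Y) := (entEquiv X Y).addCommGroup

@[simp] theorem add_apply {X Y : Fam J ℳ} (f g : X ⟶ Y) (i j : J) :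
    ent (f + g) i j = ent f i j + ent g i j := rfl

@[simp] theorem zero_apply {X Y : Fam J ℳ} (i j : J) : ent (0 : X ⟶ Y) i j = 0 := rfl

instance : Preadditive (Fam J ℳ) where
  add_comp X Y Z f g h := by
    ext i k; simp [comp_apply, Finset.sum_add_distrib]
  comp_add X Y Z f g h := by
    ext i k; simp [comp_apply, Finset.sum_add_distrib]

theorem sum_apply {X Y : Fam J ℳ} {ι : Type*} (s : Finset ι) (f : ι → (X ⟶ Y)) (i j : J) :
    ent (∑ k ∈ s, f k) i j = ∑ k ∈ s, ent (f k) i j := by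
  classical
  induction s using Finset.induction_on with
  | empty => simp
  | insert a s ha ih => rw [Finset.sum_insert ha, Finset.sum_insert ha, add_apply, ih]

/-- The diagonal matrix with the given entries. -/
def diag {X Y : Fam J ℳ} (φ : ∀ j : J, X.obj j ⟶ Y.obj j) : X ⟶ Y :=
  ofEnt fun i j => if h : i = j then φ i ≫ eqToHom (congrArg Y.obj h) else 0

@[simp] theorem diag_self {X Y : Fam J ℳ} (φ : ∀ j : J, X.obj j ⟶ Y.obj j) (i : J) :
    ent (diag φ) i i = φ i := by simp [diag]

theorem diag_ne {X Y : Fam J ℳ} (φ : ∀ j : J, X.obj j ⟶ Y.obj j) {i j : J} (h : i ≠ j) :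
    ent (diag φ) i j = 0 := by simp [diag, h]

@[simp] theorem diag_comp_apply {X Y Z : Fam J ℳ} (φ : ∀ j : J, X.obj j ⟶ Y.obj j) (f : Y ⟶ Z) (i k : J) :
    ent (diag φ ≫ f) i k = φ i ≫ ent f i k := by
  rw [comp_apply, Finset.sum_eq_single i]
  · simp
  · intro j _ hj; simp [diag_ne φ (Ne.symm hj)]
  · simp

@[simp] theorem comp_diag_apply {X Y Z : Fam J ℳ} (φ : ∀ j : J, Y.obj j ⟶ Z.obj j) (f : X ⟶ Y) (i k : J) :
    ent (f ≫ diag φ) i k = ent f i k ≫ φ k := by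
  rw [comp_apply, Finset.sum_eq_single k]
  · simp
  · intro j _ hj; simp [diag_ne φ hj]
  · simp

theorem id_eq_diag (X : Fam J ℳ) : 𝟙 X = diag fun j => 𝟙 (X.obj j) := by
  ext i j
  rw [id_apply]
  simp [kron, diag]

theorem diag_comp_diag {X Y Z : Fam J ℳ} (φ : ∀ j : J, X.obj j ⟶ Y.obj j) (ψ : ∀ j : J, Y.obj j ⟶ Z.obj j) :
    diag φ ≫ diag ψ = diag fun j => φ j ≫ ψ j := by
  ext i j
  by_cases h : i = j
  · subst h; simp
  · simp [diag_ne _ h]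

variable [Linear ℂ ℳ]

instance (X Y : Fam J ℳ) : Module ℂ (X ⟶ Y) := (entEquiv X Y).module ℂ

@[simp] theorem smul_apply {X Y : Fam J ℳ} (c : ℂ) (f : X ⟶ Y) (i j : J) :
    ent (c • f) i j = c • ent f i j := rfl

instance : Linear ℂ (Fam J ℳ) where
  smul_comp X Y Z c f g := by
    ext i k; simp [comp_apply, Finset.smul_sum]
  comp_smul X Y Z f c g := by
    ext i k; simp [comp_apply, Finset.smul_sum]

/-- The matrix with a single nonzero entry. -/
def single {X Y : Fam J ℳ} (i j : J) : (X.obj i ⟶ Y.obj j) →ₗ[ℂ] (X ⟶ Y) where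
  toFun f := ofEnt (Pi.single i (Pi.single j f))
  map_add' f g := by
    have : Pi.single i (Pi.single j (f + g)) = Pi.single i (Pi.single j f) +
        (Pi.single i (Pi.single j g) : ∀ i j : J, X.obj i ⟶ Y.obj j) := by
      rw [Pi.single_add, Pi.single_add]
    rw [this]; rfl
  map_smul' c f := by
    have : Pi.single i (Pi.single j (c • f)) =
        c • (Pi.single i (Pi.single j f) : ∀ i j : J, X.obj i ⟶ Y.obj j) := by
      rw [Pi.single_smul, Pi.single_smul]
    rw [this]; rfl

@[simp] theorem single_same {X Y : Fam J ℳ} (i j : J) (f : X.obj i ⟶ Y.obj j) :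
    ent (single i j f : X ⟶ Y) i j = f := by
  simp [single]

theorem single_ne_left {X Y : Fam J ℳ} {i i' : J} (h : i' ≠ i) (j j' : J) (f : X.obj i ⟶ Y.obj j) :
    ent (single i j f : X ⟶ Y) i' j' = 0 := by
  simp [single, h]

theorem single_ne_right {X Y : Fam J ℳ} (i i' : J) {j j' : J} (h : j' ≠ j) (f : X.obj i ⟶ Y.obj j) :
    ent (single i j f : X ⟶ Y) i' j' = 0 := by
  by_cases h' : i' = i
  · subst h'; simp [single, h]
  · exact single_ne_left h' _ _ _

theorem sum_single {X Y : Fam J ℳ} (f : X ⟶ Y) : ∑ i, ∑ j, single i j (ent f i j) = f := by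
  ext i j
  simp only [sum_apply]
  rw [Finset.sum_eq_single i, Finset.sum_eq_single j]
  · simp
  · intro j' _ h; exact single_ne_right _ _ h.symm _
  · simp
  · intro i' _ h; exact Finset.sum_eq_zero fun j' _ => single_ne_left h.symm _ _ _
  · simp

end Cat

section Dagger

variable {J ℳ : Type*} [Fintype J] [DecidableEq J] [Category ℳ] [Preadditive ℳ] [Linear ℂ ℳ]
  [UnitaryCategory ℳ]

/-- The conjugate transpose of a matrix of morphisms. -/
def dag {X Y : Fam J ℳ} : (X ⟶ Y) →ₛₗ[starRingEnd ℂ] (Y ⟶ X) where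
  toFun f := ofEnt fun i j => dagger (ent f j i)
  map_add' f g := by ext i j; exact UnitaryCategory.dagger_add _ _
  map_smul' c f := by ext i j; exact UnitaryCategory.dagger_smul _ _

theorem dag_apply {X Y : Fam J ℳ} (f : X ⟶ Y) (i j : J) : ent (dag f) i j = dagger (ent f j i) := rfl

@[simp] theorem dag_dag {X Y : Fam J ℳ} (f : X ⟶ Y) : dag (dag f) = f := by
  ext i j; simp [dag_apply, UnitaryCategory.dagger_dagger]

theorem dag_comp {X Y Z : Fam J ℳ} (f : X ⟶ Y) (g : Y ⟶ Z) : dag (f ≫ g) = dag g ≫ dag f := by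
  ext i j
  simp [dag_apply, comp_apply, dagger_sum, UnitaryCategory.dagger_comp]

theorem dag_diag {X Y : Fam J ℳ} (φ : ∀ j : J, X.obj j ⟶ Y.obj j) :
    dag (diag φ) = diag fun j => dagger (φ j) := by
  ext i j
  by_cases h : i = j
  · subst h; simp [dag_apply]
  · simp [dag_apply, diag_ne _ h, diag_ne _ (Ne.symm h)]

theorem dag_single {X Y : Fam J ℳ} (i j : J) (f : X.obj i ⟶ Y.obj j) :
    dag (single i j f : X ⟶ Y) = single j i (dagger f) := by
  ext a b
  rw [dag_apply]
  by_cases ha : a = j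
  · subst ha
    by_cases hb : b = i
    · subst hb; simp
    · rw [single_ne_left hb, single_ne_right _ _ hb, dagger_zero]
  · rw [single_ne_right _ _ ha, single_ne_left ha, dagger_zero]

end Dagger

section Action

variable {D ℳ J : Type*} [Fintype J] [DecidableEq J] [Category D] [Preadditive D] [Linear ℂ D]
    [MonoidalCategory D] [UnitaryCategory D] [Category ℳ] [Preadditive ℳ] [Linear ℂ ℳ]
    [UnitaryCategory ℳ] [MonoidalLeftAction D ℳ] [UnitaryLeftModule D ℳ]

/-- Isomorphisms act entrywise. -/
def diagIso {X Y : Fam J ℳ} (φ : ∀ j : J, X.obj j ≅ Y.obj j) : X ≅ Y where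
  hom := diag fun j => (φ j).hom
  inv := diag fun j => (φ j).inv
  hom_inv_id := by rw [diag_comp_diag, id_eq_diag]; simp
  inv_hom_id := by rw [diag_comp_diag, id_eq_diag]; simp

instance : MonoidalLeftActionStruct D (Fam J ℳ) where
  actionObj A X := ⟨fun j => A ⊙ₗ X.obj j⟩
  actionHomLeft f X := diag fun j => f ⊵ₗ X.obj j
  actionHomRight A _ _ f := ofEnt fun i j => A ⊴ₗ ent f i j
  actionAssocIso A B X := diagIso fun j => αₗ A B (X.obj j)
  actionUnitIso X := diagIso fun j => λₗ (X.obj j)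

theorem actionObj_apply (A : D) (X : Fam J ℳ) (j : J) : (A ⊙ₗ X).obj j = A ⊙ₗ X.obj j := rfl

theorem actionHomRight_apply (A : D) {X Y : Fam J ℳ} (f : X ⟶ Y) (i j : J) :
    ent (A ⊴ₗ f) i j = A ⊴ₗ ent f i j := rfl

theorem actionHomLeft_eq {A B : D} (f : A ⟶ B) (X : Fam J ℳ) :
    f ⊵ₗ X = diag fun j => f ⊵ₗ X.obj j := rfl

theorem actionAssoc_hom (A B : D) (X : Fam J ℳ) :
    (αₗ A B X).hom = diag fun j => (αₗ A B (X.obj j)).hom := rfl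

theorem actionAssoc_inv (A B : D) (X : Fam J ℳ) :
    (αₗ A B X).inv = diag fun j => (αₗ A B (X.obj j)).inv := rfl

theorem actionUnit_hom (X : Fam J ℳ) :
    (λₗ[D] X).hom = diag fun j => (λₗ (X.obj j)).hom := rfl

theorem actionUnit_inv (X : Fam J ℳ) :
    (λₗ[D] X).inv = diag fun j => (λₗ (X.obj j)).inv := rfl

theorem actionHomRight_diag (A : D) {X Y : Fam J ℳ} (φ : ∀ j : J, X.obj j ⟶ Y.obj j) :
    A ⊴ₗ (diag φ : X ⟶ Y) = diag fun j => A ⊴ₗ φ j := by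
  ext i j
  rw [actionHomRight_apply]
  by_cases h : i = j
  · subst h; simp
  · simp [diag_ne _ h]

theorem actionHom_eq {A B : D} {X Y : Fam J ℳ} (f : A ⟶ B) (g : X ⟶ Y) :
    f ⊙ₗₘ g = f ⊵ₗ X ≫ B ⊴ₗ g := rfl

theorem actionHom_apply {A B : D} {X Y : Fam J ℳ} (f : A ⟶ B) (g : X ⟶ Y) (i j : J) :
    ent (f ⊙ₗₘ g) i j = f ⊙ₗₘ ent g i j := by
  rw [actionHom_eq, actionHomLeft_eq, diag_comp_apply, actionHomRight_apply,
    MonoidalLeftAction.actionHom_def]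

/-- The structure isomorphisms and the morphisms coming from D act diagonally, so each axiom reduces
to the same axiom for every entry. -/
instance : MonoidalLeftAction D (Fam J ℳ) where
  actionHom_def _ _ := rfl
  actionHomRight_id A X := by
    rw [id_eq_diag, actionHomRight_diag, id_eq_diag]; simp; rfl
  id_actionHomLeft A X := by
    rw [actionHomLeft_eq, id_eq_diag]; simp; rfl
  actionHom_comp f₁ f₂ g₁ g₂ := by
    ext i k
    simp only [actionHom_apply, comp_apply]
    rw [MonoidalLeftAction.actionHom_def, action_sum, Preadditive.comp_sum]
    refine Finset.sum_congr rfl fun j _ => ?_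
    rw [← MonoidalLeftAction.actionHom_def, MonoidalLeftAction.actionHom_comp]
  actionAssocIso_hom_naturality f g h := by
    ext i k
    rw [actionAssoc_hom, actionAssoc_hom, comp_diag_apply, diag_comp_apply, actionHom_apply,
      actionHom_apply, actionHom_apply, MonoidalLeftAction.actionAssocIso_hom_naturality]
  actionUnitIso_hom_naturality f := by
    ext i k
    rw [actionUnit_hom, actionUnit_hom, comp_diag_apply, diag_comp_apply, actionHomRight_apply,
      MonoidalLeftAction.actionUnitIso_hom_naturality]
  whiskerLeft_actionHomLeft A _ _ f X := by
    simp only [actionHomLeft_eq, actionHomRight_diag, actionAssoc_hom, actionAssoc_inv,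
      diag_comp_diag, actionObj_apply, MonoidalLeftAction.whiskerLeft_actionHomLeft]
  whiskerRight_actionHomLeft A f X := by
    simp only [actionHomLeft_eq, actionAssoc_hom, actionAssoc_inv,
      diag_comp_diag, actionObj_apply, MonoidalLeftAction.whiskerRight_actionHomLeft]
  associator_actionHom A B E X := by
    simp only [actionHomLeft_eq, actionHomRight_diag, actionAssoc_hom,
      diag_comp_diag, actionObj_apply, MonoidalLeftAction.associator_actionHom]
  leftUnitor_actionHom A X := by
    simp only [actionHomLeft_eq, actionAssoc_hom, actionUnit_hom,
      diag_comp_diag, actionObj_apply, MonoidalLeftAction.leftUnitor_actionHom]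
  rightUnitor_actionHom A X := by
    simp only [actionHomLeft_eq, actionHomRight_diag, actionAssoc_hom, actionUnit_hom,
      diag_comp_diag, actionObj_apply, MonoidalLeftAction.rightUnitor_actionHom]

/-- The action of an object on matrices as a linear map. -/
def actR (A : D) (X Y : Fam J ℳ) : (X ⟶ Y) →ₗ[ℂ] (A ⊙ₗ X ⟶ A ⊙ₗ Y) where
  toFun f := A ⊴ₗ f
  map_add' f g := by ext i j; exact UnitaryLeftModule.action_add A _ _
  map_smul' c f := by ext i j; exact UnitaryLeftModule.action_smul A _ _

@[simp] theorem actR_apply (A : D) {X Y : Fam J ℳ} (f : X ⟶ Y) : actR A X Y f = A ⊴ₗ f := rfl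

/-- The action of morphisms on a family as a linear map. -/
def actL (A B : D) (X : Fam J ℳ) : (A ⟶ B) →ₗ[ℂ] (A ⊙ₗ X ⟶ B ⊙ₗ X) where
  toFun f := f ⊵ₗ X
  map_add' f g := by
    ext i j
    by_cases h : i = j
    · subst h; simp [actionHomLeft_eq, UnitaryLeftModule.add_action]
    · simp [actionHomLeft_eq, diag_ne _ h]
  map_smul' c f := by
    ext i j
    by_cases h : i = j
    · subst h; simp [actionHomLeft_eq, UnitaryLeftModule.smul_action]
    · simp [actionHomLeft_eq, diag_ne _ h]

@[simp] theorem actL_apply {A B : D} (X : Fam J ℳ) (f : A ⟶ B) : actL A B X f = f ⊵ₗ X := rfl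

theorem dag_actR (A : D) {X Y : Fam J ℳ} (f : X ⟶ Y) : dag (A ⊴ₗ f) = A ⊴ₗ dag f := by
  ext i j
  exact dagger_actionHomRight A _

theorem dag_actL {A B : D} (f : A ⟶ B) (X : Fam J ℳ) : dag (f ⊵ₗ X) = dagger f ⊵ₗ X := by
  rw [actionHomLeft_eq, dag_diag, actionHomLeft_eq]
  simp only [dagger_actionHomLeft]

theorem dag_assoc_hom (A B : D) (X : Fam J ℳ) : dag (αₗ A B X).hom = (αₗ A B X).inv := by
  rw [actionAssoc_hom, dag_diag, actionAssoc_inv]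
  simp only [UnitaryLeftModule.dagger_actionAssoc]

theorem dag_assoc_inv (A B : D) (X : Fam J ℳ) : dag (αₗ A B X).inv = (αₗ A B X).hom := by
  rw [← dag_assoc_hom, dag_dag]

theorem dag_unit_hom (X : Fam J ℳ) : dag (λₗ[D] X).hom = (λₗ[D] X).inv := by
  rw [actionUnit_hom, dag_diag, actionUnit_inv]
  simp only [UnitaryLeftModule.dagger_actionUnit]

theorem actionHomRight_sum (A : D) {X Y : Fam J ℳ} {ι : Type*} (s : Finset ι) (f : ι → (X ⟶ Y)) :
    A ⊴ₗ (∑ k ∈ s, f k) = ∑ k ∈ s, A ⊴ₗ f k :=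
  map_sum (actR A X Y) f s

theorem actionHomLeft_sum {A B : D} (X : Fam J ℳ) {ι : Type*} (s : Finset ι) (f : ι → (A ⟶ B)) :
    (∑ k ∈ s, f k) ⊵ₗ X = ∑ k ∈ s, f k ⊵ₗ X :=
  map_sum (actL A B X) f s

theorem actionHomRight_add (A : D) {X Y : Fam J ℳ} (f g : X ⟶ Y) :
    A ⊴ₗ (f + g) = A ⊴ₗ f + A ⊴ₗ g := (actR A X Y).map_add f g

theorem actionHomRight_smul (A : D) {X Y : Fam J ℳ} (c : ℂ) (f : X ⟶ Y) :
    A ⊴ₗ (c • f) = c • A ⊴ₗ f := (actR A X Y).map_smul c f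

theorem actionHomLeft_smul {A B : D} (X : Fam J ℳ) (c : ℂ) (f : A ⟶ B) :
    (c • f) ⊵ₗ X = c • f ⊵ₗ X := (actL A B X).map_smul c f

end Action

end Fam

end BoundaryTube

end

noncomputable section

namespace BoundaryTube

open UnitaryCategory (dagger)

/-! ### Matrices of vertices and diagrams -/

section Tube

variable {D ℳ I J : Type*} [Category D] [Preadditive D] [Linear ℂ D] [MonoidalCategory D]
  [UnitaryCategory D] [Category ℳ] [Preadditive ℳ] [Linear ℂ ℳ]
  [UnitaryCategory ℳ] [MonoidalLeftAction D ℳ] [UnitaryLeftModule D ℳ]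
  [Fintype I] [DecidableEq I] [Fintype J] [DecidableEq J]

namespace Fam

/-- Taking an entry is linear. -/
def entLin {X Y : Fam J ℳ} (i j : J) : (X ⟶ Y) →ₗ[ℂ] (X.obj i ⟶ Y.obj j) where
  toFun f := ent f i j
  map_add' _ _ := rfl
  map_smul' _ _ := rfl

@[simp] theorem entLin_apply {X Y : Fam J ℳ} (i j : J) (f : X ⟶ Y) : entLin i j f = ent f i j :=
  rfl

instance finiteDimensional_hom (X Y : Fam J ℳ)
    [∀ i j, FiniteDimensional ℂ (X.obj i ⟶ Y.obj j)] : FiniteDimensional ℂ (X ⟶ Y) :=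
  Module.Finite.of_injective (LinearMap.pi fun i => LinearMap.pi fun j => entLin i j)
    fun f g h => by
      ext i j
      exact congrFun (congrFun h i) j

theorem single_comp {X Y Z : Fam J ℳ} (i j : J) (f : X.obj i ⟶ Y.obj j) (g : Y ⟶ Z) (k l : J) :
    ent (single i j f ≫ g) k l = ent (single i l (f ≫ ent g j l) : X ⟶ Z) k l := by
  rw [Fam.comp_apply]
  by_cases h : k = i
  · subst h
    rw [Finset.sum_eq_single j]
    · simp
    · intro j' _ hj; rw [single_ne_right _ _ hj, Limits.zero_comp]
    · simp
  · rw [single_ne_left h]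
    exact Finset.sum_eq_zero fun j' _ => by rw [single_ne_left h, Limits.zero_comp]

theorem single_comp_single {X Y Z : Fam J ℳ} (i j k l : J) (f : X.obj i ⟶ Y.obj j)
    (g : Y.obj k ⟶ Z.obj l) :
    (single i j f ≫ single k l g : X ⟶ Z) = single i l (f ≫ kron Y.obj j k ≫ g) := by
  ext a b
  rw [single_comp]
  by_cases hb : b = l
  · subst hb
    congr 2
    by_cases h : j = k
    · subst h; simp [kron]
    · rw [single_ne_left h]; simp [kron, h]
  · rw [single_ne_right _ _ hb, single_ne_right (j := l) _ _ hb, Limits.comp_zero, map_zero,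
      zero_apply]

theorem single_comp_diag {X Y Z : Fam J ℳ} (i j : J) (f : X.obj i ⟶ Y.obj j)
    (φ : ∀ j : J, Y.obj j ⟶ Z.obj j) :
    single i j f ≫ diag φ = (single i j (f ≫ φ j) : X ⟶ Z) := by
  ext a b
  rw [comp_diag_apply]
  by_cases ha : a = i
  · subst ha
    by_cases hb : b = j
    · subst hb; simp
    · rw [single_ne_right _ _ hb, single_ne_right _ _ hb, Limits.zero_comp]
  · rw [single_ne_left ha, single_ne_left ha, Limits.zero_comp]

theorem diag_comp_single {X Y Z : Fam J ℳ} (i j : J) (φ : ∀ j : J, X.obj j ⟶ Y.obj j)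
    (f : Y.obj i ⟶ Z.obj j) :
    diag φ ≫ single i j f = (single i j (φ i ≫ f) : X ⟶ Z) := by
  ext a b
  rw [diag_comp_apply]
  by_cases ha : a = i
  · subst ha
    by_cases hb : b = j
    · subst hb; simp
    · rw [single_ne_right _ _ hb, single_ne_right _ _ hb, Limits.comp_zero]
  · rw [single_ne_left ha, single_ne_left ha, Limits.comp_zero]

theorem actionHomRight_single (A : D) {X Y : Fam J ℳ} (i j : J) (f : X.obj i ⟶ Y.obj j) :
    A ⊴ₗ (single i j f : X ⟶ Y) = (single i j (A ⊴ₗ f) : A ⊙ₗ X ⟶ A ⊙ₗ Y) := by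
  ext a b
  rw [actionHomRight_apply]
  by_cases ha : a = i
  · subst ha
    by_cases hb : b = j
    · subst hb
      rw [single_same]
      exact (single_same (X := A ⊙ₗ X) (Y := A ⊙ₗ Y) a b (A ⊴ₗ f)).symm
    · rw [single_ne_right _ _ hb, action_zero]
      exact (single_ne_right (X := A ⊙ₗ X) (Y := A ⊙ₗ Y) _ _ hb _).symm
  · rw [single_ne_left ha, action_zero]
    exact (single_ne_left (X := A ⊙ₗ X) (Y := A ⊙ₗ Y) ha _ _ _).symm

end Fam

open Fam

variable (S : I → D) (M : J → ℳ)

/-- The formal direct sum of all simple objects. -/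
abbrev fam : Fam J ℳ := ⟨M⟩

/-- Matrices of splitting vertices. -/
abbrev Vert (A : D) := fam M ⟶ A ⊙ₗ fam M

/-- Matrices of fusion vertices. -/
abbrev Covert (A : D) := A ⊙ₗ fam M ⟶ fam M

/-- `leftDiagram` as a bilinear map. -/
def leftDiagramLin (a : I) (d e f g : J) :
    (M d ⟶ S a ⊙ₗ M e) →ₗ[ℂ] (S a ⊙ₗ M f ⟶ M g) →ₗ[ℂ] LeftTube S M :=
  (TensorProduct.mk ℂ _ _).compr₂ (DirectSum.lof ℂ (ArcLabel I J) (fun p =>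
    (M p.2.1 ⟶ S p.1 ⊙ₗ M p.2.2.1) ⊗[ℂ] (S p.1 ⊙ₗ M p.2.2.2.1 ⟶ M p.2.2.2.2)) (a, d, e, f, g))

/-- The diagram with simple arc `a` whose vertices are matrices. -/
def simpleArc (a : I) : Vert M (S a) →ₗ[ℂ] Covert M (S a) →ₗ[ℂ] LeftTube S M :=
  ∑ d : J, ∑ e : J, ∑ f : J, ∑ g : J,
    (leftDiagramLin S M a d e f g).compl₁₂ (entLin (X := fam M) (Y := S a ⊙ₗ fam M) d e)
      (entLin (X := S a ⊙ₗ fam M) (Y := fam M) f g)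

theorem simpleArc_apply (a : I) (ν : Vert M (S a)) (ζ : Covert M (S a)) :
    simpleArc S M a ν ζ = ∑ d : J, ∑ e : J, ∑ f : J, ∑ g : J,
      leftDiagram S M a (ent ν d e) (ent ζ f g) := by
  simp only [simpleArc, LinearMap.sum_apply, LinearMap.compl₁₂_apply]
  rfl

variable {X : Type*} [AddCommMonoid X] [Module ℂ X]

/-- Linear maps out of the tube space are families of bilinear maps. -/
def tubeLift (β : ∀ a, Vert M (S a) →ₗ[ℂ] Covert M (S a) →ₗ[ℂ] X) : LeftTube S M →ₗ[ℂ] X :=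
  DirectSum.toModule ℂ _ X fun p => TensorProduct.lift
    ((β p.1).compl₁₂ (single (X := fam M) (Y := S p.1 ⊙ₗ fam M) p.2.1 p.2.2.1)
      (single (X := S p.1 ⊙ₗ fam M) (Y := fam M) p.2.2.2.1 p.2.2.2.2))

variable {S M}

theorem tubeLift_leftDiagram (β : ∀ a, Vert M (S a) →ₗ[ℂ] Covert M (S a) →ₗ[ℂ] X) (a : I)
    {d e f g : J} (ν : M d ⟶ S a ⊙ₗ M e) (ζ : S a ⊙ₗ M f ⟶ M g) :
    tubeLift S M β (leftDiagram S M a ν ζ) =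
      β a (single (X := fam M) (Y := S a ⊙ₗ fam M) d e ν)
        (single (X := S a ⊙ₗ fam M) (Y := fam M) f g ζ) := by
  rw [tubeLift, leftDiagram, DirectSum.toModule_lof]
  rfl

theorem tubeLift_simpleArc (β : ∀ a, Vert M (S a) →ₗ[ℂ] Covert M (S a) →ₗ[ℂ] X) (a : I)
    (ν : Vert M (S a)) (ζ : Covert M (S a)) : tubeLift S M β (simpleArc S M a ν ζ) = β a ν ζ := by
  rw [simpleArc_apply]
  simp only [map_sum, tubeLift_leftDiagram]
  conv_rhs => rw [← sum_single ν]
  simp only [map_sum, LinearMap.sum_apply]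
  refine Finset.sum_congr rfl fun d _ => Finset.sum_congr rfl fun e _ => ?_
  conv_rhs => rw [← sum_single ζ]
  simp only [map_sum]

theorem leftDiagram_eq_zero_left (a : I) {d e f g : J} (ζ : S a ⊙ₗ M f ⟶ M g) :
    leftDiagram S M a (0 : M d ⟶ S a ⊙ₗ M e) ζ = 0 := by
  rw [leftDiagram, TensorProduct.zero_tmul, map_zero]

theorem leftDiagram_eq_zero_right (a : I) {d e f g : J} (ν : M d ⟶ S a ⊙ₗ M e) :
    leftDiagram S M a ν (0 : S a ⊙ₗ M f ⟶ M g) = 0 := by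
  rw [leftDiagram, TensorProduct.tmul_zero, map_zero]

theorem leftDiagram_eq_simpleArc (a : I) {d e f g : J} (ν : M d ⟶ S a ⊙ₗ M e)
    (ζ : S a ⊙ₗ M f ⟶ M g) :
    leftDiagram S M a ν ζ = simpleArc S M a (single (X := fam M) (Y := S a ⊙ₗ fam M) d e ν)
      (single (X := S a ⊙ₗ fam M) (Y := fam M) f g ζ) := by
  rw [simpleArc_apply, Finset.sum_eq_single d, Finset.sum_eq_single e, Finset.sum_eq_single f,
    Finset.sum_eq_single g, single_same, single_same]
  · intro b _ hb
    rw [single_ne_right _ _ hb, leftDiagram_eq_zero_right]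
  · simp
  · intro b _ hb
    exact Finset.sum_eq_zero fun c _ => by rw [single_ne_left hb, leftDiagram_eq_zero_right]
  · simp
  · intro b _ hb
    exact Finset.sum_eq_zero fun c _ => Finset.sum_eq_zero fun c' _ => by
      rw [single_ne_right _ _ hb, leftDiagram_eq_zero_left]
  · simp
  · intro b _ hb
    exact Finset.sum_eq_zero fun c _ => Finset.sum_eq_zero fun c' _ =>
      Finset.sum_eq_zero fun c'' _ => by rw [single_ne_left hb, leftDiagram_eq_zero_left]
  · simp

theorem tube_induction {P : LeftTube S M → Prop} (h0 : P 0)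
    (hadd : ∀ x y, P x → P y → P (x + y)) (harc : ∀ a ν ζ, P (simpleArc S M a ν ζ))
    (x : LeftTube S M) : P x := by
  refine DirectSum.induction_on x h0 (fun p t => ?_) hadd
  induction t using TensorProduct.induction_on with
  | zero => rw [map_zero]; exact h0
  | tmul ν ζ =>
    have := leftDiagram_eq_simpleArc (S := S) (M := M) p.1 ν ζ
    rw [leftDiagram] at this
    exact this ▸ harc _ _ _
  | add t t' h h' => rw [map_add]; exact hadd _ _ h h'

theorem tube_hom_ext {F G : LeftTube S M →ₗ[ℂ] X}
    (h : ∀ a ν ζ, F (simpleArc S M a ν ζ) = G (simpleArc S M a ν ζ)) : F = G := by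
  refine LinearMap.ext fun x => ?_
  refine tube_induction (P := fun x => F x = G x) (by simp) (fun x y hx hy => ?_) h x
  rw [map_add, map_add, hx, hy]

/-! ### Arcs labelled by arbitrary objects -/

/-- Postcomposition of splitting vertices with a morphism of arcs. -/
abbrev pushVert (M : J → ℳ) {A B : D} (f : A ⟶ B) : Vert M A →ₗ[ℂ] Vert M B :=
  Linear.rightComp ℂ _ (f ⊵ₗ fam M)

/-- Precomposition of fusion vertices with a morphism of arcs. -/
abbrev pullCovert (M : J → ℳ) {A B : D} (f : A ⟶ B) : Covert M B →ₗ[ℂ] Covert M A :=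
  Linear.leftComp ℂ _ (f ⊵ₗ fam M)

/-- The diagram with arc `A`, evaluated by means of a decomposition of `A`. -/
def arcOf (M : J → ℳ) {A : D} (t : Decomposition S A) :
    Vert M A →ₗ[ℂ] Covert M A →ₗ[ℂ] LeftTube S M :=
  ∑ s, (simpleArc S M (t.label s)).compl₁₂ (pushVert M (t.proj s)) (pullCovert M (t.inc s))

theorem arcOf_apply {A : D} (t : Decomposition S A) (ν : Vert M A) (ζ : Covert M A) :
    arcOf M t ν ζ = ∑ s, simpleArc S M (t.label s) (ν ≫ t.proj s ⊵ₗ fam M)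
      (t.inc s ⊵ₗ fam M ≫ ζ) := by
  simp only [arcOf, LinearMap.sum_apply, LinearMap.compl₁₂_apply]
  rfl

section Naturality

variable [hS : Fact (IsIrr S)]

/-- By Schur's lemma g is a scalar, which crosses the tensor product, or zero. -/
theorem simpleArc_natural {a b : I} (g : S a ⟶ S b) (ν : Vert M (S a)) (ζ : Covert M (S b)) :
    simpleArc S M a ν (g ⊵ₗ fam M ≫ ζ) = simpleArc S M b (ν ≫ g ⊵ₗ fam M) ζ := by
  by_cases h : a = b
  · subst h
    rw [eq_scalar_smul_id (hS.out.simple a) g, actionHomLeft_smul,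
      MonoidalLeftAction.id_actionHomLeft]
    simp
  · have h0 : (0 : S a ⟶ S b) ⊵ₗ fam M = 0 := (actL (S a) (S b) (fam M)).map_zero
    rw [hS.out.hom_eq_zero h g, h0]
    simp

/-- Inserting both decompositions turns f into a matrix of morphisms between simple arcs, each of
which slides across. The case f = 𝟙 shows independence of the decomposition. -/
theorem arcOf_natural {A B : D} (t : Decomposition S A) (t' : Decomposition S B) (f : A ⟶ B)
    (ν : Vert M A) (ζ : Covert M B) :
    arcOf M t ν (f ⊵ₗ fam M ≫ ζ) = arcOf M t' (ν ≫ f ⊵ₗ fam M) ζ := by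
  have h1 : ∀ s, t.inc s ⊵ₗ fam M ≫ f ⊵ₗ fam M ≫ ζ =
      ∑ r, (t.inc s ≫ f ≫ t'.proj r) ⊵ₗ fam M ≫ t'.inc r ⊵ₗ fam M ≫ ζ := by
    intro s
    simp only [← MonoidalLeftAction.comp_actionHomLeft_assoc, Category.assoc,
      ← Preadditive.sum_comp, ← actionHomLeft_sum, ← Preadditive.comp_sum, t'.sum_proj_inc,
      Category.comp_id]
  have h2 : ∀ r, ν ≫ f ⊵ₗ fam M ≫ t'.proj r ⊵ₗ fam M =
      ∑ s, ν ≫ t.proj s ⊵ₗ fam M ≫ (t.inc s ≫ f ≫ t'.proj r) ⊵ₗ fam M := by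
    intro r
    simp only [← MonoidalLeftAction.comp_actionHomLeft, ← Preadditive.comp_sum,
      ← actionHomLeft_sum]
    simp only [← Category.assoc, ← Preadditive.sum_comp, t.sum_proj_inc, Category.id_comp]
  simp only [arcOf_apply, h1, map_sum, simpleArc_natural, Category.assoc, h2]
  rw [Finset.sum_comm]
  simp only [LinearMap.sum_apply]

variable (S M)

/-- The diagram with arc `A`. -/
def arc (A : D) : Vert M A →ₗ[ℂ] Covert M A →ₗ[ℂ] LeftTube S M :=
  arcOf M (hS.out.semisimple A).some

variable {S M}

theorem arc_natural {A B : D} (f : A ⟶ B) (ν : Vert M A) (ζ : Covert M B) :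
    arc S M A ν (f ⊵ₗ fam M ≫ ζ) = arc S M B (ν ≫ f ⊵ₗ fam M) ζ :=
  arcOf_natural _ _ f ν ζ

theorem arcOf_eq_arc {A : D} (t : Decomposition S A) : arcOf M t = arc S M A := by
  refine LinearMap.ext₂ fun ν ζ => ?_
  have := arcOf_natural (M := M) t (hS.out.semisimple A).some (𝟙 A) ν ζ
  rw [arc]
  simpa using this

/-- The decomposition chosen for `S a` need not be the trivial one; sliding the inclusions across
recombines it. -/
theorem simpleArc_eq_arc (a : I) : simpleArc S M a = arc S M (S a) := by
  refine LinearMap.ext₂ fun ν ζ => ?_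
  rw [arc, arcOf_apply]
  simp only [simpleArc_natural, Category.assoc, ← MonoidalLeftAction.comp_actionHomLeft,
    ← LinearMap.sum_apply, ← map_sum, ← Preadditive.comp_sum, ← actionHomLeft_sum]
  rw [Decomposition.sum_proj_inc]
  simp

theorem arc_induction {P : LeftTube S M → Prop} (h0 : P 0)
    (hadd : ∀ x y, P x → P y → P (x + y)) (harc : ∀ a ν ζ, P (arc S M (S a) ν ζ))
    (x : LeftTube S M) : P x :=
  tube_induction h0 hadd (fun a ν ζ => simpleArc_eq_arc (S := S) (M := M) a ▸ harc a ν ζ) x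

theorem tube_hom_ext_arc {F G : LeftTube S M →ₗ[ℂ] X}
    (h : ∀ a ν ζ, F (arc S M (S a) ν ζ) = G (arc S M (S a) ν ζ)) : F = G :=
  tube_hom_ext fun a ν ζ => by rw [simpleArc_eq_arc, h]

/-- Universal property of the coend: a dinatural family, used only on simple arcs to define the map,
gives the value on every arc. -/
theorem tubeLift_arc (β : ∀ A : D, Vert M A →ₗ[ℂ] Covert M A →ₗ[ℂ] X)
    (hβ : ∀ {A B : D} (f : A ⟶ B) (ν : Vert M A) (ζ : Covert M B),
      β A ν (f ⊵ₗ fam M ≫ ζ) = β B (ν ≫ f ⊵ₗ fam M) ζ) (A : D) (ν : Vert M A)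
    (ζ : Covert M A) : tubeLift S M (fun a => β (S a)) (arc S M A ν ζ) = β A ν ζ := by
  rw [arc, arcOf_apply]
  simp only [map_sum, tubeLift_simpleArc, hβ, Category.assoc,
    ← MonoidalLeftAction.comp_actionHomLeft,
    ← LinearMap.sum_apply]
  simp only [← map_sum, ← Preadditive.comp_sum, ← actionHomLeft_sum]
  rw [Decomposition.sum_proj_inc]
  simp

end Naturality

/-! ### The pairing of splitting and fusion vertices -/

section Pairing

/-- The sum of the diagonal entries. -/
def wallTrace (M : J → ℳ) : (fam M ⟶ fam M) →ₗ[ℂ] ℂ :=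
  ∑ j, (scalarLin (M j)).comp (entLin (X := fam M) (Y := fam M) j j)

theorem wallTrace_apply (φ : fam M ⟶ fam M) : wallTrace M φ = ∑ j, scalar (ent φ j j) := by
  simp only [wallTrace, LinearMap.sum_apply]
  rfl

/-- The pairing of morphisms from and to the wall. -/
def wallPairing (M : J → ℳ) (Y : Fam J ℳ) : (fam M ⟶ Y) →ₗ[ℂ] (Y ⟶ fam M) →ₗ[ℂ] ℂ :=
  LinearMap.mk₂ ℂ (fun ν ζ => wallTrace M (ν ≫ ζ))
    (fun f f' g => by rw [Preadditive.add_comp, map_add])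
    (fun c f g => by rw [Linear.smul_comp, map_smul])
    (fun f g g' => by rw [Preadditive.comp_add, map_add])
    (fun c f g => by rw [Linear.comp_smul, map_smul])

@[simp] theorem wallPairing_apply {Y : Fam J ℳ} (ν : fam M ⟶ Y) (ζ : Y ⟶ fam M) :
    wallPairing M Y ν ζ = wallTrace M (ν ≫ ζ) := rfl

variable [hM : Fact (IsIrr M)]

theorem ent_wall_eq_zero (φ : fam M ⟶ fam M) {i j : J} (h : i ≠ j) : ent φ i j = 0 :=
  hM.out.hom_eq_zero h _

theorem wallTrace_comp_dag {Y : Fam J ℳ} (ν : fam M ⟶ Y) :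
    wallTrace M (ν ≫ dag ν) = ∑ i, ∑ j, scalar (ent ν i j ≫ dagger (ent ν i j)) := by
  rw [wallTrace_apply]
  refine Finset.sum_congr rfl fun i _ => ?_
  rw [Fam.comp_apply, scalar_sum]
  rfl

theorem wallTrace_comp_dag_re_nonneg {Y : Fam J ℳ} (ν : fam M ⟶ Y) :
    0 ≤ (wallTrace M (ν ≫ dag ν)).re := by
  rw [wallTrace_comp_dag, Complex.re_sum]
  refine Finset.sum_nonneg fun i _ => ?_
  rw [Complex.re_sum]
  exact Finset.sum_nonneg fun j _ => scalar_comp_dagger_re_nonneg (hM.out.simple i) _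

theorem eq_zero_of_wallTrace_comp_dag {Y : Fam J ℳ} (ν : fam M ⟶ Y)
    (h : wallTrace M (ν ≫ dag ν) = 0) : ν = 0 := by
  have h1 : (wallTrace M (ν ≫ dag ν)).re = 0 := by rw [h]; rfl
  rw [wallTrace_comp_dag, Complex.re_sum, Finset.sum_eq_zero_iff_of_nonneg] at h1
  · ext i j
    have h2 := h1 i (Finset.mem_univ i)
    rw [Complex.re_sum, Finset.sum_eq_zero_iff_of_nonneg] at h2
    · have h3 := h2 j (Finset.mem_univ j)
      obtain ⟨r, -, h4, h5⟩ := exists_comp_dagger_eq (hM.out.simple i) (ent ν i j)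
      exact h4 (by rw [h5] at h3; simpa using h3)
    · exact fun j _ => scalar_comp_dagger_re_nonneg (hM.out.simple i) _
  · intro i _
    rw [Complex.re_sum]
    exact Finset.sum_nonneg fun j _ => scalar_comp_dagger_re_nonneg (hM.out.simple i) _

theorem wallTrace_dag (φ : fam M ⟶ fam M) : wallTrace M (dag φ) = conj (wallTrace M φ) := by
  rw [wallTrace_apply, wallTrace_apply, map_sum]
  refine Finset.sum_congr rfl fun i _ => ?_
  rw [dag_apply, scalar_dagger (hM.out.simple i)]

/-- Distinct simple objects have no morphisms between them, so an endomorphism of the wall starting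
at M i lives in the one-dimensional entry (i, i), and the wall trace reads off its coefficient.
Multiplicity-freeness of the wall enters here. -/
theorem single_comp_eq_smul {Y : Fam J ℳ} (i j : J) (f : M i ⟶ Y.obj j) (ζ : Y ⟶ fam M) :
    (single i j f : fam M ⟶ Y) ≫ ζ =
      wallTrace M ((single i j f : fam M ⟶ Y) ≫ ζ) • single i i (𝟙 (M i)) := by
  have h1 : ∀ k l, ¬(k = i ∧ l = i) → ent ((single i j f : fam M ⟶ Y) ≫ ζ) k l = 0 := by
    intro k l hkl
    by_cases hk : k = i
    · exact ent_wall_eq_zero _ fun h => hkl ⟨hk, h ▸ hk⟩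
    · rw [single_comp, single_ne_left hk]
  have h2 : wallTrace M ((single i j f : fam M ⟶ Y) ≫ ζ) =
      scalar (ent ((single i j f : fam M ⟶ Y) ≫ ζ) i i) := by
    rw [wallTrace_apply, Finset.sum_eq_single i]
    · intro k _ hk
      rw [h1 k k fun h => hk h.1, scalar_zero]
    · simp
  ext k l
  rw [h2, Fam.smul_apply]
  by_cases hk : k = i
  · by_cases hl : l = i
    · subst hk; subst hl
      rw [single_same]
      exact eq_scalar_smul_id (hM.out.simple _) _
    · rw [h1 k l fun h => hl h.2, single_ne_right _ _ hl, smul_zero]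
  · rw [h1 k l fun h => hk h.1, single_ne_left hk, smul_zero]

instance finiteDimensional_wall_hom (Y : Fam J ℳ) : FiniteDimensional ℂ (fam M ⟶ Y) :=
  have := hM.out.finiteDimensional
  inferInstance

instance finiteDimensional_hom_wall (Y : Fam J ℳ) : FiniteDimensional ℂ (Y ⟶ fam M) :=
  have := hM.out.finiteDimensional
  inferInstance

/-- The pairing is nondegenerate because tr(ν ≫ ν†) is a sum of nonnegative terms that vanishes only
for ν = 0. -/
theorem exists_wall_dualPair (M : J → ℳ) [hM : Fact (IsIrr M)] (Y : Fam J ℳ) :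
    ∃ (e : Fin (Module.finrank ℂ (fam M ⟶ Y)) → (fam M ⟶ Y))
      (e' : Fin (Module.finrank ℂ (fam M ⟶ Y)) → (Y ⟶ fam M)),
      IsDualPair (wallPairing M Y) e e' := by
  refine exists_isDualPair _ (fun ν h => eq_zero_of_wallTrace_comp_dag ν (h (dag ν)))
    (fun ζ h => ?_)
  have h1 : dag ζ = 0 := eq_zero_of_wallTrace_comp_dag _ (by rw [dag_dag]; exact h (dag ζ))
  rw [← dag_dag ζ, h1, map_zero]

/-- A basis of the morphisms from the wall. -/
def vec (M : J → ℳ) [Fact (IsIrr M)] (Y : Fam J ℳ) :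
    Fin (Module.finrank ℂ (fam M ⟶ Y)) → (fam M ⟶ Y) :=
  (exists_wall_dualPair M Y).choose

/-- The dual basis of the morphisms to the wall. -/
def covec (M : J → ℳ) [Fact (IsIrr M)] (Y : Fam J ℳ) :
    Fin (Module.finrank ℂ (fam M ⟶ Y)) → (Y ⟶ fam M) :=
  (exists_wall_dualPair M Y).choose_spec.choose

theorem vec_covec (M : J → ℳ) [Fact (IsIrr M)] (Y : Fam J ℳ) :
    IsDualPair (wallPairing M Y) (vec M Y) (covec M Y) :=
  (exists_wall_dualPair M Y).choose_spec.choose_spec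

/-- Every simple object is an entry of the wall, and morphisms out of simple objects are jointly
epic. -/
theorem wall_hom_ext {Y Z : Fam J ℳ} {g g' : Y ⟶ Z}
    (h : ∀ i j (f : M i ⟶ Y.obj j), (single i j f : fam M ⟶ Y) ≫ g = single i j f ≫ g') :
    g = g' := by
  ext j l
  refine hM.out.hom_ext fun i f => ?_
  have := congrArg (fun φ => ent φ i l) (h i j f)
  dsimp only at this
  rw [single_comp, single_comp, single_same, single_same] at this
  exact this

/-- Resolution of the identity. Preceded by a vertex f out of M i, each f ≫ e'ₖ is the pairing
number times the projection onto M i, so the sum is the dual-basis expansion of f followed back from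
that projection. -/
theorem sum_covec_comp_vec {ι : Type*} [Fintype ι] {Y : Fam J ℳ} {e : ι → (fam M ⟶ Y)}
    {e' : ι → (Y ⟶ fam M)} (h : IsDualPair (wallPairing M Y) e e') :
    ∑ k, e' k ≫ e k = 𝟙 Y := by
  refine wall_hom_ext (M := M) fun i j f => ?_
  have h1 : (single i i (𝟙 (M i)) : fam M ⟶ fam M) ≫ (single i j f : fam M ⟶ Y) =
      single i j f := by
    rw [single_comp_single]; simp [kron]
  rw [Preadditive.comp_sum, Category.comp_id]
  calc _ = ∑ k, wallPairing M Y (single i j f) (e' k) • (single i i (𝟙 (M i)) ≫ e k) := by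
        refine Finset.sum_congr rfl fun k _ => ?_
        rw [← Category.assoc, single_comp_eq_smul, Linear.smul_comp]; rfl
    _ = single i i (𝟙 (M i)) ≫ ∑ k, wallPairing M Y (single i j f) (e' k) • e k := by
        rw [Preadditive.comp_sum]; simp
    _ = single i j f := by rw [h.left, h1]

end Pairing

end Tube

end BoundaryTube

end

noncomputable section

namespace BoundaryTube

open UnitaryCategory (dagger)

section Bialgebra

open Fam MonoidalLeftAction

variable {D ℳ I J : Type*} [Category D] [Preadditive D] [Linear ℂ D] [MonoidalCategory D]
  [UnitaryCategory D] [Category ℳ] [Preadditive ℳ] [Linear ℂ ℳ]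
  [UnitaryCategory ℳ] [MonoidalLeftAction D ℳ] [UnitaryLeftModule D ℳ]
  [Fintype I] [DecidableEq I] [Fintype J] [DecidableEq J]

/-! ### Products of vertices -/

/-- The product of splitting vertices. -/
def vertMul {M : J → ℳ} {A B : D} : Vert M A →ₗ[ℂ] Vert M B →ₗ[ℂ] Vert M (A ⊗ B) :=
  LinearMap.mk₂ ℂ (fun ν ν' => ν ≫ A ⊴ₗ ν' ≫ (αₗ A B (fam M)).inv)
    (fun _ _ _ => by rw [Preadditive.add_comp])
    (fun _ _ _ => by rw [Linear.smul_comp])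
    (fun _ _ _ => by rw [actionHomRight_add, Preadditive.add_comp, Preadditive.comp_add])
    (fun _ _ _ => by rw [actionHomRight_smul, Linear.smul_comp, Linear.comp_smul])

/-- The product of fusion vertices. -/
def covertMul {M : J → ℳ} {A B : D} : Covert M A →ₗ[ℂ] Covert M B →ₗ[ℂ] Covert M (A ⊗ B) :=
  LinearMap.mk₂ ℂ (fun ζ ζ' => (αₗ A B (fam M)).hom ≫ A ⊴ₗ ζ' ≫ ζ)
    (fun _ _ _ => by rw [Preadditive.comp_add, Preadditive.comp_add])
    (fun _ _ _ => by rw [Linear.comp_smul, Linear.comp_smul])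
    (fun _ _ _ => by rw [actionHomRight_add, Preadditive.add_comp, Preadditive.comp_add])
    (fun _ _ _ => by rw [actionHomRight_smul, Linear.smul_comp, Linear.comp_smul])

section Vertices

variable {M : J → ℳ} {A B E : D}

theorem vertMul_apply (ν : Vert M A) (ν' : Vert M B) :
    vertMul ν ν' = ν ≫ A ⊴ₗ ν' ≫ (αₗ A B (fam M)).inv := rfl

theorem covertMul_apply (ζ : Covert M A) (ζ' : Covert M B) :
    covertMul ζ ζ' = (αₗ A B (fam M)).hom ≫ A ⊴ₗ ζ' ≫ ζ := rfl

/-- The associators cancel and the inner bubble closes inside the outer one; this is how the counit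
evaluates products. -/
theorem vertMul_comp_covertMul (ν : Vert M A) (ν' : Vert M B) (ζ : Covert M A)
    (ζ' : Covert M B) : vertMul ν ν' ≫ covertMul ζ ζ' = ν ≫ A ⊴ₗ (ν' ≫ ζ') ≫ ζ := by
  simp [vertMul_apply, covertMul_apply]

theorem vertMul_comp_action (ν : Vert M A) (ν' : Vert M B) (φ : fam M ⟶ fam M) :
    vertMul ν ν' ≫ (A ⊗ B) ⊴ₗ φ = vertMul ν (ν' ≫ B ⊴ₗ φ) := by
  simp [vertMul_apply]

theorem vertMul_natural_left {A' : D} (f : A ⟶ A') (ν : Vert M A) (ν' : Vert M B) :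
    vertMul (ν ≫ f ⊵ₗ fam M) ν' = vertMul ν ν' ≫ (f ▷ B) ⊵ₗ fam M := by
  simp only [vertMul_apply, Category.assoc, whiskerRight_actionHomLeft, Iso.inv_hom_id_assoc]
  rw [← action_exchange_assoc]

theorem vertMul_natural_right {B' : D} (f : B ⟶ B') (ν : Vert M A) (ν' : Vert M B) :
    vertMul ν (ν' ≫ f ⊵ₗ fam M) = vertMul ν ν' ≫ (A ◁ f) ⊵ₗ fam M := by
  simp [vertMul_apply]

theorem covertMul_natural_left {A' : D} (f : A' ⟶ A) (ζ : Covert M A) (ζ' : Covert M B) :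
    covertMul (f ⊵ₗ fam M ≫ ζ) ζ' = (f ▷ B) ⊵ₗ fam M ≫ covertMul ζ ζ' := by
  simp only [covertMul_apply, Category.assoc, whiskerRight_actionHomLeft, Iso.inv_hom_id_assoc]
  rw [← action_exchange_assoc]

theorem covertMul_natural_right {B' : D} (f : B' ⟶ B) (ζ : Covert M A) (ζ' : Covert M B) :
    covertMul ζ (f ⊵ₗ fam M ≫ ζ') = (A ◁ f) ⊵ₗ fam M ≫ covertMul ζ ζ' := by
  simp [covertMul_apply]

theorem vertMul_assoc (ν : Vert M A) (ν' : Vert M B) (ν'' : Vert M E) :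
    vertMul (vertMul ν ν') ν'' ≫ (α_ A B E).hom ⊵ₗ fam M = vertMul ν (vertMul ν' ν'') := by
  have h := associator_actionHom A B E (fam M)
  rw [← cancel_mono ((αₗ A (B ⊗ E) (fam M)).hom ≫ A ⊴ₗ (αₗ B E (fam M)).hom)]
  simp [vertMul_apply]

theorem covertMul_assoc (ζ : Covert M A) (ζ' : Covert M B) (ζ'' : Covert M E) :
    (α_ A B E).hom ⊵ₗ fam M ≫ covertMul ζ (covertMul ζ' ζ'') =
      covertMul (covertMul ζ ζ') ζ'' := by
  simp [covertMul_apply]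

theorem unit_vertMul (ν : Vert M A) :
    vertMul (λₗ[D] (fam M)).inv ν = ν ≫ (λ_ A).inv ⊵ₗ fam M := by
  rw [← cancel_mono ((λ_ A).hom ⊵ₗ fam M), Category.assoc, inv_hom_actionHomLeft,
    leftUnitor_actionHom]
  simp [vertMul_apply]

theorem vertMul_unit (ν : Vert M A) :
    vertMul ν (λₗ[D] (fam M)).inv = ν ≫ (ρ_ A).inv ⊵ₗ fam M := by
  rw [← cancel_mono ((ρ_ A).hom ⊵ₗ fam M), Category.assoc, inv_hom_actionHomLeft,
    rightUnitor_actionHom]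
  simp [vertMul_apply]

theorem unit_covertMul (ζ : Covert M A) :
    covertMul (λₗ[D] (fam M)).hom ζ = (λ_ A).hom ⊵ₗ fam M ≫ ζ := by
  simp [covertMul_apply]

theorem covertMul_unit (ζ : Covert M A) :
    covertMul ζ (λₗ[D] (fam M)).hom = (ρ_ A).hom ⊵ₗ fam M ≫ ζ := by
  simp [covertMul_apply]

end Vertices

/-- Expanding first in the dual bases for A leaves ∑ f'ₗ ≫ fₗ in the inner position, which is the
identity. This is the source of the multiplicativity of Δ. -/
theorem IsDualPair.vertMul {M : J → ℳ} [Fact (IsIrr M)] {A B : D} {ι κ : Type*} [Fintype ι]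
    [Fintype κ] {e : ι → Vert M A} {e' : ι → Covert M A} {f : κ → Vert M B} {f' : κ → Covert M B}
    (h : IsDualPair (wallPairing M (A ⊙ₗ fam M)) e e')
    (h' : IsDualPair (wallPairing M (B ⊙ₗ fam M)) f f') :
    IsDualPair (wallPairing M ((A ⊗ B) ⊙ₗ fam M))
      (fun p : κ × ι => BoundaryTube.vertMul (e p.2) (f p.1))
      (fun p : κ × ι => covertMul (e' p.2) (f' p.1)) := by
  constructor
  · intro ω
    rw [Fintype.sum_prod_type]
    calc _ = ∑ l, (ω ≫ (αₗ A B (fam M)).hom ≫ A ⊴ₗ f' l) ≫ A ⊴ₗ f l ≫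
          (αₗ A B (fam M)).inv := by
          refine Finset.sum_congr rfl fun l _ => ?_
          conv_rhs => rw [← h.left (ω ≫ (αₗ A B (fam M)).hom ≫ A ⊴ₗ f' l)]
          simp only [Preadditive.sum_comp, Linear.smul_comp, vertMul_apply, covertMul_apply,
            wallPairing_apply, Category.assoc]
      _ = ω ≫ (αₗ A B (fam M)).hom ≫ A ⊴ₗ (∑ l, f' l ≫ f l) ≫ (αₗ A B (fam M)).inv := by
          simp only [actionHomRight_sum, Preadditive.sum_comp, Preadditive.comp_sum,
            actionHomRight_comp, Category.assoc]
      _ = ω := by rw [sum_covec_comp_vec h']; simp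
  · intro χ
    rw [Fintype.sum_prod_type]
    calc _ = ∑ l, (αₗ A B (fam M)).hom ≫ A ⊴ₗ f' l ≫ A ⊴ₗ f l ≫
          (αₗ A B (fam M)).inv ≫ χ := by
          refine Finset.sum_congr rfl fun l _ => ?_
          conv_rhs => rw [← h.right (A ⊴ₗ f l ≫ (αₗ A B (fam M)).inv ≫ χ)]
          simp only [Preadditive.comp_sum, Linear.comp_smul, vertMul_apply, covertMul_apply,
            wallPairing_apply, Category.assoc]
      _ = (αₗ A B (fam M)).hom ≫ A ⊴ₗ (∑ l, f' l ≫ f l) ≫ (αₗ A B (fam M)).inv ≫ χ := by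
          simp only [actionHomRight_sum, Preadditive.sum_comp, Preadditive.comp_sum,
            actionHomRight_comp, Category.assoc]
      _ = χ := by rw [sum_covec_comp_vec h']; simp

/-! ### The structure maps of the weak bialgebra -/

variable (S : I → D) (M : J → ℳ) [hS : Fact (IsIrr S)]

/-- Left multiplication by a diagram. -/
def arcMul (A : D) : Vert M A →ₗ[ℂ] Covert M A →ₗ[ℂ] (LeftTube S M →ₗ[ℂ] LeftTube S M) :=
  LinearMap.mk₂ ℂ (fun ν ζ => tubeLift S M fun b =>
      (arc S M (A ⊗ S b)).compl₁₂ (vertMul ν) (covertMul ζ))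
    (fun _ _ _ => tube_hom_ext fun a ν ζ => by
      simp [tubeLift_simpleArc])
    (fun _ _ _ => tube_hom_ext fun a ν ζ => by
      simp [tubeLift_simpleArc])
    (fun _ _ _ => tube_hom_ext fun a ν ζ => by
      simp [tubeLift_simpleArc])
    (fun _ _ _ => tube_hom_ext fun a ν ζ => by
      simp [tubeLift_simpleArc])

/-- The multiplication of the tube algebra. -/
def tubeMul : LeftTube S M →ₗ[ℂ] LeftTube S M →ₗ[ℂ] LeftTube S M :=
  tubeLift S M fun a => arcMul S M (S a)

/-- The unit of the tube algebra. -/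
def tubeOne : LeftTube S M := arc S M (𝟙_ D) (λₗ (fam M)).inv (λₗ (fam M)).hom

/-- The counit of the tube algebra. -/
def tubeCounit : LeftTube S M →ₗ[ℂ] ℂ :=
  tubeLift S M fun a => wallPairing M (S a ⊙ₗ fam M)

variable {S M}

theorem tubeOne_eq : tubeOne S M = arc S M (𝟙_ D) (λₗ (fam M)).inv (λₗ (fam M)).hom := rfl

theorem arcMul_arc (A B : D) (ν : Vert M A) (ζ : Covert M A) (ν' : Vert M B) (ζ' : Covert M B) :
    arcMul S M A ν ζ (arc S M B ν' ζ') = arc S M (A ⊗ B) (vertMul ν ν') (covertMul ζ ζ') :=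
  tubeLift_arc (fun B => (arc S M (A ⊗ B)).compl₁₂ (vertMul ν) (covertMul ζ))
    (fun f ν' ζ' => by
      rw [LinearMap.compl₁₂_apply, LinearMap.compl₁₂_apply, vertMul_natural_right,
        covertMul_natural_right, arc_natural]) B ν' ζ'

theorem tubeMul_arc (A B : D) (ν : Vert M A) (ζ : Covert M A) (ν' : Vert M B)
    (ζ' : Covert M B) : tubeMul S M (arc S M A ν ζ) (arc S M B ν' ζ') =
      arc S M (A ⊗ B) (vertMul ν ν') (covertMul ζ ζ') := by
  rw [← arcMul_arc, tubeMul, tubeLift_arc (arcMul S M)]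
  intro A B f ν ζ
  refine tube_hom_ext_arc fun b ν' ζ' => ?_
  rw [arcMul_arc, arcMul_arc, vertMul_natural_left, covertMul_natural_left, arc_natural]

theorem tubeCounit_arc (A : D) (ν : Vert M A) (ζ : Covert M A) :
    tubeCounit S M (arc S M A ν ζ) = wallTrace M (ν ≫ ζ) :=
  tubeLift_arc (fun A => wallPairing M (A ⊙ₗ fam M))
    (fun f ν ζ => by rw [wallPairing_apply, wallPairing_apply, Category.assoc]) A ν ζ

variable [hM : Fact (IsIrr M)]

variable (S M) in
/-- The comultiplication on diagrams. -/
def arcComul (A : D) : Vert M A →ₗ[ℂ] Covert M A →ₗ[ℂ] LeftTube S M ⊗[ℂ] LeftTube S M :=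
  LinearMap.mk₂ ℂ (fun ν ζ => ∑ k, arc S M A (vec M (A ⊙ₗ fam M) k) ζ ⊗ₜ[ℂ]
      arc S M A ν (covec M (A ⊙ₗ fam M) k))
    (fun _ _ _ => by simp [TensorProduct.tmul_add, Finset.sum_add_distrib])
    (fun _ _ _ => by simp [Finset.smul_sum])
    (fun _ _ _ => by simp [TensorProduct.add_tmul, Finset.sum_add_distrib])
    (fun _ _ _ => by simp [Finset.smul_sum, TensorProduct.smul_tmul'])

variable (S M) in
/-- The comultiplication of the tube algebra. -/
def tubeComul : LeftTube S M →ₗ[ℂ] LeftTube S M ⊗[ℂ] LeftTube S M :=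
  tubeLift S M fun a => arcComul S M (S a)

theorem tubeComul_arc' (A : D) (ν : Vert M A) (ζ : Covert M A) :
    tubeComul S M (arc S M A ν ζ) = ∑ k, arc S M A (vec M (A ⊙ₗ fam M) k) ζ ⊗ₜ[ℂ]
      arc S M A ν (covec M (A ⊙ₗ fam M) k) := by
  rw [tubeComul, tubeLift_arc (arcComul S M)]
  · rfl
  · intro A B f ν ζ
    -- Pushing splitting vertices and pulling fusion vertices along f are transposes of each other,
    -- so the canonical elements for A and B are related by f.
    have := (vec_covec M (A ⊙ₗ fam M)).transpose (vec_covec M (B ⊙ₗ fam M))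
      (pushVert M f) (pullCovert M f) (fun v u => by simp)
      ((TensorProduct.mk ℂ _ _).compl₁₂ ((arc S M B).flip ζ) (arc S M A ν))
    simp only [arcComul, LinearMap.mk₂_apply]
    simp only [LinearMap.compl₁₂_apply, TensorProduct.mk_apply, LinearMap.flip_apply,
      Linear.rightComp_apply, Linear.leftComp_apply] at this
    simp only [arc_natural] at this ⊢
    exact this

theorem tubeComul_arc {ι : Type*} [Fintype ι] {A : D} {e : ι → Vert M A} {e' : ι → Covert M A}
    (h : IsDualPair (wallPairing M (A ⊙ₗ fam M)) e e') (ν : Vert M A) (ζ : Covert M A) :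
    tubeComul S M (arc S M A ν ζ) = ∑ k, arc S M A (e k) ζ ⊗ₜ[ℂ] arc S M A ν (e' k) := by
  rw [tubeComul_arc']
  exact (vec_covec M (A ⊙ₗ fam M)).sum_eq h
    ((TensorProduct.mk ℂ _ _).compl₁₂ ((arc S M A).flip ζ) (arc S M A ν))

/-! ### The axioms of a weak bialgebra -/

theorem tubeMul_assoc (x y z : LeftTube S M) :
    tubeMul S M (tubeMul S M x y) z = tubeMul S M x (tubeMul S M y z) := by
  induction x using arc_induction with
  | h0 => simp
  | hadd x x' h h' => simp [h, h']
  | harc a ν ζ =>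
  induction y using arc_induction with
  | h0 => simp
  | hadd x x' h h' => simp [h, h']
  | harc b ν' ζ' =>
  induction z using arc_induction with
  | h0 => simp
  | hadd x x' h h' => simp [h, h']
  | harc c ν'' ζ'' =>
    rw [tubeMul_arc, tubeMul_arc, tubeMul_arc, tubeMul_arc, ← covertMul_assoc, arc_natural,
      vertMul_assoc]

theorem tubeOne_mul (x : LeftTube S M) : tubeMul S M (tubeOne S M) x = x := by
  induction x using arc_induction with
  | h0 => simp
  | hadd x x' h h' => simp [h, h']
  | harc a ν ζ =>
    rw [tubeOne, tubeMul_arc, unit_covertMul, unit_vertMul, arc_natural]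
    simp only [Category.assoc, inv_hom_actionHomLeft, Category.comp_id]

theorem tubeMul_one (x : LeftTube S M) : tubeMul S M x (tubeOne S M) = x := by
  induction x using arc_induction with
  | h0 => simp
  | hadd x x' h h' => simp [h, h']
  | harc a ν ζ =>
    rw [tubeOne, tubeMul_arc, covertMul_unit, vertMul_unit, arc_natural]
    simp only [Category.assoc, inv_hom_actionHomLeft, Category.comp_id]

/-- Both sides insert two independent canonical elements and differ only in the order of summation.
-/
theorem tubeComul_coassoc (x : LeftTube S M) :
    TensorProduct.assoc ℂ _ _ _ ((tubeComul S M).rTensor _ (tubeComul S M x)) =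
      (tubeComul S M).lTensor _ (tubeComul S M x) := by
  induction x using arc_induction with
  | h0 => simp
  | hadd x x' h h' => simp only [map_add, h, h']
  | harc a ν ζ =>
    simp only [tubeComul_arc', map_sum, LinearMap.rTensor_tmul, LinearMap.lTensor_tmul,
      TensorProduct.sum_tmul, TensorProduct.tmul_sum, TensorProduct.assoc_tmul]
    exact Finset.sum_comm

theorem tubeCounit_comul (x : LeftTube S M) :
    TensorProduct.lid ℂ _ ((tubeCounit S M).rTensor _ (tubeComul S M x)) = x := by
  induction x using arc_induction with
  | h0 => simp
  | hadd x x' h h' => simp only [map_add, h, h']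
  | harc a ν ζ =>
    simp only [tubeComul_arc', map_sum, LinearMap.rTensor_tmul, TensorProduct.lid_tmul,
      tubeCounit_arc]
    conv_rhs => rw [← (vec_covec M (S a ⊙ₗ fam M)).right ζ]
    simp

theorem tubeComul_counit (x : LeftTube S M) :
    TensorProduct.rid ℂ _ ((tubeCounit S M).lTensor _ (tubeComul S M x)) = x := by
  induction x using arc_induction with
  | h0 => simp
  | hadd x x' h h' => simp only [map_add, h, h']
  | harc a ν ζ =>
    simp only [tubeComul_arc', map_sum, LinearMap.lTensor_tmul, TensorProduct.rid_tmul,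
      tubeCounit_arc]
    conv_rhs => rw [← (vec_covec M (S a ⊙ₗ fam M)).left ν]
    simp

/-- The comultiplication of an arc A ⊗ B may be computed with the product of the dual bases for A
and B. -/
theorem tubeComul_mul (x y : LeftTube S M) : tubeComul S M (tubeMul S M x y) =
    TensorProduct.map₂ (tubeMul S M) (tubeMul S M) (tubeComul S M x) (tubeComul S M y) := by
  induction x using arc_induction with
  | h0 => simp
  | hadd x x' h h' => simp only [map_add, LinearMap.add_apply, h, h']
  | harc a ν ζ =>
  induction y using arc_induction with
  | h0 => simp
  | hadd x x' h h' => simp only [map_add, h, h']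
  | harc b ν' ζ' =>
    rw [tubeMul_arc, tubeComul_arc ((vec_covec M (S a ⊙ₗ fam M)).vertMul
      (vec_covec M (S b ⊙ₗ fam M))), tubeComul_arc', tubeComul_arc', Fintype.sum_prod_type]
    simp only [map_sum, LinearMap.sum_apply, TensorProduct.map₂_apply_tmul, TensorProduct.map_tmul, tubeMul_arc]

/-- The outer tensor factors are multiplied by the unit. In the middle factor each of the two arcs
has one trivial vertex, so their product is a single arc on the unit with the two remaining
vertices. -/
theorem tubeComul_one : (tubeComul S M).rTensor _ (tubeComul S M (tubeOne S M)) =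
    TensorProduct.map₂ (TensorProduct.map₂ (tubeMul S M) (tubeMul S M)) (tubeMul S M)
      (tubeComul S M (tubeOne S M) ⊗ₜ[ℂ] tubeOne S M)
      ((TensorProduct.assoc ℂ _ _ _).symm
        (tubeOne S M ⊗ₜ[ℂ] tubeComul S M (tubeOne S M))) := by
  simp only [tubeOne, tubeComul_arc', map_sum, LinearMap.rTensor_tmul, TensorProduct.sum_tmul,
    TensorProduct.tmul_sum, TensorProduct.assoc_symm_tmul, LinearMap.sum_apply,
    TensorProduct.map₂_apply_tmul, TensorProduct.map_tmul]
  refine Finset.sum_congr rfl fun k _ => Finset.sum_congr rfl fun l _ => ?_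
  simp only [← tubeOne_eq, tubeMul_one, tubeOne_mul]
  rw [tubeMul_arc, covertMul_unit, unit_vertMul, arc_natural]
  -- The left and right unitors of the unit object coincide, so the leftover isomorphism is trivial.
  have h : (λ_ (𝟙_ D)).inv ≫ (ρ_ (𝟙_ D)).hom = 𝟙 _ := by rw [← unitors_equal, Iso.inv_hom_id]
  simp only [Category.assoc, ← comp_actionHomLeft, h, id_actionHomLeft, Category.comp_id]

theorem tubeComul_one' : (tubeComul S M).rTensor _ (tubeComul S M (tubeOne S M)) =
    TensorProduct.map₂ (TensorProduct.map₂ (tubeMul S M) (tubeMul S M)) (tubeMul S M)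
      ((TensorProduct.assoc ℂ _ _ _).symm
        (tubeOne S M ⊗ₜ[ℂ] tubeComul S M (tubeOne S M)))
      (tubeComul S M (tubeOne S M) ⊗ₜ[ℂ] tubeOne S M) := by
  simp only [tubeOne, tubeComul_arc', map_sum, LinearMap.rTensor_tmul, TensorProduct.sum_tmul,
    TensorProduct.tmul_sum, TensorProduct.assoc_symm_tmul, LinearMap.sum_apply,
    TensorProduct.map₂_apply_tmul, TensorProduct.map_tmul]
  rw [Finset.sum_comm]
  refine Finset.sum_congr rfl fun k _ => Finset.sum_congr rfl fun l _ => ?_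
  simp only [← tubeOne_eq, tubeMul_one, tubeOne_mul]
  rw [tubeMul_arc, unit_covertMul, vertMul_unit, arc_natural]
  have h : (ρ_ (𝟙_ D)).inv ≫ (λ_ (𝟙_ D)).hom = 𝟙 _ := by rw [unitors_equal, Iso.inv_hom_id]
  simp only [Category.assoc, ← comp_actionHomLeft, h, id_actionHomLeft, Category.comp_id]

theorem tubeCounit_mul (x y z : LeftTube S M) :
    tubeCounit S M (tubeMul S M (tubeMul S M x y) z) =
      LinearMap.mul' ℂ ℂ (TensorProduct.map (tubeCounit S M ∘ₗ tubeMul S M x)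
        (tubeCounit S M ∘ₗ (tubeMul S M).flip z) (tubeComul S M y)) := by
  induction x using arc_induction with
  | h0 => simp
  | hadd x x' h h' =>
    simp only [map_add, LinearMap.add_apply, h, h', LinearMap.comp_add, TensorProduct.map_add_left]
  | harc a ν ζ =>
  induction y using arc_induction with
  | h0 => simp
  | hadd x x' h h' => simp only [map_add, LinearMap.add_apply, h, h']
  | harc b ν' ζ' =>
  induction z using arc_induction with
  | h0 => simp
  | hadd x x' h h' =>
    simp only [map_add, h, h', LinearMap.comp_add, TensorProduct.map_add_right,
      LinearMap.add_apply]
  | harc c ν'' ζ'' =>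
    simp only [tubeComul_arc', map_sum, TensorProduct.map_tmul, LinearMap.comp_apply,
      LinearMap.flip_apply, tubeMul_arc, tubeCounit_arc, LinearMap.mul'_apply,
      vertMul_comp_covertMul (ν := vertMul ν ν')]
    rw [← Category.assoc, vertMul_comp_action]
    simp only [vertMul_comp_covertMul]
    -- The closed triple product has y in the middle layer, closed on the inside by z. Expanding
    -- that part as a splitting vertex cuts the diagram into the two factors.
    conv_lhs => rw [← (vec_covec M (S b ⊙ₗ fam M)).left (ν' ≫ S b ⊴ₗ (ν'' ≫ ζ''))]
    simp only [Preadditive.sum_comp, Preadditive.comp_sum, actionHomRight_sum, Linear.smul_comp,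
      Linear.comp_smul, actionHomRight_smul, map_sum, map_smul, smul_eq_mul, wallPairing_apply,
      Category.assoc]
    exact Finset.sum_congr rfl fun k _ => mul_comm _ _

theorem tubeCounit_mul' (x y z : LeftTube S M) :
    tubeCounit S M (tubeMul S M (tubeMul S M x y) z) =
      LinearMap.mul' ℂ ℂ (TensorProduct.map (tubeCounit S M ∘ₗ tubeMul S M x)
        (tubeCounit S M ∘ₗ (tubeMul S M).flip z)
        (TensorProduct.comm ℂ _ _ (tubeComul S M y))) := by
  induction x using arc_induction with
  | h0 => simp
  | hadd x x' h h' =>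
    simp only [map_add, LinearMap.add_apply, h, h', LinearMap.comp_add, TensorProduct.map_add_left]
  | harc a ν ζ =>
  induction y using arc_induction with
  | h0 => simp
  | hadd x x' h h' => simp only [map_add, LinearMap.add_apply, h, h']
  | harc b ν' ζ' =>
  induction z using arc_induction with
  | h0 => simp
  | hadd x x' h h' =>
    simp only [map_add, h, h', LinearMap.comp_add, TensorProduct.map_add_right,
      LinearMap.add_apply]
  | harc c ν'' ζ'' =>
    simp only [tubeComul_arc', map_sum, TensorProduct.comm_tmul, TensorProduct.map_tmul,
      LinearMap.comp_apply,
      LinearMap.flip_apply, tubeMul_arc, tubeCounit_arc, LinearMap.mul'_apply,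
      vertMul_comp_covertMul (ν := vertMul ν ν')]
    rw [← Category.assoc, vertMul_comp_action]
    simp only [vertMul_comp_covertMul, Category.assoc]
    -- The other order comes from absorbing the closed inner part into the fusion vertex ζ' instead.
    conv_lhs => rw [← (vec_covec M (S b ⊙ₗ fam M)).right (S b ⊴ₗ (ν'' ≫ ζ'') ≫ ζ')]
    simp only [Preadditive.sum_comp, Preadditive.comp_sum, actionHomRight_sum, Linear.smul_comp,
      Linear.comp_smul, actionHomRight_smul, map_sum, map_smul, smul_eq_mul, wallPairing_apply]
    exact Finset.sum_congr rfl fun k _ => mul_comm _ _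

instance finiteDimensional_tube : FiniteDimensional ℂ (LeftTube S M) := by
  have := hM.out.finiteDimensional
  infer_instance

variable (S M) in
/-- The tube algebra as a weak bialgebra. -/
def tubeWeakBialgebra : WeakBialgebra (LeftTube S M) where
  one := tubeOne S M
  mul := tubeMul S M
  counit := tubeCounit S M
  comul := tubeComul S M
  finiteDimensional := inferInstance
  mul_assoc := tubeMul_assoc
  one_mul := tubeOne_mul
  mul_one := tubeMul_one
  coassoc := tubeComul_coassoc
  counit_comul := tubeCounit_comul
  comul_counit := tubeComul_counit
  comul_mul := tubeComul_mul
  comul_one := tubeComul_one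
  comul_one' := tubeComul_one'
  counit_mul := tubeCounit_mul
  counit_mul' := tubeCounit_mul'

end Bialgebra

end BoundaryTube

end

noncomputable section

namespace BoundaryTube

open UnitaryCategory (dagger)

/-! ### Bending legs in a module category -/

section Bend

open MonoidalLeftAction

variable {D ℳ : Type*} [Category D] [MonoidalCategory D] [Category ℳ] [MonoidalLeftAction D ℳ]

/-- The evaluation of a dual pair, acting on an object of a module category. -/
def evM (A A' : D) [ExactPairing A A'] (x : ℳ) : A' ⊙ₗ (A ⊙ₗ x) ⟶ x :=
  (αₗ A' A x).inv ≫ ε_ A A' ⊵ₗ x ≫ (λₗ x).hom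

/-- The coevaluation of a dual pair, acting on an object of a module category. -/
def coevM (A A' : D) [ExactPairing A A'] (x : ℳ) : x ⟶ A ⊙ₗ (A' ⊙ₗ x) :=
  (λₗ x).inv ≫ η_ A A' ⊵ₗ x ≫ (αₗ A A' x).hom

@[simp]
theorem leftUnitor_inv_action_assoc (A : D) (x : ℳ) :
    (λ_ A).inv ⊵ₗ x ≫ (αₗ (𝟙_ D) A x).hom = (λₗ (A ⊙ₗ x)).inv := by
  rw [← cancel_mono (λₗ (A ⊙ₗ x)).hom, Category.assoc, ← leftUnitor_actionHom,
    inv_hom_actionHomLeft, Iso.inv_hom_id]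

@[simp]
theorem leftUnitor_inv_action_assoc_assoc (A : D) (x : ℳ) {z : ℳ} (h : 𝟙_ D ⊙ₗ A ⊙ₗ x ⟶ z) :
    (λ_ A).inv ⊵ₗ x ≫ (αₗ (𝟙_ D) A x).hom ≫ h = (λₗ (A ⊙ₗ x)).inv ≫ h := by
  rw [← Category.assoc, leftUnitor_inv_action_assoc]

theorem rightUnitor_inv_action_assoc (A : D) (x : ℳ) :
    (ρ_ A).inv ⊵ₗ x ≫ (αₗ A (𝟙_ D) x).hom = A ⊴ₗ (λₗ x).inv := by
  rw [← cancel_mono (A ⊴ₗ (λₗ x).hom), Category.assoc, ← rightUnitor_actionHom,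
    inv_hom_actionHomLeft, actionHomRight_inv_hom]

section

variable (A A' B B' : D) [ExactPairing A A'] [ExactPairing B B']

theorem evM_natural {x y : ℳ} (f : x ⟶ y) : A' ⊴ₗ (A ⊴ₗ f) ≫ evM A A' y = evM A A' x ≫ f := by
  have h := tensor_actionHomRight A' A f
  rw [← Category.assoc, Iso.eq_comp_inv] at h
  have h' : A' ⊴ₗ (A ⊴ₗ f) = (αₗ A' A x).inv ≫ (A' ⊗ A) ⊴ₗ f ≫ (αₗ A' A y).hom := by
    rw [h, Iso.inv_hom_id_assoc]
  simp only [evM, h', Category.assoc, Iso.hom_inv_id_assoc, action_exchange_assoc,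
    ← actionUnitIso_hom_naturality]

theorem coevM_natural {x y : ℳ} (f : x ⟶ y) :
    f ≫ coevM A A' y = coevM A A' x ≫ A ⊴ₗ (A' ⊴ₗ f) := by
  have h := tensor_actionHomRight A A' f
  rw [← Category.assoc, Iso.eq_comp_inv] at h
  simp only [coevM, Category.assoc, ← h, ← action_exchange_assoc,
    actionUnitIso_inv_naturality_assoc]

theorem coevM_natural_assoc {x y z : ℳ} (f : x ⟶ y) (h : A ⊙ₗ A' ⊙ₗ y ⟶ z) :
    f ≫ coevM A A' y ≫ h = coevM A A' x ≫ A ⊴ₗ (A' ⊴ₗ f) ≫ h := by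
  rw [← Category.assoc, coevM_natural, Category.assoc]

@[simp]
-- The zigzag identity of the dual pair acting on x, with its associator and unitors absorbed by the
-- coherence of the action.
theorem coevM_evM (x : ℳ) : coevM A A' (A ⊙ₗ x) ≫ A ⊴ₗ evM A A' x = 𝟙 (A ⊙ₗ x) := by
  have h := congrArg (· ⊵ₗ x) (ExactPairing.evaluation_coevaluation A A')
  simp only [comp_actionHomLeft, whiskerLeft_actionHomLeft, leftUnitor_actionHom] at h
  rw [← cancel_mono ((ρ_ A).inv ⊵ₗ x), ← cancel_epi ((αₗ (𝟙_ D) A x).hom ≫ (λₗ (A ⊙ₗ x)).hom)]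
  simp only [Category.assoc, Category.id_comp] at h ⊢
  rw [← h]
  simp only [coevM, evM, actionHomRight_comp, Category.assoc, actionHomLeft_action]
  have h2 : A ⊴ₗ (λₗ x).hom ≫ (ρ_ A).inv ⊵ₗ x = (αₗ A (𝟙_ D) x).inv := by
    rw [← cancel_mono (αₗ A (𝟙_ D) x).hom, Category.assoc, rightUnitor_inv_action_assoc,
      actionHomRight_hom_inv, Iso.inv_hom_id]
  have h3 : (αₗ (A ⊗ A') A x).hom ≫ (αₗ A A' (A ⊙ₗ x)).hom ≫ A ⊴ₗ (αₗ A' A x).inv =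
      (α_ A A' A).hom ⊵ₗ x ≫ (αₗ A (A' ⊗ A) x).hom := by
    rw [← cancel_mono (A ⊴ₗ (αₗ A' A x).hom)]
    simp
  rw [h2, reassoc_of% h3]
  simp

@[simp]
theorem action_coevM_evM (x : ℳ) : A' ⊴ₗ coevM A A' x ≫ evM A A' (A' ⊙ₗ x) = 𝟙 (A' ⊙ₗ x) := by
  have h := congrArg (· ⊵ₗ x) (ExactPairing.coevaluation_evaluation A A')
  simp only [comp_actionHomLeft, whiskerLeft_actionHomLeft, rightUnitor_actionHom] at h
  rw [← cancel_mono ((λ_ A').inv ⊵ₗ x), Category.id_comp,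
    ← cancel_epi ((αₗ A' (𝟙_ D) x).hom ≫ A' ⊴ₗ (λₗ x).hom)]
  simp only [Category.assoc] at h ⊢
  rw [← h]
  have h2 : (λₗ (A' ⊙ₗ x)).hom ≫ (λ_ A').inv ⊵ₗ x = (αₗ (𝟙_ D) A' x).inv := by
    rw [← cancel_mono ((λ_ A').hom ⊵ₗ x)]
    simp
  have h3 := associator_actionHom A' A A' x
  have h4 : A' ⊴ₗ (αₗ A A' x).hom ≫ (αₗ A' A (A' ⊙ₗ x)).inv =
      (αₗ A' (A ⊗ A') x).inv ≫ (α_ A' A A').inv ⊵ₗ x ≫ (αₗ (A' ⊗ A) A' x).hom := by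
    rw [Iso.eq_inv_comp, ← cancel_epi ((α_ A' A A').hom ⊵ₗ x), ← cancel_mono (αₗ A' A (A' ⊙ₗ x)).hom]
    simp
  simp only [coevM, evM, actionHomRight_comp, Category.assoc, actionHomLeft_action, h2,
    Iso.hom_inv_id, Category.comp_id]
  rw [reassoc_of% h4]
  simp

@[simp]
theorem action_coevM_evM_assoc {x z : ℳ} (h : A' ⊙ₗ x ⟶ z) :
    A' ⊴ₗ coevM A A' x ≫ evM A A' (A' ⊙ₗ x) ≫ h = h := by
  rw [← Category.assoc, action_coevM_evM, Category.id_comp]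

/-- The coevaluation of A ⊗ B is nested, so the legs of a product are bent one after the other; the
dual B' ⊗ A' accounts for the reversal of products under the antipode. -/
theorem coevM_tensor (x : ℳ) : coevM (A ⊗ B) (B' ⊗ A') x =
    coevM A A' x ≫ A ⊴ₗ coevM B B' (A' ⊙ₗ x) ≫ A ⊴ₗ (B ⊴ₗ (αₗ B' A' x).inv) ≫
      (αₗ A B ((B' ⊗ A') ⊙ₗ x)).inv := by
  have h : η_ (A ⊗ B) (B' ⊗ A') = η_ A A' ≫ A ◁ (λ_ A').inv ≫ A ◁ (η_ B B' ▷ A') ≫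
      A ◁ (α_ B B' A').hom ≫ (α_ A B (B' ⊗ A')).inv := by
    rw [ExactPairing.tensor_coevaluation]
    monoidal
  have h2 := (leftUnitor_inv_action_assoc A' x).symm
  have h3 := associator_actionHom A B (B' ⊗ A') x
  have h4 : (α_ A B (B' ⊗ A')).inv ⊵ₗ x ≫ (αₗ (A ⊗ B) (B' ⊗ A') x).hom =
      (αₗ A (B ⊗ (B' ⊗ A')) x).hom ≫ A ⊴ₗ (αₗ B (B' ⊗ A') x).hom ≫
        (αₗ A B ((B' ⊗ A') ⊙ₗ x)).inv := by
    rw [← cancel_epi ((α_ A B (B' ⊗ A')).hom ⊵ₗ x),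
      ← cancel_mono (αₗ A B ((B' ⊗ A') ⊙ₗ x)).hom]
    simp
  have h5 : (α_ B B' A').hom ⊵ₗ x ≫ (αₗ B (B' ⊗ A') x).hom =
      (αₗ (B ⊗ B') A' x).hom ≫ (αₗ B B' (A' ⊙ₗ x)).hom ≫ B ⊴ₗ (αₗ B' A' x).inv := by
    rw [← cancel_mono (B ⊴ₗ (αₗ B' A' x).hom)]
    simp
  simp only [coevM, h, comp_actionHomLeft, whiskerLeft_actionHomLeft, Category.assoc,
    Iso.inv_hom_id_assoc, h4, actionHomRight_comp, h2, actionHomLeft_action,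
    Iso.hom_inv_id_assoc]
  simp only [← actionHomRight_comp_assoc, h5]

theorem evM_tensor (x : ℳ) : evM (A ⊗ B) (B' ⊗ A') x =
    (B' ⊗ A') ⊴ₗ (αₗ A B x).hom ≫ (αₗ B' A' (A ⊙ₗ (B ⊙ₗ x))).hom ≫ B' ⊴ₗ evM A A' (B ⊙ₗ x) ≫
      evM B B' x := by
  have h : ε_ (A ⊗ B) (B' ⊗ A') = (α_ B' A' (A ⊗ B)).hom ≫ B' ◁ (α_ A' A B).inv ≫
      B' ◁ (ε_ A A' ▷ B) ≫ B' ◁ (λ_ B).hom ≫ ε_ B B' := by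
    rw [ExactPairing.tensor_evaluation]
    monoidal
  have h2 : (λₗ (B ⊙ₗ x)).hom = (αₗ (𝟙_ D) B x).inv ≫ (λ_ B).hom ⊵ₗ x := by
    rw [leftUnitor_actionHom, Iso.inv_hom_id_assoc]
  have h3 : (αₗ (B' ⊗ A') (A ⊗ B) x).inv ≫ (α_ B' A' (A ⊗ B)).hom ⊵ₗ x =
      (αₗ B' A' ((A ⊗ B) ⊙ₗ x)).hom ≫ B' ⊴ₗ (αₗ A' (A ⊗ B) x).inv ≫
        (αₗ B' (A' ⊗ (A ⊗ B)) x).inv := by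
    rw [Iso.inv_comp_eq, ← cancel_mono ((αₗ B' (A' ⊗ (A ⊗ B)) x).hom ≫
      B' ⊴ₗ (αₗ A' (A ⊗ B) x).hom)]
    simp
  have h4 : (αₗ A' (A ⊗ B) x).inv ≫ (α_ A' A B).inv ⊵ₗ x =
      A' ⊴ₗ (αₗ A B x).hom ≫ (αₗ A' A (B ⊙ₗ x)).inv ≫ (αₗ (A' ⊗ A) B x).inv := by
    rw [Iso.inv_comp_eq, ← cancel_epi ((α_ A' A B).hom ⊵ₗ x),
      ← cancel_mono ((αₗ (A' ⊗ A) B x).hom ≫ (αₗ A' A (B ⊙ₗ x)).hom)]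
    simp
  simp only [evM, h, comp_actionHomLeft, whiskerLeft_actionHomLeft, Category.assoc,
    Iso.inv_hom_id_assoc, actionHomRight_comp, h2, actionHomLeft_action,
    tensor_actionHomRight, reassoc_of% h3,
    Iso.hom_inv_id_assoc]
  simp only [← actionHomRight_comp_assoc, reassoc_of% h4]

end

variable {A A' B B' : D} [ExactPairing A A'] [ExactPairing B B'] {x y z : ℳ}

/-- Bending a leg down. -/
def bend (A' : D) [ExactPairing A A'] (f : x ⟶ A ⊙ₗ y) : A' ⊙ₗ x ⟶ y := A' ⊴ₗ f ≫ evM A A' y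

/-- Bending a leg up. -/
def unbend (A : D) [ExactPairing A A'] (g : A' ⊙ₗ x ⟶ y) : x ⟶ A ⊙ₗ y := coevM A A' x ≫ A ⊴ₗ g

@[simp] theorem unbend_bend (f : x ⟶ A ⊙ₗ y) : unbend A (bend A' f) = f := by
  simp only [unbend, bend, actionHomRight_comp, ← coevM_natural_assoc, coevM_evM,
    Category.comp_id]

@[simp] theorem bend_unbend (g : A' ⊙ₗ x ⟶ y) : bend A' (unbend A g) = g := by
  simp only [unbend, bend, actionHomRight_comp, Category.assoc, evM_natural,
    action_coevM_evM_assoc]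

theorem bend_comp (f : x ⟶ A ⊙ₗ y) (g : y ⟶ z) : bend A' (f ≫ A ⊴ₗ g) = bend A' f ≫ g := by
  simp [bend, evM_natural]

theorem comp_unbend (g : z ⟶ x) (f : A' ⊙ₗ x ⟶ y) :
    unbend A (A' ⊴ₗ g ≫ f) = g ≫ unbend A f := by
  simp [unbend, coevM_natural_assoc]

variable (A A' B B') in
-- Only this sliding property of the mate is needed to compare bent legs along f.
theorem exists_mate (f : A ⟶ B) : ∃ g : B' ⟶ A', g ▷ A ≫ ε_ A A' = B' ◁ f ≫ ε_ B B' := by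
  let _ : HasRightDual A := ⟨A'⟩
  let _ : HasRightDual B := ⟨B'⟩
  exact ⟨fᘁ, rightAdjointMate_comp_evaluation f⟩

theorem mate_comp_bend {f : A ⟶ B} {g : B' ⟶ A'}
    (h : g ▷ A ≫ ε_ A A' = B' ◁ f ≫ ε_ B B') (ν : x ⟶ A ⊙ₗ y) :
    g ⊵ₗ x ≫ bend A' ν = bend B' (ν ≫ f ⊵ₗ y) := by
  have h1 := congrArg (· ⊵ₗ y) h
  simp only [comp_actionHomLeft, whiskerLeft_actionHomLeft, Category.assoc] at h1
  simp only [bend, evM, ← action_exchange_assoc, actionHomLeft_action, Category.assoc,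
    Iso.hom_inv_id_assoc, actionHomRight_comp]
  rw [reassoc_of% h1]
  simp

section Dagger

variable {D : Type*} [Category D] [Preadditive D] [Linear ℂ D] [MonoidalCategory D]
  [UnitaryCategory D] [UnitaryMonoidal D]

theorem dagger_whiskerLeft (A : D) {B E : D} (f : B ⟶ E) : dagger (A ◁ f) = A ◁ dagger f := by
  rw [← id_tensorHom, UnitaryMonoidal.dagger_tensor, UnitaryCategory.dagger_id, id_tensorHom]

theorem dagger_whiskerRight {B E : D} (f : B ⟶ E) (A : D) : dagger (f ▷ A) = dagger f ▷ A := by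
  rw [← tensorHom_id, UnitaryMonoidal.dagger_tensor, UnitaryCategory.dagger_id, tensorHom_id]

theorem dagger_associator_inv (X Y Z : D) : dagger (α_ X Y Z).inv = (α_ X Y Z).hom := by
  rw [← UnitaryMonoidal.dagger_associator, UnitaryCategory.dagger_dagger]

theorem dagger_leftUnitor_inv (X : D) : dagger (λ_ X).inv = (λ_ X).hom := by
  rw [← UnitaryMonoidal.dagger_leftUnitor, UnitaryCategory.dagger_dagger]

theorem dagger_rightUnitor_inv (X : D) : dagger (ρ_ X).inv = (ρ_ X).hom := by
  rw [← UnitaryMonoidal.dagger_rightUnitor, UnitaryCategory.dagger_dagger]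

/-- The adjoint of a dual pair. -/
@[reducible]
def conjPairing (A A' : D)
    [ExactPairing A A'] : ExactPairing A' A where
  coevaluation' := dagger (ε_ A A')
  evaluation' := dagger (η_ A A')
  coevaluation_evaluation' := by
    have := congrArg dagger (ExactPairing.evaluation_coevaluation A A')
    simpa only [UnitaryCategory.dagger_comp, dagger_whiskerLeft, dagger_whiskerRight, UnitaryMonoidal.dagger_associator,
      UnitaryMonoidal.dagger_leftUnitor, dagger_rightUnitor_inv, Category.assoc] using this
  evaluation_coevaluation' := by
    have := congrArg dagger (ExactPairing.coevaluation_evaluation A A')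
    simpa only [UnitaryCategory.dagger_comp, dagger_whiskerLeft, dagger_whiskerRight, dagger_associator_inv,
      dagger_leftUnitor_inv, UnitaryMonoidal.dagger_rightUnitor, Category.assoc] using this

end Dagger

end Bend

end BoundaryTube

end

noncomputable section

namespace BoundaryTube

open UnitaryCategory (dagger)

section Antipode

open Fam MonoidalLeftAction

variable {D ℳ I J : Type*} [Category D] [Preadditive D] [Linear ℂ D] [MonoidalCategory D]
  [UnitaryCategory D] [Category ℳ] [Preadditive ℳ] [Linear ℂ ℳ]
  [UnitaryCategory ℳ] [MonoidalLeftAction D ℳ] [UnitaryLeftModule D ℳ]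
  [Fintype I] [DecidableEq I] [Fintype J] [DecidableEq J]

/-! ### Bending the vertices of a diagram -/

section Vertices

variable {M : J → ℳ} {A B : D} (A' B' : D) [ExactPairing A A'] [ExactPairing B B']

/-- Bending down splitting vertices. -/
def bendLin : Vert M A →ₗ[ℂ] Covert M A' where
  toFun := bend A'
  map_add' f g := by rw [bend, actionHomRight_add, Preadditive.add_comp]; rfl
  map_smul' c f := by rw [bend, actionHomRight_smul, Linear.smul_comp]; rfl

theorem bendLin_apply (ν : Vert M A) : bendLin A' ν = bend A' ν := rfl

/-- Bending up fusion vertices with legs on the dual. -/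
def unbendLin : Covert M A' →ₗ[ℂ] Vert M A where
  toFun := unbend A
  map_add' f g := by rw [unbend, actionHomRight_add, Preadditive.comp_add]; rfl
  map_smul' c f := by rw [unbend, actionHomRight_smul, Linear.comp_smul]; rfl

theorem unbendLin_apply (η : Covert M A') : unbendLin (A := A) A' η = unbend A η := rfl

variable [hM : Fact (IsIrr M)]

/-- The difference is zero because it pairs to zero with its own adjoint. -/
theorem vert_ext {ν ν' : Vert M A} (h : ∀ η : Covert M A, wallTrace M (ν ≫ η) =
    wallTrace M (ν' ≫ η)) : ν = ν' := by
  rw [← sub_eq_zero]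
  refine eq_zero_of_wallTrace_comp_dag _ ?_
  rw [Preadditive.sub_comp, map_sub, h, sub_self]

/-- The transpose of `unbendLin` with respect to the pairings of vertices. -/
def lift : Covert M A →ₗ[ℂ] Vert M A' :=
  ∑ k, ((wallPairing M (A ⊙ₗ fam M)) (unbend A (covec M (A' ⊙ₗ fam M) k))).smulRight
    (vec M (A' ⊙ₗ fam M) k)

theorem wallTrace_lift_comp (ζ : Covert M A) (η : Covert M A') :
    wallTrace M (lift A' ζ ≫ η) = wallTrace M (unbend A η ≫ ζ) := by
  conv_rhs => rw [← (vec_covec M (A' ⊙ₗ fam M)).right η]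
  rw [← unbendLin_apply]
  simp only [lift, LinearMap.sum_apply, LinearMap.smulRight_apply, Preadditive.sum_comp, map_sum,
    Linear.smul_comp, map_smul, smul_eq_mul, wallPairing_apply, unbendLin_apply]
  exact Finset.sum_congr rfl fun k _ => mul_comm _ _

/-- This invariance of the pairing characterises `lift`, because every fusion vertex on A' is a bent
one. Dimensions enter only later, when `lift` is compared with a bent diagram. -/
theorem wallTrace_lift_comp_bend (ζ : Covert M A) (ν : Vert M A) :
    wallTrace M (lift A' ζ ≫ bend A' ν) = wallTrace M (ν ≫ ζ) := by
  rw [wallTrace_lift_comp, unbend_bend]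

variable {A' B'}

/-- Bending is bijective and `lift` preserves the pairing, so dual bases go to dual bases, with the
two roles exchanged. -/
theorem IsDualPair.bend {ι : Type*} [Fintype ι] {e : ι → Vert M A} {e' : ι → Covert M A}
    (h : IsDualPair (wallPairing M (A ⊙ₗ fam M)) e e') :
    IsDualPair (wallPairing M (A' ⊙ₗ fam M)) (fun k => lift A' (e' k))
      (fun k => BoundaryTube.bend A' (e k)) := by
  constructor
  · intro v
    refine vert_ext fun η => ?_
    rw [← bend_unbend (A := A) η]
    conv_rhs => rw [← h.left (unbend A η), ← bendLin_apply]
    simp only [Preadditive.sum_comp, Linear.smul_comp, map_sum, map_smul, wallPairing_apply,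
      wallTrace_lift_comp_bend, smul_eq_mul, bendLin_apply, Preadditive.comp_sum, Linear.comp_smul]
    exact Finset.sum_congr rfl fun k _ => mul_comm _ _
  · intro u
    rw [← bend_unbend (A := A) u]
    conv_rhs => rw [← h.left (unbend A u), ← bendLin_apply]
    simp only [wallPairing_apply, wallTrace_lift_comp_bend, map_sum, map_smul, bendLin_apply]

/-- Transpose of `mate_comp_bend`, tested against bent vertices. -/
theorem lift_comp_mate {f : A ⟶ B} {g : B' ⟶ A'}
    (h : g ▷ A ≫ ε_ A A' = B' ◁ f ≫ ε_ B B') (ζ : Covert M B) :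
    lift A' (f ⊵ₗ fam M ≫ ζ) = lift B' ζ ≫ g ⊵ₗ fam M := by
  refine vert_ext fun η => ?_
  rw [← bend_unbend (A := A) η, wallTrace_lift_comp_bend, Category.assoc, mate_comp_bend h,
    wallTrace_lift_comp_bend, Category.assoc]

variable {ι : Type*} [Fintype ι] {e : ι → Vert M A} {e' : ι → Covert M A}
    (h : IsDualPair (wallPairing M (A ⊙ₗ fam M)) e e')

include h in
-- Writing eₖ as its bend bent back up places ∑ bend eₖ ≫ lift e'ₖ above a coevaluation, and this
-- sum is the resolution of the identity for the bent dual pair.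
theorem sum_vertMul_lift :
    ∑ k, vertMul (e k) (lift A' (e' k)) = (λₗ[D] (fam M)).inv ≫ η_ A A' ⊵ₗ fam M := by
  have h1 : ∀ k, e k = unbend A (bend A' (e k)) := fun k => (unbend_bend _).symm
  calc _ = ∑ k, coevM A A' (fam M) ≫ A ⊴ₗ (bend A' (e k) ≫ lift A' (e' k)) ≫
        (αₗ A A' (fam M)).inv := by
        refine Finset.sum_congr rfl fun k _ => ?_
        conv_lhs => rw [h1 k]
        simp only [vertMul_apply, unbend, actionHomRight_comp, Category.assoc]
    _ = coevM A A' (fam M) ≫ A ⊴ₗ (∑ k, bend A' (e k) ≫ lift A' (e' k)) ≫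
        (αₗ A A' (fam M)).inv := by
        simp only [actionHomRight_sum, Preadditive.sum_comp, Preadditive.comp_sum]
    _ = _ := by rw [sum_covec_comp_vec h.bend]; simp [coevM]

include h in
-- Here the resolution of the identity ∑ e'ₖ ≫ eₖ appears directly below the evaluation.
theorem sum_covertMul_bend :
    ∑ k, covertMul (bend A' (e k)) (e' k) = ε_ A A' ⊵ₗ fam M ≫ (λₗ[D] (fam M)).hom := by
  calc _ = (αₗ A' A (fam M)).hom ≫ A' ⊴ₗ (∑ k, e' k ≫ e k) ≫ evM A A' (fam M) := by
        simp only [actionHomRight_sum, Preadditive.sum_comp, Preadditive.comp_sum,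
          covertMul_apply, bend, actionHomRight_comp, Category.assoc]
    _ = _ := by rw [sum_covec_comp_vec h]; simp [evM]

theorem coev_comp_covertMul (ζ : Covert M A) (ν : Vert M A) :
    η_ A A' ⊵ₗ fam M ≫ covertMul ζ (bend A' ν) = (λₗ[D] (fam M)).hom ≫ ν ≫ ζ := by
  conv_rhs => rw [← unbend_bend (A' := A') ν]
  simp [covertMul_apply, unbend, coevM]

/-- The evaluation joins the two legs, which turns the product into `lift A' ζ` followed by a bent
vertex; the invariance of the pairing then applies. -/
theorem wallTrace_vertMul_ev (ζ : Covert M A) (ν : Vert M A) (φ : fam M ⟶ fam M) :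
    wallTrace M (vertMul (lift A' ζ) ν ≫ ε_ A A' ⊵ₗ fam M ≫ (λₗ[D] (fam M)).hom ≫ φ) =
      wallTrace M (ν ≫ A ⊴ₗ φ ≫ ζ) := by
  have h1 : vertMul (lift A' ζ) ν ≫ ε_ A A' ⊵ₗ fam M ≫ (λₗ[D] (fam M)).hom ≫ φ =
      lift A' ζ ≫ bend A' (ν ≫ A ⊴ₗ φ) := by
    rw [bend_comp]
    simp [vertMul_apply, bend, evM]
  rw [h1, wallTrace_lift_comp_bend, Category.assoc]

include h in
-- The sum over k creates a coevaluation next to the evaluation already present, and the zigzag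
-- removes both.
theorem sum_vertMul_ev_vertMul (ζ : Covert M A) :
    ∑ k, vertMul (vertMul (lift A' ζ) (e k) ≫ ε_ A A' ⊵ₗ fam M) (lift A' (e' k)) ≫
      (λ_ A').hom ⊵ₗ fam M = lift A' ζ := by
  calc _ = ∑ k, lift A' ζ ≫ A' ⊴ₗ (vertMul (e k) (lift A' (e' k)) ≫ (αₗ A A' (fam M)).hom) ≫
        evM A A' _ := by
        refine Finset.sum_congr rfl fun k _ => ?_
        simp only [vertMul_apply, evM, Category.assoc, Iso.inv_hom_id, Category.comp_id,
          leftUnitor_actionHom, Iso.inv_hom_id_assoc, actionHomRight_comp]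
        rw [← actionUnitIso_hom_naturality]
        have := evM_natural A A' (lift A' (e' k))
        simp only [evM, Category.assoc] at this
        rw [this]
    _ = lift A' ζ ≫ A' ⊴ₗ coevM A A' _ ≫ evM A A' _ := by
        simp only [← Preadditive.comp_sum, ← Preadditive.sum_comp, ← actionHomRight_sum]
        rw [sum_vertMul_lift h]
        simp [coevM]
    _ = _ := by rw [action_coevM_evM, Category.comp_id]

theorem bend_vertMul (ν : Vert M A) (ν' : Vert M B) :
    bend (B' ⊗ A') (vertMul ν ν') = covertMul (bend B' ν') (bend A' ν) := by
  have h := congrArg (B' ⊴ₗ ·) (evM_natural A A' ν')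
  simp only [actionHomRight_comp] at h
  simp only [bend, vertMul_apply, covertMul_apply, evM_tensor, actionHomRight_comp,
    Category.assoc]
  rw [← reassoc_of% h]
  simp only [tensor_actionHomRight, Category.assoc, Iso.inv_hom_id_assoc,
    ← actionHomRight_comp_assoc, Iso.inv_hom_id,
    actionHomRight_id, Category.id_comp]

/-- Tested against an arbitrary η, both sides become the same trace once the leg of A ⊗ B is unbent
in two steps. -/
theorem lift_covertMul (ζ : Covert M A) (ζ' : Covert M B) :
    lift (B' ⊗ A') (covertMul ζ ζ') = vertMul (lift B' ζ') (lift A' ζ) := by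
  refine vert_ext fun η => ?_
  have h1 : vertMul (lift B' ζ') (lift A' ζ) ≫ η =
      lift B' ζ' ≫ B' ⊴ₗ lift A' ζ ≫ (αₗ B' A' (fam M)).inv ≫ η := by simp [vertMul_apply]
  rw [wallTrace_lift_comp, h1, wallTrace_lift_comp, comp_unbend, Category.assoc,
    wallTrace_lift_comp]
  congr 1
  simp [unbend, coevM_tensor, covertMul_apply]

end Vertices

/-! ### The antipode -/

variable (S : I → D) (M : J → ℳ) [hS : Fact (IsIrr S)] [hM : Fact (IsIrr M)]

/-- The antipode on the diagrams with arc `A`. -/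
def arcAntipode (A A' : D) [ExactPairing A A'] :
    Vert M A →ₗ[ℂ] Covert M A →ₗ[ℂ] LeftTube S M :=
  ((arc S M A').compl₁₂ (lift (A := A) A') (bendLin (A := A) A')).flip

variable {S M} in
theorem arcAntipode_apply {A A' : D} [ExactPairing A A'] (ν : Vert M A) (ζ : Covert M A) :
    arcAntipode S M A A' ν ζ = arc S M A' (lift A' ζ) (bend A' ν) := rfl

-- The mate of f moves across the dual arc in the opposite direction. Since A' and B' are arbitrary,
-- f = 𝟙 also covers a change of dual.
variable {S M} in
theorem arcAntipode_natural {A A' B B' : D} [ExactPairing A A'] [ExactPairing B B'] (f : A ⟶ B)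
    (ν : Vert M A) (ζ : Covert M B) : arcAntipode S M A A' ν (f ⊵ₗ fam M ≫ ζ) =
      arcAntipode S M B B' (ν ≫ f ⊵ₗ fam M) ζ := by
  obtain ⟨g, hg⟩ := exists_mate A A' B B' f
  rw [arcAntipode_apply, arcAntipode_apply, lift_comp_mate hg, ← arc_natural, mate_comp_bend hg]

variable [RigidCategory D]

/-- The antipode of the tube algebra. -/
def tubeAntipode : LeftTube S M →ₗ[ℂ] LeftTube S M :=
  tubeLift S M fun a => arcAntipode S M (S a) (S a)ᘁ

variable {S M}

theorem tubeAntipode_arc {A : D} (A' : D) [ExactPairing A A'] (ν : Vert M A) (ζ : Covert M A) :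
    tubeAntipode S M (arc S M A ν ζ) = arc S M A' (lift A' ζ) (bend A' ν) := by
  rw [tubeAntipode, tubeLift_arc (fun A => arcAntipode S M A Aᘁ)
    (fun f ν ζ => arcAntipode_natural f ν ζ)]
  -- Naturality along the identity of A, taken with two different duals, removes the choice of dual.
  have := arcAntipode_natural (S := S) (A' := Aᘁ) (B' := A') (𝟙 A) ν ζ
  rw [← arcAntipode_apply]
  simpa using this

/-- The splitting vertices sum to a coevaluation; sliding it off contracts the arc A ⊗ A' to a unit
arc carrying the closed wall ν ≫ ζ. -/
theorem tubeMul_antipode (x : LeftTube S M) :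
    TensorProduct.lift (tubeMul S M) ((tubeAntipode S M).lTensor _ (tubeComul S M x)) =
      (tubeWeakBialgebra S M).counitL x := by
  change _ = TensorProduct.lid ℂ _ ((tubeCounit S M ∘ₗ (tubeMul S M).flip x).rTensor _
    (tubeComul S M (tubeOne S M)))
  induction x using arc_induction with
  | h0 => simp
  | hadd x x' h h' =>
    simp only [map_add, h, h', LinearMap.comp_add, LinearMap.rTensor_add, LinearMap.add_apply]
  | harc a ν ζ =>
    simp only [tubeComul_arc', map_sum, LinearMap.lTensor_tmul, TensorProduct.lift.tmul,
      tubeAntipode_arc (S a)ᘁ, tubeMul_arc, tubeOne_eq, LinearMap.rTensor_tmul,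
      TensorProduct.lid_tmul, LinearMap.comp_apply, LinearMap.flip_apply, tubeCounit_arc,
      vertMul_comp_covertMul]
    simp only [← LinearMap.sum_apply, ← map_sum, ← map_smul]
    rw [sum_vertMul_lift (vec_covec M (S a ⊙ₗ fam M)), ← arc_natural, coev_comp_covertMul]
    congr 1
    -- Expanding this vertex in the dual bases of the unit arc reproduces the sum over the two legs
    -- of Δ(1).
    have := (vec_covec M (𝟙_ D ⊙ₗ fam M)).right ((λₗ (fam M)).hom ≫ ν ≫ ζ)
    simp only [wallPairing_apply, actionUnitIso_hom_naturality] at this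
    rw [actionUnitIso_hom_naturality, this]

/-- The fusion vertices sum to an evaluation, which slides to the splitting side and closes the leg
between `lift ζ` and ν. -/
theorem tubeAntipode_mul (x : LeftTube S M) :
    TensorProduct.lift (tubeMul S M) ((tubeAntipode S M).rTensor _ (tubeComul S M x)) =
      (tubeWeakBialgebra S M).counitR x := by
  change _ = TensorProduct.rid ℂ _ ((tubeCounit S M ∘ₗ tubeMul S M x).lTensor _
    (tubeComul S M (tubeOne S M)))
  induction x using arc_induction with
  | h0 => simp
  | hadd x x' h h' =>
    simp only [map_add, h, h', LinearMap.comp_add, LinearMap.lTensor_add, LinearMap.add_apply]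
  | harc a ν ζ =>
    simp only [tubeComul_arc', map_sum, LinearMap.rTensor_tmul, TensorProduct.lift.tmul,
      tubeAntipode_arc (S a)ᘁ, tubeMul_arc, tubeOne_eq, LinearMap.lTensor_tmul,
      TensorProduct.rid_tmul, LinearMap.comp_apply, tubeCounit_arc,
      vertMul_comp_covertMul]
    simp only [← map_sum]
    rw [sum_covertMul_bend (vec_covec M (S a ⊙ₗ fam M)), arc_natural]
    have := (vec_covec M (𝟙_ D ⊙ₗ fam M)).left
      (vertMul (lift (S a)ᘁ ζ) ν ≫ ε_ (S a) (S a)ᘁ ⊵ₗ fam M)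
    rw [← this]
    simp only [map_sum, map_smul, LinearMap.sum_apply, LinearMap.smul_apply]
    refine Finset.sum_congr rfl fun k _ => ?_
    congr 1
    rw [wallPairing_apply, ← wallTrace_vertMul_ev (A' := (S a)ᘁ)]
    simp

theorem tubeAntipode_mul_arc {A : D} (A' : D) [ExactPairing A A'] (ν : Vert M A)
    (ζ : Covert M A) :
    TensorProduct.lift (tubeMul S M) ((tubeAntipode S M).rTensor _
      (tubeComul S M (arc S M A ν ζ))) =
      arc S M (𝟙_ D) (vertMul (lift A' ζ) ν ≫ ε_ A A' ⊵ₗ fam M) (λₗ (fam M)).hom := by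
  simp only [tubeComul_arc', map_sum, LinearMap.rTensor_tmul, TensorProduct.lift.tmul,
    tubeAntipode_arc A', tubeMul_arc]
  simp only [← map_sum]
  rw [sum_covertMul_bend (vec_covec M (A ⊙ₗ fam M)), arc_natural]

/-- The first two factors give a unit arc by `tubeAntipode_mul_arc`; multiplying by the third and
summing leaves a zigzag. -/
theorem tubeAntipode_mul_antipode (x : LeftTube S M) :
    TensorProduct.lift (tubeMul S M) (TensorProduct.map
      (TensorProduct.lift (tubeMul S M) ∘ₗ (tubeAntipode S M).rTensor _)
      (tubeAntipode S M) ((tubeComul S M).rTensor _ (tubeComul S M x))) =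
        tubeAntipode S M x := by
  induction x using arc_induction with
  | h0 => simp
  | hadd x x' h h' => simp only [map_add, h, h']
  | harc a ν ζ =>
    rw [tubeComul_arc']
    simp only [map_sum, LinearMap.rTensor_tmul, TensorProduct.map_tmul, LinearMap.comp_apply,
      tubeAntipode_mul_arc (S a)ᘁ, tubeAntipode_arc (S a)ᘁ, TensorProduct.lift.tmul,
      tubeMul_arc, unit_covertMul, arc_natural]
    simp only [← LinearMap.sum_apply, ← map_sum]
    rw [sum_vertMul_ev_vertMul (vec_covec M (S a ⊙ₗ fam M))]

variable (S M) in
/-- The tube algebra as a weak Hopf algebra. -/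
def tubeWeakHopfAlgebra : WeakHopfAlgebra (LeftTube S M) where
  toWeakBialgebra := tubeWeakBialgebra S M
  antipode := tubeAntipode S M
  mul_antipode := tubeMul_antipode
  antipode_mul := tubeAntipode_mul
  antipode_mul_antipode := tubeAntipode_mul_antipode

/-- Both `bend` and `lift` reverse products, with B' ⊗ A' taken as the dual of A ⊗ B. -/
theorem tubeAntipode_antimul (x y : LeftTube S M) :
    tubeAntipode S M (tubeMul S M x y) =
      tubeMul S M (tubeAntipode S M y) (tubeAntipode S M x) := by
  induction x using arc_induction with
  | h0 => simp
  | hadd x x' h h' => simp only [map_add, LinearMap.add_apply, h, h']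
  | harc a ν ζ =>
  induction y using arc_induction with
  | h0 => simp
  | hadd x x' h h' => simp only [map_add, LinearMap.add_apply, h, h']
  | harc b ν' ζ' =>
    rw [tubeMul_arc, tubeAntipode_arc ((S b)ᘁ ⊗ (S a)ᘁ), tubeAntipode_arc (A := S a) (S a)ᘁ,
      tubeAntipode_arc (A := S b) (S b)ᘁ, tubeMul_arc, bend_vertMul, lift_covertMul]

/-! ### The involution -/

/-- Reflection of diagrams on the space of pairs of vertices. -/
def reflectComponent (p : ArcLabel I J) :
    (M p.2.1 ⟶ S p.1 ⊙ₗ M p.2.2.1) ⊗[ℂ] (S p.1 ⊙ₗ M p.2.2.2.1 ⟶ M p.2.2.2.2)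
      →ₛₗ[starRingEnd ℂ] LeftTube S M :=
  TensorProduct.lift (LinearMap.mk₂'ₛₗ (starRingEnd ℂ) (starRingEnd ℂ)
    (fun ν ζ => leftDiagram S M p.1 (dagger ζ) (dagger ν))
    (fun ν ν' ζ => by
      rw [UnitaryCategory.dagger_add, leftDiagram, TensorProduct.tmul_add, map_add]; rfl)
    (fun c ν ζ => by
      rw [UnitaryCategory.dagger_smul, leftDiagram, TensorProduct.tmul_smul, map_smul]; rfl)
    (fun ν ζ ζ' => by
      rw [UnitaryCategory.dagger_add, leftDiagram, TensorProduct.add_tmul, map_add]; rfl)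
    (fun c ν ζ => by
      rw [UnitaryCategory.dagger_smul, leftDiagram, ← TensorProduct.smul_tmul', map_smul]; rfl))

variable (S M) in
/-- Reflection of diagrams. -/
def reflect : LeftTube S M →ₛₗ[starRingEnd ℂ] LeftTube S M :=
  ∑ p : ArcLabel I J, (reflectComponent p).comp (DirectSum.component ℂ (ArcLabel I J) (fun p =>
    (M p.2.1 ⟶ S p.1 ⊙ₗ M p.2.2.1) ⊗[ℂ] (S p.1 ⊙ₗ M p.2.2.2.1 ⟶ M p.2.2.2.2)) p)

theorem reflect_leftDiagram (a : I) {d e f g : J} (ν : M d ⟶ S a ⊙ₗ M e)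
    (ζ : S a ⊙ₗ M f ⟶ M g) :
    reflect S M (leftDiagram S M a ν ζ) = leftDiagram S M a (dagger ζ) (dagger ν) := by
  rw [reflect, LinearMap.sum_apply, Finset.sum_eq_single (a, d, e, f, g)]
  · rw [LinearMap.comp_apply, leftDiagram, DirectSum.component.lof_self]
    rfl
  · intro p _ hp
    rw [LinearMap.comp_apply, leftDiagram, DirectSum.component.of, dif_neg hp.symm, map_zero]
  · simp

theorem reflect_simpleArc (a : I) (ν : Vert M (S a)) (ζ : Covert M (S a)) :
    reflect S M (simpleArc S M a ν ζ) = simpleArc S M a (dag ζ) (dag ν) := by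
  simp only [simpleArc_apply, map_sum, reflect_leftDiagram, dag_apply]
  calc _ = ∑ d : J, ∑ e : J, ∑ g : J, ∑ f : J,
      leftDiagram S M a (dagger (ent ζ f g)) (dagger (ent ν d e)) := by
        refine Finset.sum_congr rfl fun d _ => Finset.sum_congr rfl fun e _ => Finset.sum_comm
    _ = ∑ d : J, ∑ g : J, ∑ e : J, ∑ f : J,
      leftDiagram S M a (dagger (ent ζ f g)) (dagger (ent ν d e)) :=
        Finset.sum_congr rfl fun d _ => Finset.sum_comm
    _ = ∑ g : J, ∑ d : J, ∑ f : J, ∑ e : J,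
      leftDiagram S M a (dagger (ent ζ f g)) (dagger (ent ν d e)) := by
        rw [Finset.sum_comm]
        refine Finset.sum_congr rfl fun d _ => Finset.sum_congr rfl fun e _ => Finset.sum_comm
    _ = ∑ g : J, ∑ f : J, ∑ d : J, ∑ e : J,
      leftDiagram S M a (dagger (ent ζ f g)) (dagger (ent ν d e)) :=
        Finset.sum_congr rfl fun d _ => Finset.sum_comm
    _ = _ := Finset.sum_congr rfl fun d _ => Finset.sum_congr rfl fun e _ => Finset.sum_comm

/-- Reflection replaces inclusions and projections by their adjoints; after sliding, the adjoint of
∑ proj ≫ inc = 𝟙 recombines them. -/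
theorem reflect_arc (A : D) (ν : Vert M A) (ζ : Covert M A) :
    reflect S M (arc S M A ν ζ) = arc S M A (dag ζ) (dag ν) := by
  have h : arc S M A ν ζ = arcOf M (hS.out.semisimple A).some ν ζ := rfl
  rw [h, arcOf_apply, map_sum]
  simp only [reflect_simpleArc]
  simp only [simpleArc_eq_arc, dag_comp, dag_actL, arc_natural,
    Category.assoc, ← comp_actionHomLeft, ← UnitaryCategory.dagger_comp]
  simp only [← LinearMap.sum_apply, ← map_sum, ← Preadditive.comp_sum, ← actionHomLeft_sum,
    ← dagger_sum, Decomposition.sum_proj_inc, UnitaryCategory.dagger_id, id_actionHomLeft,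
    Category.comp_id]

theorem dag_vertMul {A B : D} (ν : Vert M A) (ν' : Vert M B) :
    dag (vertMul ν ν') = covertMul (dag ν) (dag ν') := by
  simp [vertMul_apply, covertMul_apply, dag_comp, dag_actR, dag_assoc_inv]

theorem dag_covertMul {A B : D} (ζ : Covert M A) (ζ' : Covert M B) :
    dag (covertMul ζ ζ') = vertMul (dag ζ) (dag ζ') := by
  simp [vertMul_apply, covertMul_apply, dag_comp, dag_actR, dag_assoc_hom]

theorem reflect_mul (x y : LeftTube S M) :
    reflect S M (tubeMul S M x y) = tubeMul S M (reflect S M x) (reflect S M y) := by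
  induction x using arc_induction with
  | h0 => simp
  | hadd x x' h h' => simp only [map_add, LinearMap.add_apply, h, h']
  | harc a ν ζ =>
  induction y using arc_induction with
  | h0 => simp
  | hadd x x' h h' => simp only [map_add, h, h']
  | harc b ν' ζ' =>
    rw [tubeMul_arc, reflect_arc, reflect_arc, reflect_arc, tubeMul_arc, dag_vertMul,
      dag_covertMul]

variable (S M) in
/-- The involution of the tube algebra. -/
def tubeStar : LeftTube S M →ₛₗ[starRingEnd ℂ] LeftTube S M :=
  (tubeAntipode S M).comp (reflect S M)

theorem tubeStar_arc {A : D} (A' : D) [ExactPairing A A'] (ν : Vert M A) (ζ : Covert M A) :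
    tubeStar S M (arc S M A ν ζ) = arc S M A' (lift A' (dag ν)) (bend A' (dag ζ)) := by
  rw [tubeStar, LinearMap.comp_apply, reflect_arc, tubeAntipode_arc A']

theorem tubeStar_mul (x y : LeftTube S M) :
    tubeStar S M (tubeMul S M x y) = tubeMul S M (tubeStar S M y) (tubeStar S M x) := by
  simp only [tubeStar, LinearMap.comp_apply, reflect_mul, tubeAntipode_antimul]

theorem wallPairing_dag {A : D} (ν : Vert M A) (ζ : Covert M A) :
    wallTrace M (dag ζ ≫ dag ν) = conj (wallTrace M (ν ≫ ζ)) := by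
  rw [← dag_comp, wallTrace_dag]

/-- The pairing of the adjoints is the complex conjugate of the original pairing. -/
theorem IsDualPair.dag {A : D} {ι : Type*} [Fintype ι] {e : ι → Vert M A} {e' : ι → Covert M A}
    (h : IsDualPair (wallPairing M (A ⊙ₗ fam M)) e e') :
    IsDualPair (wallPairing M (A ⊙ₗ fam M)) (fun k => Fam.dag (e' k)) (fun k => Fam.dag (e k)) := by
  constructor
  · intro v
    have := congrArg Fam.dag (h.right (Fam.dag v))
    simpa [map_sum, wallPairing_apply, ← wallPairing_dag] using this
  · intro v
    have := congrArg Fam.dag (h.left (Fam.dag v))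
    simpa [map_sum, wallPairing_apply, ← wallPairing_dag] using this

/-- Adjoints followed by bending send a dual pair to a dual pair, which may be used to compute the
comultiplication of the image. -/
theorem tubeComul_star (x : LeftTube S M) : tubeComul S M (tubeStar S M x) =
    TensorProduct.map (tubeStar S M) (tubeStar S M) (tubeComul S M x) := by
  induction x using arc_induction with
  | h0 => simp
  | hadd x x' h h' => simp only [map_add, h, h']
  | harc a ν ζ =>
    have h := (vec_covec M (S a ⊙ₗ fam M)).dag.bend (A' := (S a)ᘁ)
    rw [tubeStar_arc (S a)ᘁ, tubeComul_arc h, tubeComul_arc', map_sum]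
    simp only [TensorProduct.map_tmul, tubeStar_arc (S a)ᘁ]

variable [UnitaryMonoidal D]

/-- The adjoint of the evaluation is the coevaluation of the adjoint duality, so † exchanges bending
down and bending up. -/
theorem dag_bend {A A' : D} [ExactPairing A A'] [ExactPairing A' A]
    (h : η_ A' A = dagger (ε_ A A')) (ν : Vert M A) :
    dag (bend A' ν) = unbend A' (dag ν) := by
  simp [bend, unbend, evM, coevM, dag_comp, dag_actR, dag_actL, dag_assoc_inv, dag_unit_hom, h]

theorem lift_dag_lift {A A' : D} [ExactPairing A A'] [ExactPairing A' A]
    (h : η_ A' A = dagger (ε_ A A')) (ν : Vert M A) :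
    lift A (dag (lift A' (dag ν))) = ν := by
  refine vert_ext fun η => ?_
  have h1 : unbend A' η = dag (bend A' (dag η)) := by rw [dag_bend h, dag_dag]
  rw [wallTrace_lift_comp, h1, wallPairing_dag, wallTrace_lift_comp_bend, wallPairing_dag,
    Complex.conj_conj]

theorem tubeStar_star (x : LeftTube S M) : tubeStar S M (tubeStar S M x) = x := by
  induction x using arc_induction with
  | h0 => simp
  | hadd x x' h h' => simp only [map_add, h, h']
  | harc a ν ζ =>
    -- The outer involution may be computed with any dual of `(S a)ᘁ`. With the adjoint duality maps
    -- it undoes the inner one.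
    let _ := conjPairing (S a) (S a)ᘁ
    have h : η_ (S a)ᘁ (S a) = dagger (ε_ (S a) (S a)ᘁ) := rfl
    rw [tubeStar_arc (A := S a) (S a)ᘁ, tubeStar_arc (A := (S a)ᘁ) (S a), dag_bend h, dag_dag,
      bend_unbend, lift_dag_lift h]

end Antipode

end BoundaryTube

end

noncomputable section

namespace BoundaryTube

open UnitaryCategory (dagger)

/-! ### Faithful representations from orthonormal bases -/

section Rep

variable {W : Type*} [AddCommGroup W] [Module ℂ W] (H : WeakBialgebra W)
  (star : W →ₛₗ[starRingEnd ℂ] W)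

/-- This is the GNS construction for h: W is a Hilbert space with orthonormal basis b, and x acts by
left multiplication with matrix h(b_p* x b_q). -/
theorem exists_faithful_rep_of_onb_fin
    (star_mul : ∀ x y, star (H.mul x y) = H.mul (star y) (star x)) (h : W →ₗ[ℂ] ℂ) {n : ℕ}
    (b : Fin n → W) (ho : ∀ p q, h (H.mul (star (b p)) (b q)) = if p = q then 1 else 0)
    (hspan : ∀ x, ∃ c : Fin n → ℂ, x = ∑ p, c p • b p) :
    ∃ (V : Type) (_ : NormedAddCommGroup V) (_ : InnerProductSpace ℂ V)
      (_ : CompleteSpace V) (π : W →ₗ[ℂ] (V →L[ℂ] V)),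
      Function.Injective π ∧ π H.one = 1 ∧ (∀ x y, π (H.mul x y) = π x * π y) ∧
        ∀ x, π (star x) = ContinuousLinearMap.adjoint (π x) := by
  have key : ∀ x, ∑ p, h (H.mul (star (b p)) x) • b p = x := by
    intro x
    obtain ⟨c, rfl⟩ := hspan x
    simp [ho]
  have herm : ∀ x y, h (H.mul (star x) y) = conj (h (H.mul (star y) x)) := by
    intro x y
    obtain ⟨c, rfl⟩ := hspan x
    obtain ⟨d, rfl⟩ := hspan y
    simp [ho, mul_comm]
  let m : W →ₗ[ℂ] Matrix (Fin n) (Fin n) ℂ :=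
    { toFun := fun x => Matrix.of fun p q => h (H.mul (star (b p)) (H.mul x (b q)))
      map_add' := fun x y => by ext p q; simp
      map_smul' := fun c x => by ext p q; simp }
  have hm : ∀ x p q, m x p q = h (H.mul (star (b p)) (H.mul x (b q))) := fun _ _ _ => rfl
  refine ⟨EuclideanSpace ℂ (Fin n), inferInstance, inferInstance, inferInstance,
    (Matrix.toEuclideanCLM (n := Fin n) (𝕜 := ℂ)).toAlgEquiv.toLinearMap ∘ₗ m, ?_, ?_, ?_, ?_⟩
  · rw [LinearMap.coe_comp]
    refine (Matrix.toEuclideanCLM (n := Fin n) (𝕜 := ℂ)).injective.comp ?_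
    rw [injective_iff_map_eq_zero]
    intro x hx
    have h1 : ∀ q, H.mul x (b q) = 0 := fun q => by
      rw [← key (H.mul x (b q))]
      refine Finset.sum_eq_zero fun p _ => ?_
      rw [← hm, hx, Matrix.zero_apply, zero_smul]
    -- If x kills every basis vector it kills the unit, hence x = 0.
    obtain ⟨c, hc⟩ := hspan H.one
    rw [← H.mul_one x, hc, map_sum]
    exact Finset.sum_eq_zero fun p _ => by rw [map_smul, h1, smul_zero]
  · have : m H.one = 1 := by
      ext p q
      rw [hm, H.one_mul, ho, Matrix.one_apply]
    change Matrix.toEuclideanCLM (n := Fin n) (𝕜 := ℂ) (m H.one) = 1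
    rw [this, map_one]
  · intro x y
    have : m (H.mul x y) = m x * m y := by
      ext p q
      rw [hm, Matrix.mul_apply, H.mul_assoc]
      conv_lhs => rw [← key (H.mul y (b q))]
      simp [hm, mul_comm]
    change Matrix.toEuclideanCLM (n := Fin n) (𝕜 := ℂ) (m (H.mul x y)) =
      Matrix.toEuclideanCLM (n := Fin n) (𝕜 := ℂ) (m x) *
        Matrix.toEuclideanCLM (n := Fin n) (𝕜 := ℂ) (m y)
    rw [this, map_mul]
  · intro x
    have : m (star x) = Star.star (m x) := by
      ext p q
      rw [Matrix.star_apply, hm, hm, Complex.star_def, ← herm, star_mul, H.mul_assoc]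
    change Matrix.toEuclideanCLM (n := Fin n) (𝕜 := ℂ) (m (star x)) =
      ContinuousLinearMap.adjoint (Matrix.toEuclideanCLM (n := Fin n) (𝕜 := ℂ) (m x))
    rw [this, map_star, ContinuousLinearMap.star_eq_adjoint]

theorem exists_faithful_rep_of_onb
    (star_mul : ∀ x y, star (H.mul x y) = H.mul (star y) (star x)) (h : W →ₗ[ℂ] ℂ)
    {P : Type*} [Fintype P] [DecidableEq P]
    (b : P → W) (ho : ∀ p q, h (H.mul (star (b p)) (b q)) = if p = q then 1 else 0)
    (hspan : ∀ x, ∃ c : P → ℂ, x = ∑ p, c p • b p) :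
    ∃ (V : Type) (_ : NormedAddCommGroup V) (_ : InnerProductSpace ℂ V)
      (_ : CompleteSpace V) (π : W →ₗ[ℂ] (V →L[ℂ] V)),
      Function.Injective π ∧ π H.one = 1 ∧ (∀ x y, π (H.mul x y) = π x * π y) ∧
        ∀ x, π (star x) = ContinuousLinearMap.adjoint (π x) := by
  let e := Fintype.equivFin P
  refine exists_faithful_rep_of_onb_fin H star star_mul h (b ∘ e.symm)
    (fun p q => ?_) (fun x => ?_)
  · simp [ho]
  · obtain ⟨c, hc⟩ := hspan x
    exact ⟨c ∘ e.symm, by rw [hc, ← e.symm.sum_comp]; rfl⟩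

end Rep

/-! ### The Haar functional -/

section Haar

open Fam MonoidalLeftAction

/-! ### A faithful trace at the possibly non-simple unit object. -/

section Unit

variable {D I : Type*} [Category D] [Preadditive D] [Linear ℂ D] [MonoidalCategory D]
  [UnitaryCategory D] [Fintype I] (S : I → D) [hS : Fact (IsIrr S)]

/-- A finite family of morphisms from simple objects that decomposes the unit object. -/
theorem exists_unit_onb : ∃ e : ∀ a, Fin (Module.finrank ℂ (S a ⟶ 𝟙_ D)) → (S a ⟶ 𝟙_ D),
    ∑ a, ∑ s, dagger (e a s) ≫ e a s = 𝟙 (𝟙_ D) := by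
  have := hS.out.finiteDimensional
  choose e he using fun a => exists_onb (hS.out.simple a) (Y := 𝟙_ D)
  exact ⟨e, hS.out.sum_onb e fun a => (he a).2⟩

/-- A faithful positive functional on the endomorphisms of the unit object. -/
def unitTrace : (𝟙_ D ⟶ 𝟙_ D) →ₗ[ℂ] ℂ :=
  ∑ a, ∑ s, scalarLin (S a) ∘ₗ Linear.rightComp ℂ _ (dagger ((exists_unit_onb S).choose a s)) ∘ₗ
    Linear.leftComp ℂ _ ((exists_unit_onb S).choose a s)

/-- The value is a sum of squares of the components of f on the simple constituents of the unit.
These resolve the identity, so all of them vanish only for f = 0. -/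
theorem unitTrace_comp_dagger {A : D} (f : 𝟙_ D ⟶ A) :
    ∃ r : ℝ, 0 ≤ r ∧ (r = 0 → f = 0) ∧ unitTrace S (f ≫ dagger f) = r := by
  choose r h0 h1 h2 using fun a s => exists_comp_dagger_eq (hS.out.simple a)
    ((exists_unit_onb S).choose a s ≫ f)
  refine ⟨∑ a, ∑ s, r a s, Finset.sum_nonneg fun a _ => Finset.sum_nonneg fun s _ => h0 a s,
    fun h => ?_, ?_⟩
  · rw [Finset.sum_eq_zero_iff_of_nonneg fun a _ => Finset.sum_nonneg fun s _ => h0 a s] at h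
    rw [← Category.id_comp f, ← (exists_unit_onb S).choose_spec, Preadditive.sum_comp]
    refine Finset.sum_eq_zero fun a ha => ?_
    have h' := h a ha
    rw [Finset.sum_eq_zero_iff_of_nonneg fun s _ => h0 a s] at h'
    rw [Preadditive.sum_comp]
    refine Finset.sum_eq_zero fun s hs => ?_
    rw [Category.assoc, h1 a s (h' s hs), Limits.comp_zero]
  · push_cast
    simp only [unitTrace, LinearMap.sum_apply, ← h2]
    refine Finset.sum_congr rfl fun a _ => Finset.sum_congr rfl fun s _ => ?_
    simp [scalarLin, UnitaryCategory.dagger_comp]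

/-- The pairing of morphisms from and to the unit object. -/
def unitPairing (A : D) : (𝟙_ D ⟶ A) →ₗ[ℂ] (A ⟶ 𝟙_ D) →ₗ[ℂ] ℂ :=
  LinearMap.mk₂ ℂ (fun v u => unitTrace S (v ≫ u))
    (fun f f' g => by rw [Preadditive.add_comp, map_add])
    (fun c f g => by rw [Linear.smul_comp, map_smul])
    (fun f g g' => by rw [Preadditive.comp_add, map_add])
    (fun c f g => by rw [Linear.comp_smul, map_smul])

theorem unitPairing_apply (A : D) (v : 𝟙_ D ⟶ A) (u : A ⟶ 𝟙_ D) :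
    unitPairing S A v u = unitTrace S (v ≫ u) := rfl

theorem exists_unit_dualPair (A : D) :
    ∃ (e : Fin (Module.finrank ℂ (𝟙_ D ⟶ A)) → (𝟙_ D ⟶ A))
      (e' : Fin (Module.finrank ℂ (𝟙_ D ⟶ A)) → (A ⟶ 𝟙_ D)),
      IsDualPair (unitPairing S A) e e' := by
  have := hS.out.finiteDimensional
  have h0 : ∀ f : 𝟙_ D ⟶ A, unitTrace S (f ≫ dagger f) = 0 → f = 0 := by
    intro f hf
    obtain ⟨r, -, h, hr⟩ := unitTrace_comp_dagger S f
    exact h (by exact_mod_cast hr.symm.trans hf)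
  refine exists_isDualPair _ (fun v h => h0 v (h (dagger v))) (fun u h => ?_)
  have := h0 (dagger u) (by rw [UnitaryCategory.dagger_dagger]; exact h (dagger u))
  exact dagger_injective (this.trans dagger_zero.symm)

theorem ev_ne_zero {A A' : D} [MonoidalPreadditive D] [ExactPairing A A'] (hA : 𝟙 A ≠ 0) :
    dagger (ε_ A A') ≠ 0 := by
  intro h
  refine hA ?_
  have h0 : ε_ A A' = 0 := by rw [← UnitaryCategory.dagger_dagger (ε_ A A'), h, dagger_zero]
  have h1 := ExactPairing.evaluation_coevaluation A A'
  rw [h0, MonoidalPreadditive.whiskerLeft_zero, Limits.comp_zero, Limits.comp_zero] at h1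
  rw [← cancel_epi (λ_ A).hom, ← cancel_mono (ρ_ A).inv]
  simpa using h1.symm

/-- Adjunction: u is determined by its transpose B ⟶ A. For B and A simple, Schur's lemma then
controls Hom(A' ⊗ B, 1). -/
theorem exists_eq_whiskerLeft_comp_ev {A A' B : D} [ExactPairing A A'] (u : A' ⊗ B ⟶ 𝟙_ D) :
    ∃ f : B ⟶ A, u = A' ◁ f ≫ ε_ A A' := by
  refine ⟨tensorLeftHomEquiv B A A' (𝟙_ D) u ≫ (ρ_ A).hom, ?_⟩
  conv_lhs => rw [← (tensorLeftHomEquiv B A A' (𝟙_ D)).symm_apply_apply u]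
  generalize tensorLeftHomEquiv B A A' (𝟙_ D) u = g
  change A' ◁ g ≫ (α_ A' A (𝟙_ D)).inv ≫ ε_ A A' ▷ 𝟙_ D ≫ (λ_ (𝟙_ D)).hom = _
  rw [unitors_equal, rightUnitor_naturality]
  simp

theorem unit_dualPair_of_ne {a b : I} (h : a ≠ b) (A' : D) [ExactPairing (S a) A']
    [MonoidalPreadditive D] :
    IsDualPair (unitPairing S (A' ⊗ S b)) (Fin.elim0 : Fin 0 → _) (Fin.elim0 : Fin 0 → _) := by
  have h1 : ∀ u : A' ⊗ S b ⟶ 𝟙_ D, u = 0 := by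
    intro u
    obtain ⟨f, rfl⟩ := exists_eq_whiskerLeft_comp_ev (A := S a) u
    rw [hS.out.hom_eq_zero h.symm f, MonoidalPreadditive.whiskerLeft_zero, Limits.zero_comp]
  refine ⟨fun v => ?_, fun u => ?_⟩
  · have := h1 (dagger v)
    rw [Finset.univ_eq_empty, Finset.sum_empty]
    exact (dagger_injective (this.trans dagger_zero.symm)).symm
  · rw [Finset.univ_eq_empty, Finset.sum_empty, h1 u]

/-- Hom(A' ⊗ a, 1) is the line spanned by the evaluation; t is the trace of its loop, positive
because the evaluation is nonzero. -/
theorem exists_unit_dualPair_ev (a : I) (A' : D) [ExactPairing (S a) A']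
    [MonoidalPreadditive D] [MonoidalLinear ℂ D] : ∃ t : ℝ, 0 < t ∧
    IsDualPair (unitPairing S (A' ⊗ S a)) (fun _ : Fin 1 => ((t : ℂ)⁻¹) • dagger (ε_ (S a) A'))
      (fun _ : Fin 1 => ε_ (S a) A') := by
  obtain ⟨t, h0, h1, ht⟩ := unitTrace_comp_dagger S (dagger (ε_ (S a) A'))
  have ht0 : t ≠ 0 := fun h => ev_ne_zero (id_ne_zero (hS.out.simple a)) (h1 h)
  rw [UnitaryCategory.dagger_dagger] at ht
  have hu : ∀ u : A' ⊗ S a ⟶ 𝟙_ D, ∃ c : ℂ, u = c • ε_ (S a) A' := by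
    intro u
    obtain ⟨f, rfl⟩ := exists_eq_whiskerLeft_comp_ev (A := S a) u
    refine ⟨scalar f, ?_⟩
    conv_lhs => rw [eq_scalar_smul_id (hS.out.simple a) f]
    rw [MonoidalLinear.whiskerLeft_smul, whiskerLeft_id, Linear.smul_comp, Category.id_comp]
  refine ⟨t, lt_of_le_of_ne h0 ht0.symm, fun v => ?_, fun u => ?_⟩
  · obtain ⟨c, hc⟩ := hu (dagger v)
    obtain rfl : v = conj c • dagger (ε_ (S a) A') := by
      rw [← UnitaryCategory.dagger_dagger v, hc, UnitaryCategory.dagger_smul]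
    simp [unitPairing_apply, ht, smul_smul, ht0]
  · obtain ⟨c, rfl⟩ := hu u
    simp [unitPairing_apply, ht, ht0]

end Unit

variable {D ℳ I J : Type*} [Category D] [Preadditive D] [Linear ℂ D] [MonoidalCategory D]
  [MonoidalPreadditive D] [MonoidalLinear ℂ D] [UnitaryCategory D] [Category ℳ] [Preadditive ℳ]
  [Linear ℂ ℳ]
  [UnitaryCategory ℳ] [MonoidalLeftAction D ℳ] [UnitaryLeftModule D ℳ]
  [Fintype I] [DecidableEq I] [Fintype J] [DecidableEq J]
  (S : I → D) (M : J → ℳ) [hS : Fact (IsIrr S)] [hM : Fact (IsIrr M)]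

theorem actionHomLeft_add {A B : D} (X : Fam J ℳ) (f g : A ⟶ B) :
    (f + g) ⊵ₗ X = f ⊵ₗ X + g ⊵ₗ X := (actL A B X).map_add f g

/-- Closing a leg of a splitting vertex. -/
def closeVert (A : D) : Vert M A →ₗ[ℂ] (A ⟶ 𝟙_ D) →ₗ[ℂ] ℂ :=
  LinearMap.mk₂ ℂ (fun ν u => wallTrace M (ν ≫ u ⊵ₗ fam M ≫ (λₗ (fam M)).hom))
    (fun f f' g => by rw [Preadditive.add_comp, map_add])
    (fun c f g => by rw [Linear.smul_comp, map_smul])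
    (fun f g g' => by rw [actionHomLeft_add, Preadditive.add_comp, Preadditive.comp_add, map_add])
    (fun c f g => by rw [actionHomLeft_smul, Linear.smul_comp, Linear.comp_smul, map_smul])

/-- Closing a leg of a fusion vertex. -/
def closeCovert (A : D) : Covert M A →ₗ[ℂ] (𝟙_ D ⟶ A) →ₗ[ℂ] ℂ :=
  LinearMap.mk₂ ℂ (fun ζ v => wallTrace M ((λₗ (fam M)).inv ≫ v ⊵ₗ fam M ≫ ζ))
    (fun f f' g => by rw [Preadditive.comp_add, Preadditive.comp_add, map_add])
    (fun c f g => by rw [Linear.comp_smul, Linear.comp_smul, map_smul])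
    (fun f g g' => by rw [actionHomLeft_add, Preadditive.add_comp, Preadditive.comp_add, map_add])
    (fun c f g => by rw [actionHomLeft_smul, Linear.smul_comp, Linear.comp_smul, map_smul])

/-- The Haar functional on the diagrams with arc `A`. -/
def arcHaar (A : D) : Vert M A →ₗ[ℂ] Covert M A →ₗ[ℂ] ℂ :=
  ∑ k, (LinearMap.mul ℂ ℂ).compl₁₂
    ((closeVert M A).flip ((exists_unit_dualPair S A).choose_spec.choose k))
    ((closeCovert M A).flip ((exists_unit_dualPair S A).choose k))

/-- The Haar functional of the tube algebra. -/
def tubeHaar : LeftTube S M →ₗ[ℂ] ℂ := tubeLift S M fun a => arcHaar S M (S a)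

variable {S M}

theorem arcHaar_apply {A : D} {ι : Type*} [Fintype ι] {e : ι → (𝟙_ D ⟶ A)}
    {e' : ι → (A ⟶ 𝟙_ D)} (h : IsDualPair (unitPairing S A) e e') (ν : Vert M A)
    (ζ : Covert M A) : arcHaar S M A ν ζ = ∑ k, closeVert M A ν (e' k) * closeCovert M A ζ (e k) := by
  have h0 := (exists_unit_dualPair S A).choose_spec.choose_spec
  have := h0.sum_eq h ((LinearMap.mul ℂ ℂ).compl₁₂ (closeVert M A ν) (closeCovert M A ζ)).flip
  simp only [arcHaar, LinearMap.sum_apply]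
  exact this

/-- Composition with f on morphisms from the unit and on morphisms to the unit are transposes of
each other. -/
theorem arcHaar_natural {A B : D} (f : A ⟶ B) (ν : Vert M A) (ζ : Covert M B) :
    arcHaar S M A ν (f ⊵ₗ fam M ≫ ζ) = arcHaar S M B (ν ≫ f ⊵ₗ fam M) ζ := by
  have hA := (exists_unit_dualPair S A).choose_spec.choose_spec
  have hB := (exists_unit_dualPair S B).choose_spec.choose_spec
  rw [arcHaar_apply hA, arcHaar_apply hB]
  have := hA.transpose hB (Linear.rightComp ℂ _ f) (Linear.leftComp ℂ _ f)
    (fun v u => by simp [unitPairing_apply])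
    ((LinearMap.mul ℂ ℂ).compl₁₂ (closeVert M A ν) (closeCovert M B ζ)).flip
  simpa [closeVert, closeCovert] using this

theorem tubeHaar_arc {A : D} {ι : Type*} [Fintype ι] {e : ι → (𝟙_ D ⟶ A)}
    {e' : ι → (A ⟶ 𝟙_ D)} (h : IsDualPair (unitPairing S A) e e') (ν : Vert M A)
    (ζ : Covert M A) : tubeHaar S M (arc S M A ν ζ) =
      ∑ k, closeVert M A ν (e' k) * closeCovert M A ζ (e k) := by
  rw [← arcHaar_apply h]
  exact tubeLift_arc (fun A => arcHaar S M A) (fun f ν ζ => arcHaar_natural f ν ζ) A ν ζ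

variable [RigidCategory D] [UnitaryMonoidal D]

/-- The arc of the product is the dual of a tensored with b, which has no morphism to the unit when
a ≠ b. -/
theorem tubeHaar_of_ne {a b : I} (h : a ≠ b) (ν : Vert M (S a)) (ζ : Covert M (S a))
    (ν' : Vert M (S b)) (ζ' : Covert M (S b)) :
    tubeHaar S M (tubeMul S M (tubeStar S M (arc S M (S a) ν ζ)) (arc S M (S b) ν' ζ')) = 0 := by
  rw [tubeStar_arc (S a)ᘁ, tubeMul_arc, tubeHaar_arc (unit_dualPair_of_ne S h (S a)ᘁ)]
  simp

/-- Closing the dual of a tensored with a by the evaluation and its adjoint separates the splitting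
vertices from the fusion vertices, and each factor becomes a positive form. -/
theorem exists_tubeHaar_self (a : I) : ∃ t : ℝ, 0 < t ∧ ∀ (ν : Vert M (S a)) (ζ : Covert M (S a))
    (ν' : Vert M (S a)) (ζ' : Covert M (S a)),
    tubeHaar S M (tubeMul S M (tubeStar S M (arc S M (S a) ν ζ)) (arc S M (S a) ν' ζ')) =
      wallTrace M (ν' ≫ dag ν) * ((t : ℂ)⁻¹ * wallTrace M (dag (bend (S a)ᘁ (dag ζ')) ≫
        bend (S a)ᘁ (dag ζ))) := by
  obtain ⟨t, ht, h⟩ := exists_unit_dualPair_ev S a (S a)ᘁ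
  refine ⟨t, ht, fun ν ζ ν' ζ' => ?_⟩
  rw [tubeStar_arc (S a)ᘁ, tubeMul_arc, tubeHaar_arc h, Fin.sum_univ_one]
  congr 1
  · have := wallTrace_vertMul_ev (A' := (S a)ᘁ) (dag ν) ν' (𝟙 _)
    rw [Category.comp_id, actionHomRight_id, Category.id_comp] at this
    exact this
  · rw [map_smul, smul_eq_mul]
    congr 1
    let _ := conjPairing (S a) (S a)ᘁ
    have hη : η_ (S a)ᘁ (S a) = dagger (ε_ (S a) (S a)ᘁ) := rfl
    rw [dag_bend hη, dag_dag]
    change wallTrace M (_ ≫ _ ⊵ₗ fam M ≫ covertMul _ _) = _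
    simp [unbend, coevM, covertMul_apply, hη]

/-- The map ω and the weight t serve the second Haar factor, where the inner product is taken after
bending; for the first, ω is the identity and t = 1. -/
theorem exists_wall_onb {V : Type*} [AddCommGroup V] [Module ℂ V] [FiniteDimensional ℂ V]
    {Y : Fam J ℳ} (ω : V →ₗ[ℂ] (fam M ⟶ Y)) (hω : Function.Injective ω) {t : ℝ} (ht : 0 < t) :
    ∃ b : Module.Basis (Fin (Module.finrank ℂ V)) ℂ V,
      ∀ i j, (t : ℂ)⁻¹ * wallTrace M (ω (b j) ≫ dag (ω (b i))) = if i = j then 1 else 0 := by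
  refine exists_orthonormal_basis (LinearMap.mk₂'ₛₗ (starRingEnd ℂ) (RingHom.id ℂ)
    (fun f g => (t : ℂ)⁻¹ * wallTrace M (ω g ≫ dag (ω f)))
    (fun f f' g => by simp [mul_add]) (fun c f g => by simp [mul_left_comm])
    (fun f g g' => by simp [mul_add]) (fun c f g => by simp [mul_left_comm]))
    (fun f g => ?_) (fun f => ?_) (fun f h => ?_)
  · simp only [LinearMap.mk₂'ₛₗ_apply, map_mul, ← wallTrace_dag, dag_comp, dag_dag]
    simp
  · rw [LinearMap.mk₂'ₛₗ_apply, ← Complex.ofReal_inv, Complex.re_ofReal_mul]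
    exact mul_nonneg (inv_nonneg.2 ht.le) (wallTrace_comp_dag_re_nonneg _)
  · rw [LinearMap.mk₂'ₛₗ_apply] at h
    refine (injective_iff_map_eq_zero ω).1 hω f (eq_zero_of_wallTrace_comp_dag _ ?_)
    simpa [ht.ne'] using h

variable (S M) in
theorem exists_tube_onb : ∃ (n m : I → ℕ) (b : (Σ a, Fin (n a) × Fin (m a)) → LeftTube S M),
    (∀ p q, tubeHaar S M (tubeMul S M (tubeStar S M (b p)) (b q)) = if p = q then 1 else 0) ∧
      ∀ x, ∃ c : (Σ a, Fin (n a) × Fin (m a)) → ℂ, x = ∑ p, c p • b p := by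
  have := hM.out.finiteDimensional
  -- Two antilinear adjoints make ω linear. It is injective because bending and † are invertible.
  let ω : ∀ a, Covert M (S a) →ₗ[ℂ] (fam M ⟶ (S a)ᘁ ⊙ₗ fam M) := fun a =>
    { toFun := fun ζ => dag (bend (S a)ᘁ (dag ζ))
      map_add' := fun f g => by rw [← bendLin_apply, map_add, map_add, map_add]; rfl
      map_smul' := fun c f => by
        rw [← bendLin_apply, map_smulₛₗ, map_smul, map_smulₛₗ, Complex.conj_conj]; rfl }
  have hω : ∀ a, Function.Injective (ω a) := fun a => by
    intro f g h
    have h1 : dag (ω a f) = dag (ω a g) := by rw [h]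
    change dag (dag _) = dag (dag _) at h1
    rw [dag_dag, dag_dag] at h1
    have h2 := congrArg (unbend (S a)) h1
    rw [unbend_bend, unbend_bend] at h2
    rw [← dag_dag f, h2, dag_dag]
  choose t ht h using exists_tubeHaar_self (S := S) (M := M)
  choose e he using fun a => exists_wall_onb (M := M)
    (LinearMap.id : Vert M (S a) →ₗ[ℂ] Vert M (S a)) Function.injective_id one_pos
  choose f hf using fun a => exists_wall_onb (M := M) (ω a) (hω a) (ht a)
  refine ⟨fun a => Module.finrank ℂ (Vert M (S a)), fun a => Module.finrank ℂ (Covert M (S a)),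
    fun p => arc S M (S p.1) (e p.1 p.2.1) (f p.1 p.2.2), ?_, ?_⟩
  · rintro ⟨a, k, l⟩ ⟨b, k', l'⟩
    by_cases hab : a = b
    · subst hab
      have h1 := he a k k'
      have h2 := hf a l l'
      simp only [Complex.ofReal_one, inv_one, one_mul, LinearMap.id_apply] at h1
      change _ * wallTrace M (dag (bend (S a)ᘁ _) ≫ dag (dag (bend (S a)ᘁ _))) = _ at h2
      rw [dag_dag] at h2
      rw [h, h1, h2]
      by_cases hk : k = k' <;> by_cases hl : l = l' <;> simp [hk, hl]
    · rw [tubeHaar_of_ne hab, if_neg]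
      exact fun h => hab (congrArg Sigma.fst h)
  · intro x
    suffices hx : x ∈ Submodule.span ℂ (Set.range fun p :
        (Σ a, Fin (Module.finrank ℂ (Vert M (S a))) ×
          Fin (Module.finrank ℂ (Covert M (S a)))) =>
        arc S M (S p.1) (e p.1 p.2.1) (f p.1 p.2.2)) by
      obtain ⟨c, hc⟩ := (Submodule.mem_span_range_iff_exists_fun ℂ).1 hx
      exact ⟨c, hc.symm⟩
    induction x using arc_induction with
    | h0 => exact Submodule.zero_mem _
    | hadd x y hx hy => exact Submodule.add_mem _ hx hy
    | harc a ν ζ =>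
      rw [← (e a).sum_repr ν, ← (f a).sum_repr ζ]
      simp only [map_sum, LinearMap.sum_apply, map_smul, LinearMap.smul_apply]
      refine Submodule.sum_mem _ fun k _ => Submodule.smul_mem _ _ <|
        Submodule.sum_mem _ fun l _ => Submodule.smul_mem _ _ <| Submodule.subset_span ?_
      exact ⟨⟨a, _, _⟩, rfl⟩

variable (S M) in
theorem exists_tube_faithful_rep :
    ∃ (V : Type) (_ : NormedAddCommGroup V) (_ : InnerProductSpace ℂ V)
      (_ : CompleteSpace V) (π : LeftTube S M →ₗ[ℂ] (V →L[ℂ] V)),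
      Function.Injective π ∧ π (tubeOne S M) = 1 ∧
        (∀ x y, π (tubeMul S M x y) = π x * π y) ∧
        ∀ x, π (tubeStar S M x) = ContinuousLinearMap.adjoint (π x) := by
  obtain ⟨n, m, b, ho, hspan⟩ := exists_tube_onb S M
  exact exists_faithful_rep_of_onb (tubeWeakBialgebra S M) (tubeStar S M)
    tubeStar_mul (tubeHaar S M) b ho hspan

variable (S M) in
/-- The tube algebra as a `C^*` weak Hopf algebra. -/
def tubeCStar : CStarWeakHopfAlgebra (LeftTube S M) where
  toWeakHopfAlgebra := tubeWeakHopfAlgebra S M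
  star := tubeStar S M
  star_star := tubeStar_star
  star_mul := tubeStar_mul
  comul_star := tubeComul_star
  exists_faithful_rep := exists_tube_faithful_rep S M

end Haar

end BoundaryTube

end

noncomputable section

namespace BoundaryTube

open UnitaryCategory (dagger)

/-! ### Actions of the endomorphisms of the unit object -/

section UnitAct

variable {D : Type*} [Category D] [MonoidalCategory D]

/-- An endomorphism of the unit, placed to the left of an object. -/
def unitLeft (θ : 𝟙_ D ⟶ 𝟙_ D) (A : D) : A ⟶ A := (λ_ A).inv ≫ θ ▷ A ≫ (λ_ A).hom

/-- An endomorphism of the unit, placed to the right of an object. -/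
def unitRight (θ : 𝟙_ D ⟶ 𝟙_ D) (A : D) : A ⟶ A := (ρ_ A).inv ≫ A ◁ θ ≫ (ρ_ A).hom

variable (θ : 𝟙_ D ⟶ 𝟙_ D)

theorem unitLeft_natural {A B : D} (f : A ⟶ B) : unitLeft θ A ≫ f = f ≫ unitLeft θ B := by
  simp only [unitLeft, Category.assoc, ← leftUnitor_naturality, ← whisker_exchange_assoc,
    leftUnitor_inv_naturality_assoc]

theorem unitRight_natural {A B : D} (f : A ⟶ B) : unitRight θ A ≫ f = f ≫ unitRight θ B := by
  simp only [unitRight, Category.assoc, ← rightUnitor_naturality, whisker_exchange_assoc,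
    rightUnitor_inv_naturality_assoc]

theorem unitLeft_tensor (A B : D) : unitLeft θ (A ⊗ B) = unitLeft θ A ▷ B := by
  simp only [unitLeft]; monoidal

theorem unitRight_tensor (A B : D) : unitRight θ (A ⊗ B) = A ◁ unitRight θ B := by
  simp only [unitRight]; monoidal

theorem unitRight_whiskerRight (A B : D) : unitRight θ A ▷ B = A ◁ unitLeft θ B := by
  simp only [unitRight, unitLeft]; monoidal

end UnitAct

/-! ### Mates -/

section Mate

variable {D : Type*} [Category D] [MonoidalCategory D] {A A' B B' E E' : D}
  [ExactPairing A A'] [ExactPairing B B'] [ExactPairing E E']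

variable (A' B') in
/-- The mate of a morphism with respect to chosen duals. -/
def mate (f : A ⟶ B) : B' ⟶ A' :=
  let _ : HasRightDual A := ⟨A'⟩
  let _ : HasRightDual B := ⟨B'⟩
  fᘁ

theorem mate_ev (f : A ⟶ B) : mate A' B' f ▷ A ≫ ε_ A A' = B' ◁ f ≫ ε_ B B' :=
  let _ : HasRightDual A := ⟨A'⟩
  let _ : HasRightDual B := ⟨B'⟩
  rightAdjointMate_comp_evaluation f

theorem coev_mate (f : A ⟶ B) : η_ B B' ≫ B ◁ mate A' B' f = η_ A A' ≫ f ▷ A' :=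
  let _ : HasRightDual A := ⟨A'⟩
  let _ : HasRightDual B := ⟨B'⟩
  coevaluation_comp_rightAdjointMate f

theorem mate_comp (f : A ⟶ B) (g : B ⟶ E) :
    mate A' E' (f ≫ g) = mate B' E' g ≫ mate A' B' f :=
  let _ : HasRightDual A := ⟨A'⟩
  let _ : HasRightDual B := ⟨B'⟩
  let _ : HasRightDual E := ⟨E'⟩
  comp_rightAdjointMate

theorem mate_id : mate A' A' (𝟙 A) = 𝟙 A' :=
  let _ : HasRightDual A := ⟨A'⟩
  rightAdjointMate_id

/-- By adjunction a morphism into A' is determined by its pairing with the evaluation. -/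
theorem eq_of_whiskerRight_comp_ev {X : D} {f g : X ⟶ A'} (h : f ▷ A ≫ ε_ A A' = g ▷ A ≫ ε_ A A') :
    f = g := by
  have key : ∀ f : X ⟶ A', (tensorRightHomEquiv X A A' (𝟙_ D)).symm (f ≫ (λ_ A').inv) =
      f ▷ A ≫ ε_ A A' := by
    intro f
    change (f ≫ (λ_ A').inv) ▷ A ≫ (α_ _ _ _).hom ≫ 𝟙_ D ◁ ε_ A A' ≫ (ρ_ _).hom = _
    rw [← unitors_equal, leftUnitor_naturality]
    simp
  have h1 := (tensorRightHomEquiv X A A' (𝟙_ D)).symm.injective ((key f).trans (h.trans (key g).symm))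
  rwa [cancel_mono] at h1

theorem mate_eq {f : A ⟶ B} {g : B' ⟶ A'} (h : g ▷ A ≫ ε_ A A' = B' ◁ f ≫ ε_ B B') :
    mate A' B' f = g := eq_of_whiskerRight_comp_ev ((mate_ev f).trans h.symm)

theorem exists_mate_eq [Preadditive D] [Linear ℂ D] [UnitaryCategory D] (g : B' ⟶ A') :
    ∃ f : A ⟶ B, mate A' B' f = g := by
  obtain ⟨f, hf⟩ := exists_eq_whiskerLeft_comp_ev (A := B) (g ▷ A ≫ ε_ A A')
  exact ⟨f, mate_eq hf⟩

theorem mate_eq_zero_iff [Preadditive D] [Linear ℂ D] [MonoidalPreadditive D] {f : A ⟶ B} :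
    mate A' B' f = 0 ↔ f = 0 := by
  constructor
  · intro h
    have h1 := coev_mate (A' := A') (B' := B') f
    rw [h, MonoidalPreadditive.whiskerLeft_zero, Limits.comp_zero] at h1
    have h2 := ExactPairing.evaluation_coevaluation A A'
    -- Zigzag: f is recovered from η ≫ f ▷ A', which equals a composite with the mate and hence
    -- vanishes.
    have h3 : (λ_ A).hom ≫ f ≫ (ρ_ B).inv = 0 := by
      rw [rightUnitor_inv_naturality, ← Category.assoc, ← h2, Category.assoc, Category.assoc,
        whisker_exchange, ← associator_naturality_left_assoc, ← comp_whiskerRight_assoc, ← h1,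
        MonoidalPreadditive.zero_whiskerRight, Limits.zero_comp]
    rw [← cancel_mono (ρ_ B).inv, ← cancel_epi (λ_ A).hom, h3]
    simp
  · rintro rfl
    exact mate_eq (by simp)

theorem mate_add [Preadditive D] [Linear ℂ D] [MonoidalPreadditive D] (f g : A ⟶ B) :
    mate A' B' (f + g) = mate A' B' f + mate A' B' g :=
  mate_eq (by simp [MonoidalPreadditive.add_whiskerRight, MonoidalPreadditive.whiskerLeft_add,
    mate_ev])

theorem mate_smul [Preadditive D] [Linear ℂ D] [MonoidalPreadditive D] [MonoidalLinear ℂ D]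
    (c : ℂ) (f : A ⟶ B) : mate A' B' (c • f) = c • mate A' B' f :=
  mate_eq (by simp [mate_ev])

end Mate

/-! ### Balanced duals -/

section Balanced

variable {D : Type*} [Category D] [Preadditive D] [Linear ℂ D] [MonoidalCategory D]
  [MonoidalPreadditive D] [MonoidalLinear ℂ D] [UnitaryCategory D] [UnitaryMonoidal D]

/-- Both loops of the duality maps act on `A` by `d`. -/
structure IsBalanced (A A' : D) [ExactPairing A A'] (d : ℝ) : Prop where
  pos : 0 < d
  ev : unitRight (dagger (ε_ A A') ≫ ε_ A A') A = (d : ℂ) • 𝟙 A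
  coev : unitLeft (η_ A A' ≫ dagger (η_ A A')) A = (d : ℂ) • 𝟙 A

theorem unitLeft_smul (c : ℂ) (θ : 𝟙_ D ⟶ 𝟙_ D) (A : D) :
    unitLeft (c • θ) A = c • unitLeft θ A := by simp [unitLeft]

theorem unitRight_smul (c : ℂ) (θ : 𝟙_ D ⟶ 𝟙_ D) (A : D) :
    unitRight (c • θ) A = c • unitRight θ A := by simp [unitRight]

/-- The partial trace over the left factor. -/
def leftPartial (A A' : D) [ExactPairing A A'] {B : D} (φ : A ⊗ B ⟶ A ⊗ B) : B ⟶ B :=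
  (λ_ B).inv ≫ dagger (ε_ A A') ▷ B ≫ (α_ A' A B).hom ≫ A' ◁ φ ≫ (α_ A' A B).inv ≫
    ε_ A A' ▷ B ≫ (λ_ B).hom

/-- The partial trace over the right factor. -/
def rightPartial {A : D} (B B' : D) [ExactPairing B B'] (φ : A ⊗ B ⟶ A ⊗ B) : A ⟶ A :=
  (ρ_ A).inv ≫ A ◁ η_ B B' ≫ (α_ A B B').inv ≫ φ ▷ B' ≫ (α_ A B B').hom ≫
    A ◁ dagger (η_ B B') ≫ (ρ_ A).hom

variable {A A' B B' E E' : D} [ExactPairing A A'] [ExactPairing B B'] [ExactPairing E E']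

theorem ev_tensor : ε_ (A ⊗ B) (B' ⊗ A') = (α_ B' A' (A ⊗ B)).hom ≫ B' ◁ (α_ A' A B).inv ≫
    B' ◁ (ε_ A A' ▷ B) ≫ B' ◁ (λ_ B).hom ≫ ε_ B B' := by
  rw [ExactPairing.tensor_evaluation]
  monoidal

theorem coev_tensor : η_ (A ⊗ B) (B' ⊗ A') = η_ A A' ≫ (ρ_ A).inv ▷ A' ≫ (A ◁ η_ B B') ▷ A' ≫
    (α_ A B B').inv ▷ A' ≫ (α_ (A ⊗ B) B' A').hom := by
  rw [ExactPairing.tensor_coevaluation]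
  monoidal

/-- The loop of A ⊗ B is nested: the inner strand A closes first and leaves the partial trace inside
the loop of B. -/
theorem ev_tensor_trace (φ : A ⊗ B ⟶ A ⊗ B) :
    dagger (ε_ (A ⊗ B) (B' ⊗ A')) ≫ (B' ⊗ A') ◁ φ ≫ ε_ (A ⊗ B) (B' ⊗ A') =
      dagger (ε_ B B') ≫ B' ◁ leftPartial A A' φ ≫ ε_ B B' := by
  have h : (B' ⊗ A') ◁ φ = (α_ B' A' (A ⊗ B)).hom ≫ B' ◁ (A' ◁ φ) ≫ (α_ B' A' (A ⊗ B)).inv := by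
    simp
  rw [ev_tensor, h]
  simp only [UnitaryCategory.dagger_comp, dagger_whiskerLeft, dagger_whiskerRight,
    UnitaryMonoidal.dagger_associator, dagger_associator_inv, UnitaryMonoidal.dagger_leftUnitor,
    leftPartial, whiskerLeft_comp, Category.assoc, Iso.inv_hom_id_assoc]

theorem coev_tensor_trace (φ : A ⊗ B ⟶ A ⊗ B) :
    η_ (A ⊗ B) (B' ⊗ A') ≫ φ ▷ (B' ⊗ A') ≫ dagger (η_ (A ⊗ B) (B' ⊗ A')) =
      η_ A A' ≫ rightPartial B B' φ ▷ A' ≫ dagger (η_ A A') := by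
  have h : φ ▷ (B' ⊗ A') = (α_ (A ⊗ B) B' A').inv ≫ (φ ▷ B') ▷ A' ≫ (α_ (A ⊗ B) B' A').hom := by
    simp
  rw [coev_tensor, h]
  simp only [UnitaryCategory.dagger_comp, dagger_whiskerLeft, dagger_whiskerRight,
    UnitaryMonoidal.dagger_associator, dagger_associator_inv, dagger_rightUnitor_inv,
    rightPartial, comp_whiskerRight, Category.assoc, Iso.hom_inv_id_assoc]

/-- Closing A on the left and B on the right gives the same scalar diagram in either order, by the
exchange law. -/
theorem middle_trace (φ : A ⊗ B ⟶ A ⊗ B) :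
    η_ B B' ≫ leftPartial A A' φ ▷ B' ≫ dagger (η_ B B') =
      dagger (ε_ A A') ≫ A' ◁ rightPartial B B' φ ≫ ε_ A A' := by
  calc _ = 𝟙 _ ⊗≫ (𝟙_ D ◁ η_ B B' ≫ dagger (ε_ A A') ▷ (B ⊗ B')) ⊗≫ (A' ◁ φ) ▷ B' ⊗≫
        (ε_ A A' ▷ (B ⊗ B') ≫ 𝟙_ D ◁ dagger (η_ B B')) ⊗≫ 𝟙 _ := by
        simp only [leftPartial]; monoidal
    _ = 𝟙 _ ⊗≫ (dagger (ε_ A A') ▷ 𝟙_ D ≫ (A' ⊗ A) ◁ η_ B B') ⊗≫ (A' ◁ φ) ▷ B' ⊗≫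
        ((A' ⊗ A) ◁ dagger (η_ B B') ≫ ε_ A A' ▷ 𝟙_ D) ⊗≫ 𝟙 _ := by
        rw [← whisker_exchange, ← whisker_exchange]
    _ = _ := by simp only [rightPartial]; monoidal

end Balanced

end BoundaryTube

end

noncomputable section

namespace BoundaryTube

open UnitaryCategory (dagger)

/-! ### Balanced duality maps and the unitary structure. -/

section UnitaryDuality

variable {D : Type*} [Category D] [Preadditive D] [Linear ℂ D] [MonoidalCategory D]
  [MonoidalPreadditive D] [MonoidalLinear ℂ D] [UnitaryCategory D] [UnitaryMonoidal D]
  {A A' B B' E E' : D} [ExactPairing A A'] [ExactPairing B B'] [ExactPairing E E']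
  {dA dB dE : ℝ}

theorem unitLeft_one (θ : 𝟙_ D ⟶ 𝟙_ D) : unitLeft θ (𝟙_ D) = unitRight θ (𝟙_ D) := by
  have h1 : unitLeft θ (𝟙_ D) = θ := by
    rw [unitLeft, unitors_equal, rightUnitor_naturality, ← unitors_equal, Iso.inv_hom_id_assoc]
  have h2 : unitRight θ (𝟙_ D) = θ := by
    rw [unitRight, ← unitors_equal, leftUnitor_naturality, unitors_equal, Iso.inv_hom_id_assoc]
  rw [h1, h2]

/-- Taking mates is a linear bijection from End A to End A'. -/
theorem finrank_dual_end (hA : Module.finrank ℂ (A ⟶ A) = 1) :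
    Module.finrank ℂ (A' ⟶ A') = 1 := by
  let m : (A ⟶ A) →ₗ[ℂ] (A' ⟶ A') :=
    { toFun := mate A' A', map_add' := mate_add, map_smul' := mate_smul }
  have hm : Function.Bijective m := by
    refine ⟨(injective_iff_map_eq_zero m).2 fun f hf => mate_eq_zero_iff.1 hf, fun g => ?_⟩
    exact exists_mate_eq g
  rw [← (LinearEquiv.ofBijective m hm).finrank_eq, hA]

/-- The mates slide around the loop one at a time, turning a loop on A into a loop on B. -/
theorem mate_loop (e f : A ⟶ B) :
    dagger (ε_ A A') ≫ (dagger (mate A' B' e) ≫ mate A' B' f) ▷ A ≫ ε_ A A' =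
      dagger (ε_ B B') ≫ B' ◁ (dagger e ≫ f) ≫ ε_ B B' := by
  have h := congrArg dagger (mate_ev (A' := A') (B' := B') e)
  rw [UnitaryCategory.dagger_comp, UnitaryCategory.dagger_comp, dagger_whiskerRight,
    dagger_whiskerLeft] at h
  rw [comp_whiskerRight, Category.assoc, mate_ev, reassoc_of% h, whiskerLeft_comp, Category.assoc]

theorem mate_loop' (e f : A ⟶ B) :
    η_ B B' ≫ B ◁ (mate A' B' f ≫ dagger (mate A' B' e)) ≫ dagger (η_ B B') =
      η_ A A' ≫ (f ≫ dagger e) ▷ A' ≫ dagger (η_ A A') := by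
  have h := congrArg dagger (coev_mate (A' := A') (B' := B') e)
  rw [UnitaryCategory.dagger_comp, UnitaryCategory.dagger_comp, dagger_whiskerRight,
    dagger_whiskerLeft] at h
  rw [whiskerLeft_comp, Category.assoc, h, ← Category.assoc, coev_mate, comp_whiskerRight,
    Category.assoc, Category.assoc]

/-- The two loops are exchanged. Each is transported from A' to A through the evaluation, where the
balance of A applies. -/
theorem IsBalanced.conj (h : IsBalanced A A' dA) :
    @IsBalanced D _ _ _ _ _ A' A (conjPairing A A') dA := by
  let _ := conjPairing A A'
  refine ⟨h.pos, ?_, ?_⟩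
  · apply eq_of_whiskerRight_comp_ev (A := A)
    change unitRight (dagger (dagger (η_ A A')) ≫ dagger (η_ A A')) A' ▷ A ≫ _ = _
    rw [UnitaryCategory.dagger_dagger, unitRight_whiskerRight, h.coev]
    simp only [MonoidalLinear.smul_whiskerRight, MonoidalLinear.whiskerLeft_smul, id_whiskerRight,
      whiskerLeft_id]
  · apply eq_of_whiskerRight_comp_ev (A := A)
    change unitLeft (dagger (ε_ A A') ≫ dagger (dagger (ε_ A A'))) A' ▷ A ≫ _ = _
    rw [UnitaryCategory.dagger_dagger, ← unitLeft_tensor, unitLeft_natural, unitLeft_one,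
      ← unitRight_natural, unitRight_tensor, h.ev]
    simp only [MonoidalLinear.smul_whiskerRight, MonoidalLinear.whiskerLeft_smul, id_whiskerRight,
      whiskerLeft_id]

section Fusion

variable (hA : IsBalanced A A' dA) (hB : IsBalanced B B' dB) (hE : IsBalanced E E' dE)
  (sA : Module.finrank ℂ (A ⟶ A) = 1) (sB : Module.finrank ℂ (B ⟶ B) = 1)
  (sE : Module.finrank ℂ (E ⟶ E) = 1)
include hA hB hE sA sB sE

/-- The nested loop of A ⊗ B expresses the Gram matrix of the mates by a partial trace. The
auxiliary nonzero k records that E occurs in A ⊗ B. -/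
theorem mate_gram_left (e f k : E ⟶ A ⊗ B) (hk : k ≠ 0) :
    (dE : ℂ) * scalar (dagger (mate E' (B' ⊗ A') e) ≫ mate E' (B' ⊗ A') f) =
      dB * scalar (leftPartial A A' (dagger e ≫ f)) := by
  have h := mate_loop (A' := E') (B' := B' ⊗ A') e f
  have sE' : Module.finrank ℂ (E' ⟶ E') = 1 := finrank_dual_end (A := E) sE
  rw [ev_tensor_trace, eq_scalar_smul_id sB (leftPartial _ _ _), eq_scalar_smul_id sE' (_ ≫ _)] at h
  simp only [MonoidalLinear.smul_whiskerRight, MonoidalLinear.whiskerLeft_smul, id_whiskerRight,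
    whiskerLeft_id, Linear.smul_comp, Linear.comp_smul, Category.id_comp] at h
  -- `h` is an identity in End(1), and 1 need not be simple; so both loops are made to act on the
  -- same nonzero morphism k, where balance turns them into d_E and d_B.
  have h2 := congrArg (fun θ => unitRight θ E ≫ k) h
  simp only [unitRight_smul, hE.ev, unitRight_natural, Linear.smul_comp, unitRight_tensor, hB.ev,
    MonoidalLinear.whiskerLeft_smul, whiskerLeft_id, Linear.comp_smul, Category.comp_id,
    Category.id_comp, smul_smul] at h2
  rw [mul_comm, smul_left_injective ℂ hk h2, mul_comm]

theorem mate_gram_right (e f k : E ⟶ A ⊗ B) (hk : k ≠ 0) :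
    (dE : ℂ) * scalar (mate (B' ⊗ A') E' (dagger e) ≫ dagger (mate (B' ⊗ A') E' (dagger f))) =
      dA * scalar (rightPartial B B' (dagger e ≫ f)) := by
  have h := mate_loop' (A' := B' ⊗ A') (B' := E') (dagger f) (dagger e)
  have sE' : Module.finrank ℂ (E' ⟶ E') = 1 := finrank_dual_end (A := E) sE
  rw [coev_tensor_trace, UnitaryCategory.dagger_dagger, eq_scalar_smul_id sA (rightPartial _ _ _),
    eq_scalar_smul_id sE' (_ ≫ _)] at h
  simp only [MonoidalLinear.smul_whiskerRight, MonoidalLinear.whiskerLeft_smul, id_whiskerRight,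
    whiskerLeft_id, Linear.smul_comp, Linear.comp_smul, Category.id_comp] at h
  have h2 := congrArg (fun θ => unitLeft θ E ≫ k) h
  simp only [unitLeft_smul, hE.coev, unitLeft_natural, Linear.smul_comp, unitLeft_tensor, hA.coev,
    MonoidalLinear.smul_whiskerRight, id_whiskerRight, Linear.comp_smul, Category.comp_id,
    Category.id_comp, smul_smul] at h2
  rw [mul_comm, smul_left_injective ℂ hk h2, mul_comm]

theorem leftPartial_eq_rightPartial (φ : A ⊗ B ⟶ A ⊗ B) {k : E ⟶ A ⊗ B} (hk : k ≠ 0) :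
    (dB : ℂ) * scalar (leftPartial A A' φ) = dA * scalar (rightPartial B B' φ) := by
  have h := middle_trace (A' := A') (B' := B') φ
  rw [eq_scalar_smul_id sB (leftPartial _ _ _), eq_scalar_smul_id sA (rightPartial _ _ _)] at h
  simp only [MonoidalLinear.smul_whiskerRight, MonoidalLinear.whiskerLeft_smul, id_whiskerRight,
    whiskerLeft_id, Linear.smul_comp, Linear.comp_smul, Category.id_comp] at h
  have h2 := congrArg (fun θ => k ≫ unitRight θ A ▷ B) h
  simp only [unitRight_smul, hA.ev] at h2
  simp only [MonoidalLinear.smul_whiskerRight, unitRight_whiskerRight, hB.coev,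
    MonoidalLinear.whiskerLeft_smul, whiskerLeft_id, id_whiskerRight, smul_smul, Linear.comp_smul,
    Category.comp_id] at h2
  rw [mul_comm, smul_left_injective ℂ hk h2, mul_comm]

/-- The left and right Gram matrices equal the two partial traces up to dimensions, and
`leftPartial_eq_rightPartial` identifies these. -/
theorem mate_gram_eq (e f : E ⟶ A ⊗ B) :
    dagger (mate E' (B' ⊗ A') e) ≫ mate E' (B' ⊗ A') f =
      mate (B' ⊗ A') E' (dagger e) ≫ dagger (mate (B' ⊗ A') E' (dagger f)) := by
  have sE' : Module.finrank ℂ (E' ⟶ E') = 1 := finrank_dual_end (A := E) sE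
  by_cases he : e = 0
  · rw [he, dagger_zero, mate_eq_zero_iff.2 rfl, mate_eq_zero_iff.2 rfl, dagger_zero]
    simp
  · rw [eq_scalar_smul_id sE' (dagger _ ≫ _), eq_scalar_smul_id sE' (_ ≫ dagger _)]
    congr 1
    have h0 : (dE : ℂ) ≠ 0 := by exact_mod_cast hE.pos.ne'
    apply mul_left_cancel₀ h0
    rw [mate_gram_left hA hB hE sA sB sE e f e he, mate_gram_right hA hB hE sA sB sE e f e he,
      leftPartial_eq_rightPartial hA hB hE sA sB sE _ he]

/-- Balanced duality maps are compatible with the unitary structure. -/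
theorem dagger_mate (e : E ⟶ A ⊗ B) :
    dagger (mate E' (B' ⊗ A') e) = mate (B' ⊗ A') E' (dagger e) := by
  have sE' : Module.finrank ℂ (E' ⟶ E') = 1 := finrank_dual_end (A := E) sE
  have cross : ∀ e f : E ⟶ A ⊗ B, mate (B' ⊗ A') E' (dagger f) ≫ mate E' (B' ⊗ A') e =
      scalar (e ≫ dagger f) • 𝟙 E' := by
    intro e f
    rw [← mate_comp, eq_scalar_smul_id sE (e ≫ dagger f), mate_smul, mate_id, scalar_smul_id sE]
  -- The defect between the two sides is itself the mate of some k†; the aim is k = 0.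
  obtain ⟨g, hg⟩ := exists_mate_eq (A := A ⊗ B) (B := E) (A' := B' ⊗ A') (B' := E')
    (dagger (mate E' (B' ⊗ A') e) - mate (B' ⊗ A') E' (dagger e))
  obtain ⟨k, rfl⟩ : ∃ k : E ⟶ A ⊗ B, dagger k = g := ⟨dagger g, UnitaryCategory.dagger_dagger g⟩
  -- Substituting the defect for one factor, the terms cancel by `mate_gram_eq` and `cross`. The
  -- first summand is the scalar of k ≫ k† and the second a square, so both are nonnegative and k
  -- vanishes.
  have h1 : mate (B' ⊗ A') E' (dagger k) ≫ mate E' (B' ⊗ A') k +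
      mate (B' ⊗ A') E' (dagger k) ≫ dagger (mate (B' ⊗ A') E' (dagger k)) = 0 := by
    have h2 : dagger (mate E' (B' ⊗ A') e) ≫ dagger (mate (B' ⊗ A') E' (dagger k)) =
        scalar (k ≫ dagger e) • 𝟙 E' := by
      rw [← UnitaryCategory.dagger_comp, cross, UnitaryCategory.dagger_smul,
        UnitaryCategory.dagger_id, ← scalar_dagger sE, UnitaryCategory.dagger_comp,
        UnitaryCategory.dagger_dagger]
    conv_lhs =>
      enter [1, 1]
      rw [hg]
    conv_lhs =>
      enter [2, 1]
      rw [hg]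
    rw [Preadditive.sub_comp, Preadditive.sub_comp, mate_gram_eq hA hB hE sA sB sE, cross, h2]
    abel
  rw [cross] at h1
  have h3 := congrArg scalar h1
  rw [scalar_add, scalar_smul_id sE', scalar_zero] at h3
  have h4 := congrArg Complex.re h3
  obtain ⟨r, r0, rz, hr⟩ := exists_comp_dagger_eq sE k
  have h5 := scalar_comp_dagger_re_nonneg sE' (mate (B' ⊗ A') E' (dagger k))
  rw [Complex.add_re, hr, Complex.ofReal_re, Complex.zero_re] at h4
  have h6 := rz (by linarith)
  rw [h6, dagger_zero, mate_eq_zero_iff.2 rfl] at hg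
  exact sub_eq_zero.1 hg.symm

/-- The partial trace over `A` of an endomorphism of `A ⊗ B` that factors through a simple
object. -/
theorem scalar_leftPartial (e : E ⟶ A ⊗ B) (f : A ⊗ B ⟶ E) :
    (dB : ℂ) * scalar (leftPartial A A' (f ≫ e)) = dE * scalar (e ≫ f) := by
  have sE' : Module.finrank ℂ (E' ⟶ E') = 1 := finrank_dual_end (A := E) sE
  by_cases he : e = 0
  · rw [he]; simp [leftPartial]
  · obtain ⟨k, rfl⟩ : ∃ k : E ⟶ A ⊗ B, dagger k = f := ⟨dagger f, UnitaryCategory.dagger_dagger f⟩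
    -- Once † commutes with mates, the Gram product is the mate of e ≫ k†, hence the same scalar.
    rw [← mate_gram_left hA hB hE sA sB sE k e e he, dagger_mate hA hB hE sA sB sE, ← mate_comp,
      eq_scalar_smul_id sE (e ≫ _), mate_smul, mate_id, scalar_smul_id sE', scalar_smul_id sE]

end Fusion

/-- The dimension of a balanced dual is an isomorphism invariant. -/
theorem IsBalanced.eq_of_ne_zero (hA : IsBalanced A A' dA) (hB : IsBalanced B B' dB)
    (sA : Module.finrank ℂ (A ⟶ A) = 1) (sB : Module.finrank ℂ (B ⟶ B) = 1)
    {f : A ⟶ B} (hf : f ≠ 0) : dA = dB := by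
  have sA' : Module.finrank ℂ (A' ⟶ A') = 1 := finrank_dual_end (A := A) sA
  have sB' : Module.finrank ℂ (B' ⟶ B') = 1 := finrank_dual_end (A := B) sB
  have h1 := mate_loop (A' := A') (B' := B') f f
  have h2 := mate_loop' (A' := A') (B' := B') f f
  obtain ⟨q, q0, qz, hq⟩ := exists_comp_dagger_eq sA f
  obtain ⟨p, p0, pz, hp⟩ := exists_comp_dagger_eq sB' (mate A' B' f)
  rw [eq_scalar_smul_id sA' (_ ≫ _), eq_scalar_smul_id sB (_ ≫ _), scalar_comp_comm sA' sB',
    scalar_comp_comm sB sA, hp, hq] at h1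
  rw [eq_scalar_smul_id sB' (_ ≫ _), eq_scalar_smul_id sA (_ ≫ _), hp, hq] at h2
  simp only [MonoidalLinear.smul_whiskerRight, MonoidalLinear.whiskerLeft_smul, id_whiskerRight,
    whiskerLeft_id, Linear.smul_comp, Linear.comp_smul, Category.id_comp] at h1 h2
  have h3 := congrArg (fun θ => unitRight θ A ≫ f) h1
  have h4 := congrArg (fun θ => unitLeft θ A ≫ f) h2
  simp only [unitRight_smul, hA.ev, Linear.smul_comp, unitRight_natural, hB.ev, Linear.comp_smul,
    Category.comp_id, Category.id_comp, smul_smul] at h3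
  simp only [unitLeft_smul, hA.coev, Linear.smul_comp, unitLeft_natural, hB.coev, Linear.comp_smul,
    Category.comp_id, Category.id_comp, smul_smul] at h4
  have h5 : p * dA = q * dB := by exact_mod_cast smul_left_injective ℂ hf h3
  have h6 : p * dB = q * dA := by exact_mod_cast smul_left_injective ℂ hf h4
  have q1 : 0 < q := lt_of_le_of_ne q0 fun h => hf (qz h.symm)
  have a0 := hA.pos
  have b0 := hB.pos
  -- The two loop identities read p d_A = q d_B and p d_B = q d_A; positivity of d_A + d_B gives p =
  -- q.
  have h7 : (p - q) * (dA + dB) = 0 := by linear_combination h5 + h6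
  have h8 : p = q := by
    rcases mul_eq_zero.1 h7 with h | h
    · linarith
    · linarith
  rw [h8] at h5
  exact mul_left_cancel₀ q1.ne' h5

/-- The partial trace over `A` of the identity of `A ⊗ B`. -/
theorem leftPartial_id : leftPartial A A' (𝟙 (A ⊗ B)) = unitLeft (dagger (ε_ A A') ≫ ε_ A A') B := by
  simp [leftPartial, unitLeft]

theorem leftPartial_sum {ι : Type*} (s : Finset ι) (φ : ι → (A ⊗ B ⟶ A ⊗ B)) :
    leftPartial A A' (∑ i ∈ s, φ i) = ∑ i ∈ s, leftPartial A A' (φ i) := by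
  simp only [leftPartial, whiskerLeft_sum, Preadditive.sum_comp, Preadditive.comp_sum]

/-- A duality pairing with rescaled duality maps. -/
@[reducible]
def scaledPairing (A A' : D) [ExactPairing A A'] (μ : ℂ) (hμ : μ ≠ 0) : ExactPairing A A' where
  coevaluation' := μ⁻¹ • η_ A A'
  evaluation' := μ • ε_ A A'
  coevaluation_evaluation' := by
    simp [smul_smul, hμ]
  evaluation_coevaluation' := by
    simp [smul_smul, hμ]

end UnitaryDuality

/-! ### Existence and fusion rules of quantum dimensions. -/

section QuantumDimension

variable {D : Type*} [Category D] [Preadditive D] [Linear ℂ D] [MonoidalCategory D]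
  [MonoidalPreadditive D] [MonoidalLinear ℂ D] [UnitaryCategory D] [UnitaryMonoidal D]

/-- The loop is a square in the unitary structure, and it cannot vanish because the zigzag would
then make 𝟙 A zero. -/
theorem exists_unitRight_loop {A A' : D} [ExactPairing A A']
    (sA : Module.finrank ℂ (A ⟶ A) = 1) :
    ∃ r : ℝ, 0 < r ∧ scalar (unitRight (dagger (ε_ A A') ≫ ε_ A A') A) = r := by
  obtain ⟨r, r0, rz, hr⟩ := exists_comp_dagger_eq sA (dagger (A ◁ ε_ A A' ≫ (ρ_ A).hom))
  refine ⟨r, lt_of_le_of_ne r0 fun h => ?_, ?_⟩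
  · have h1 := congrArg dagger (rz h.symm)
    rw [UnitaryCategory.dagger_dagger, dagger_zero, ← cancel_mono (ρ_ A).inv] at h1
    have h2 := ExactPairing.evaluation_coevaluation A A'
    have h3 : A ◁ ε_ A A' = 0 := by simpa using h1
    rw [h3, Limits.comp_zero, Limits.comp_zero] at h2
    apply id_ne_zero sA
    rw [← cancel_mono (ρ_ A).inv, ← cancel_epi (λ_ A).hom]
    simpa using h2.symm
  · rw [← hr, UnitaryCategory.dagger_dagger, UnitaryCategory.dagger_comp, dagger_whiskerLeft,
      UnitaryMonoidal.dagger_rightUnitor]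
    simp [unitRight]

theorem exists_unitLeft_loop {A A' : D} [ExactPairing A A']
    (sA : Module.finrank ℂ (A ⟶ A) = 1) :
    ∃ r : ℝ, 0 < r ∧ scalar (unitLeft (η_ A A' ≫ dagger (η_ A A')) A) = r := by
  obtain ⟨r, r0, rz, hr⟩ := exists_comp_dagger_eq sA ((λ_ A).inv ≫ η_ A A' ▷ A)
  refine ⟨r, lt_of_le_of_ne r0 fun h => ?_, ?_⟩
  · have h1 := rz h.symm
    rw [← cancel_epi (λ_ A).hom] at h1
    have h2 := ExactPairing.evaluation_coevaluation A A'
    have h3 : η_ A A' ▷ A = 0 := by simpa using h1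
    rw [h3, Limits.zero_comp] at h2
    apply id_ne_zero sA
    rw [← cancel_mono (ρ_ A).inv, ← cancel_epi (λ_ A).hom]
    simpa using h2.symm
  · rw [← hr, UnitaryCategory.dagger_comp, dagger_whiskerRight, dagger_leftUnitor_inv]
    simp [unitLeft]

/-- Every dual of a simple object has balanced duality maps. -/
theorem exists_balanced_pairing {A A' : D} [h : ExactPairing A A']
    (sA : Module.finrank ℂ (A ⟶ A) = 1) :
    ∃ μ d : ℝ, 0 < μ ∧
      (μ ^ 2 : ℂ) * scalar (unitRight (dagger (ε_ A A') ≫ ε_ A A') A) = d ∧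
      d = Real.sqrt (‖scalar (unitRight (dagger (ε_ A A') ≫ ε_ A A') A)‖ *
        ‖scalar (unitLeft (η_ A A' ≫ dagger (η_ A A')) A)‖) ∧
      ∃ P : ExactPairing A A', @IsBalanced D _ _ _ _ _ A A' P d ∧
        P.evaluation' = (μ : ℂ) • h.evaluation' := by
  obtain ⟨r, r0, hr⟩ := exists_unitRight_loop (A' := A') sA
  obtain ⟨l, l0, hl⟩ := exists_unitLeft_loop (A' := A') sA
  set d := Real.sqrt (r * l) with hd
  have d0 : 0 < d := Real.sqrt_pos.2 (mul_pos r0 l0)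
  have d2 : d ^ 2 = r * l := Real.sq_sqrt (mul_pos r0 l0).le
  -- Scaling ev by μ and coev by its inverse multiplies the loops r and l by μ² and its inverse;
  -- both become the geometric mean d.
  set μ := Real.sqrt (d / r) with hμ
  have μ0 : 0 < μ := Real.sqrt_pos.2 (div_pos d0 r0)
  have μ2 : μ ^ 2 * r = d := by rw [hμ, Real.sq_sqrt (div_pos d0 r0).le]; field_simp
  have μ2' : (μ⁻¹) ^ 2 * l = d := by
    field_simp
    nlinarith
  refine ⟨μ, d, μ0, ?_, ?_, scaledPairing A A' (μ : ℂ) (by exact_mod_cast μ0.ne'),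
    @IsBalanced.mk D _ _ _ _ _ A A' (_) d d0 ?_ ?_, rfl⟩
  · rw [hr, ← μ2]; push_cast; ring
  · rw [hr, hl, Complex.norm_real, Complex.norm_real, Real.norm_of_nonneg r0.le,
      Real.norm_of_nonneg l0.le]
  · change unitRight (dagger ((μ : ℂ) • ε_ A A') ≫ ((μ : ℂ) • ε_ A A')) A = _
    rw [UnitaryCategory.dagger_smul, Linear.smul_comp, Linear.comp_smul, smul_smul, unitRight_smul,
      eq_scalar_smul_id sA (unitRight _ A), hr, Complex.conj_ofReal, smul_smul, ← μ2]
    congr 1; push_cast; ring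
  · change unitLeft (((μ : ℂ)⁻¹ • η_ A A') ≫ dagger ((μ : ℂ)⁻¹ • η_ A A')) A = _
    rw [UnitaryCategory.dagger_smul, Linear.smul_comp, Linear.comp_smul, smul_smul, unitLeft_smul,
      eq_scalar_smul_id sA (unitLeft _ A), hl, map_inv₀, Complex.conj_ofReal, smul_smul, ← μ2']
    congr 1; push_cast; ring

variable [RigidCategory D]

/-- The relation for μ² is recorded because `leftCup` is μ² times the adjoint of the original
evaluation, that is, μ times the adjoint of the balanced one. -/
theorem exists_balanced_rightDual {A : D} (sA : Module.finrank ℂ (A ⟶ A) = 1) :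
    ∃ μ : ℝ, 0 < μ ∧ (μ ^ 2 : ℂ) = qdim A / capLoop A ∧
      ∃ P : ExactPairing A Aᘁ, @IsBalanced D _ _ _ _ _ A Aᘁ P (qdim A) ∧
        P.evaluation' = (μ : ℂ) • (HasRightDual.exact : ExactPairing A Aᘁ).evaluation' := by
  obtain ⟨r, r0, hr⟩ := exists_unitRight_loop (A' := Aᘁ) sA
  obtain ⟨μ, d, h2, h4, h5, P, h1, h3⟩ := exists_balanced_pairing (A' := Aᘁ) sA
  have h6 : d = qdim A := h5
  subst h6
  refine ⟨μ, h2, ?_, P, h1, h3⟩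
  have h7 : capLoop A ≠ 0 := by
    have : capLoop A = r := hr
    rw [this]; exact_mod_cast r0.ne'
  rw [eq_div_iff h7]
  exact h4

theorem qdim_pos {A : D} (sA : Module.finrank ℂ (A ⟶ A) = 1) : 0 < qdim A := by
  obtain ⟨-, -, -, P, h, -⟩ := exists_balanced_rightDual sA
  exact h.pos

/-- The quantum dimension does not depend on the choice of balanced duality maps. -/
theorem IsBalanced.eq_qdim {A B B' : D} [ExactPairing B B'] {d : ℝ} (h : IsBalanced B B' d)
    (sA : Module.finrank ℂ (A ⟶ A) = 1) (sB : Module.finrank ℂ (B ⟶ B) = 1)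
    {f : A ⟶ B} (hf : f ≠ 0) : d = qdim A := by
  obtain ⟨-, -, -, P, h', -⟩ := exists_balanced_rightDual sA
  exact (h'.eq_of_ne_zero h sA sB hf).symm

/-- Dimensions are multiplicative: `∑_b d_b dim Hom(b, A ⊗ c)` is the loop of `A` times `d_c`. -/
theorem sum_qdim_mul_finrank {I : Type*} [Fintype I] {S : I → D} (hS : IsIrr S) {A A' : D}
    [ExactPairing A A'] {d : ℝ} (h : IsBalanced A A' d) (sA : Module.finrank ℂ (A ⟶ A) = 1) (c : I) :
    ∑ b, (qdim (S b) : ℂ) * Module.finrank ℂ (S b ⟶ A ⊗ S c) =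
      scalar (unitLeft (dagger (ε_ A A') ≫ ε_ A A') (S c)) * qdim (S c) := by
  have := hS.finiteDimensional
  choose e he1 he2 using fun b => exists_onb (X := S b) (Y := A ⊗ S c) (hS.simple b)
  obtain ⟨-, -, -, P, hP, -⟩ := exists_balanced_rightDual (hS.simple c)
  have h1 : ∀ b s, (qdim (S c) : ℂ) * scalar (leftPartial A A' (dagger (e b s) ≫ e b s)) =
      qdim (S b) := by
    intro b s
    obtain ⟨-, -, -, Q, hQ, -⟩ := exists_balanced_rightDual (hS.simple b)
    rw [scalar_leftPartial h hP hQ sA (hS.simple c) (hS.simple b), he1, if_pos rfl,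
      scalar_id (hS.simple b), mul_one]
  -- Partial trace over A of the resolution of 𝟙 on A ⊗ c: each copy of b contributes d_b / d_c, and
  -- the identity contributes the loop of A.
  have h2 := congrArg (fun φ => (qdim (S c) : ℂ) * scalar (leftPartial A A' φ)) (hS.sum_onb e he2)
  simp only [leftPartial_sum, scalar_sum, Finset.mul_sum, h1, leftPartial_id] at h2
  rw [mul_comm (scalar _), ← h2]
  simp [mul_comm]

end QuantumDimension

end BoundaryTube

end

noncomputable section

namespace BoundaryTube

open UnitaryCategory (dagger)

/-! ### Multiplicities -/

/-- The dimension of a direct sum. -/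
theorem finrank_eq_sum_of_decomposition {ι V : Type*} [Fintype ι] {W : ι → Type*} [AddCommGroup V]
    [Module ℂ V] [∀ s, AddCommGroup (W s)] [∀ s, Module ℂ (W s)]
    [∀ s, FiniteDimensional ℂ (W s)] (p : ∀ s, V →ₗ[ℂ] W s) (i : ∀ s, W s →ₗ[ℂ] V)
    (h1 : ∀ s w, p s (i s w) = w) (h2 : ∀ s t, s ≠ t → ∀ w, p t (i s w) = 0)
    (h3 : ∀ v, ∑ s, i s (p s v) = v) : Module.finrank ℂ V = ∑ s, Module.finrank ℂ (W s) := by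
  classical
  let e : V ≃ₗ[ℂ] (∀ s, W s) :=
    { LinearMap.pi p with
      invFun := fun w => ∑ s, i s (w s)
      left_inv := h3
      right_inv := fun w => by
        funext t
        change p t (∑ s, i s (w s)) = w t
        rw [map_sum, Finset.sum_eq_single t (fun s _ hs => h2 s t hs _) (by simp), h1] }
  rw [e.finrank_eq, Module.finrank_pi_fintype]

section Multiplicity

variable {C I : Type*} [Category C] [Preadditive C] [Linear ℂ C] [UnitaryCategory C]
  {S : I → C} (hS : IsIrr S)
include hS

theorem IsIrr.finrank_hom_eq_sum {X Y : C} (t : Decomposition S Y) :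
    Module.finrank ℂ (X ⟶ Y) = ∑ s, Module.finrank ℂ (X ⟶ S (t.label s)) := by
  have := hS.finiteDimensional
  refine finrank_eq_sum_of_decomposition (fun s => Linear.rightComp ℂ X (t.proj s))
    (fun s => Linear.rightComp ℂ X (t.inc s)) (fun s w => ?_) (fun s u h w => ?_) fun v => ?_
  · simp [t.inc_proj]
  · simp [t.inc_proj_of_ne s u h]
  · simp only [Linear.rightComp_apply, Category.assoc, ← Preadditive.comp_sum, t.sum_proj_inc,
      Category.comp_id]

variable [DecidableEq I]

theorem IsIrr.finrank_simple (a b : I) :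
    Module.finrank ℂ (S a ⟶ S b) = if a = b then 1 else 0 := by
  split_ifs with h
  · subst h; exact hS.simple a
  · have : Subsingleton (S a ⟶ S b) :=
      ⟨fun f g => by rw [hS.hom_eq_zero h f, hS.hom_eq_zero h g]⟩
    exact Module.finrank_zero_of_subsingleton

theorem IsIrr.sum_label [Fintype I] {Y : C} (t : Decomposition S Y) {R : Type*}
    [CommSemiring R] (f : I → R) :
    ∑ s, f (t.label s) = ∑ a, (Module.finrank ℂ (S a ⟶ Y) : R) * f a := by
  simp only [hS.finrank_hom_eq_sum t, hS.finrank_simple, Nat.cast_sum, Finset.sum_mul]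
  rw [Finset.sum_comm]
  refine Finset.sum_congr rfl fun s _ => ?_
  simp

/-- Morphisms decompose over the simple objects. -/
theorem IsIrr.finrank_hom [Fintype I] (X Y : C) :
    Module.finrank ℂ (X ⟶ Y) =
      ∑ a, Module.finrank ℂ (S a ⟶ Y) * Module.finrank ℂ (X ⟶ S a) := by
  obtain ⟨t⟩ := hS.semisimple Y
  rw [hS.finrank_hom_eq_sum t, hS.sum_label t fun a => Module.finrank ℂ (X ⟶ S a)]
  simp

theorem IsIrr.finrank_hom_symm [Fintype I] (X Y : C) :
    Module.finrank ℂ (X ⟶ Y) = Module.finrank ℂ (Y ⟶ X) := by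
  have := hS.finiteDimensional
  rw [hS.finrank_hom X Y, hS.finrank_hom Y X]
  refine Finset.sum_congr rfl fun a _ => ?_
  rw [finrank_hom_comm (Y := Y) (hS.simple a), finrank_hom_comm (Y := X) (hS.simple a), mul_comm]

end Multiplicity

/-! ### Multiplicities of the action and dimensions of internal morphism objects. -/

section ModuleTrace

open MonoidalLeftAction

variable {D ℳ I J : Type*} [Category D] [Preadditive D] [Linear ℂ D] [MonoidalCategory D]
  [UnitaryCategory D] [Category ℳ] [Preadditive ℳ] [Linear ℂ ℳ]
  [UnitaryCategory ℳ] [MonoidalLeftAction D ℳ] [UnitaryLeftModule D ℳ]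
  [Fintype I] [Fintype J] {S : I → D} {M : J → ℳ}

/-- The multiplicities of an action are additive in the acting object. -/
theorem finrank_action_eq_sum [DecidableEq I] (hS : IsIrr S) (hM : IsIrr M) (X : D) (x y : ℳ) :
    Module.finrank ℂ (x ⟶ X ⊙ₗ y) =
      ∑ c, Module.finrank ℂ (S c ⟶ X) * Module.finrank ℂ (x ⟶ S c ⊙ₗ y) := by
  have := hM.finiteDimensional
  obtain ⟨t⟩ := hS.semisimple X
  have h : Module.finrank ℂ (x ⟶ X ⊙ₗ y) = ∑ s, Module.finrank ℂ (x ⟶ S (t.label s) ⊙ₗ y) := by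
    refine finrank_eq_sum_of_decomposition (fun s => Linear.rightComp ℂ x (t.proj s ⊵ₗ y))
      (fun s => Linear.rightComp ℂ x (t.inc s ⊵ₗ y)) (fun s w => ?_) (fun s u h w => ?_)
      fun v => ?_
    · simp [← comp_actionHomLeft, t.inc_proj]
    · have h0 : (0 : S (t.label s) ⟶ S (t.label u)) ⊵ₗ y = 0 := (actLeft _ _ y).map_zero
      simp [← comp_actionHomLeft, t.inc_proj_of_ne s u h, h0]
    · simp only [Linear.rightComp_apply, Category.assoc, ← Preadditive.comp_sum,
        ← comp_actionHomLeft, ← sum_action, t.sum_proj_inc, id_actionHomLeft, Category.comp_id]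
  rw [h, hS.sum_label t fun c => Module.finrank ℂ (x ⟶ S c ⊙ₗ y)]
  simp

/-- Frobenius reciprocity in a module category. -/
theorem finrank_bend (A A' : D) [ExactPairing A A'] (x y : ℳ) :
    Module.finrank ℂ (x ⟶ A ⊙ₗ y) = Module.finrank ℂ (A' ⊙ₗ x ⟶ y) := by
  let e : (x ⟶ A ⊙ₗ y) ≃ₗ[ℂ] (A' ⊙ₗ x ⟶ y) :=
    { toFun := bend A'
      map_add' := fun f g => by rw [bend, UnitaryLeftModule.action_add, Preadditive.add_comp]; rfl
      map_smul' := fun c f => by rw [bend, UnitaryLeftModule.action_smul, Linear.smul_comp]; rfl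
      invFun := unbend A
      left_inv := unbend_bend
      right_inv := bend_unbend }
  exact e.finrank_eq

/-- Frobenius reciprocity in a monoidal category. -/
theorem finrank_whiskerLeft [MonoidalPreadditive D] [MonoidalLinear ℂ D] (A A' : D)
    [ExactPairing A A'] (X Y : D) :
    Module.finrank ℂ (A' ⊗ X ⟶ Y) = Module.finrank ℂ (X ⟶ A ⊗ Y) := by
  let e : (A' ⊗ X ⟶ Y) ≃ₗ[ℂ] (X ⟶ A ⊗ Y) :=
    { tensorLeftHomEquiv X A A' Y with
      map_add' := fun f g => by
        simp [tensorLeftHomEquiv, MonoidalPreadditive.whiskerLeft_add]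
      map_smul' := fun c f => by simp [tensorLeftHomEquiv] }
  exact e.finrank_eq

/-- An endomorphism of the unit acting on an object of a module category. -/
def unitAct (θ : 𝟙_ D ⟶ 𝟙_ D) (x : ℳ) : x ⟶ x := (λₗ x).inv ≫ θ ⊵ₗ x ≫ (λₗ x).hom

theorem unitAct_natural (θ : 𝟙_ D ⟶ 𝟙_ D) {x y : ℳ} (f : x ⟶ y) :
    unitAct θ x ≫ f = f ≫ unitAct θ y := by
  simp only [unitAct, Category.assoc, actionUnitIso_hom_naturality, ← action_exchange_assoc,
    actionUnitIso_inv_naturality_assoc]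

theorem unitAct_action (θ : 𝟙_ D ⟶ 𝟙_ D) (A : D) (x : ℳ) :
    unitAct θ (A ⊙ₗ x) = unitLeft θ A ⊵ₗ x := by
  have h : (λ_ A).inv ⊵ₗ x = (λₗ (A ⊙ₗ x)).inv ≫ (αₗ (𝟙_ D) A x).inv := by
    rw [← leftUnitor_inv_action_assoc_assoc, Iso.hom_inv_id, Category.comp_id]
  simp only [unitAct, unitLeft, comp_actionHomLeft, leftUnitor_actionHom, whiskerRight_actionHomLeft,
    Category.assoc, h]
  simp

/-- The scalars by which the unit acts agree on connected simple objects. -/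
theorem scalar_unitAct (hS : IsIrr S) (hM : IsIrr M) (θ : 𝟙_ D ⟶ 𝟙_ D) {i : J} {c : I} {y : ℳ}
    {f : M i ⟶ S c ⊙ₗ y} (hf : f ≠ 0) :
    scalar (unitAct θ (M i)) = scalar (unitLeft θ (S c)) := by
  have h := unitAct_natural θ f
  rw [unitAct_action, eq_scalar_smul_id (hM.simple i) (unitAct _ _),
    eq_scalar_smul_id (hS.simple c) (unitLeft _ _), UnitaryLeftModule.smul_action,
    id_actionHomLeft, Linear.smul_comp, Linear.comp_smul, Category.id_comp, Category.comp_id] at h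
  exact smul_left_injective ℂ hf h

variable [RigidCategory D] [UnitaryMonoidal D] [MonoidalPreadditive D] [MonoidalLinear ℂ D]

/-- The dimension `∑_b d_b dim Hom(b ⊙ x, y)` of the internal morphism object. -/
def homDim (S : I → D) (x y : ℳ) : ℝ :=
  ∑ b, qdim (S b) * Module.finrank ℂ (y ⟶ S b ⊙ₗ x)

theorem homDim_nonneg (hS : IsIrr S) (x y : ℳ) : 0 ≤ homDim S x y :=
  Finset.sum_nonneg fun b _ => mul_nonneg (qdim_pos (hS.simple b)).le (Nat.cast_nonneg _)

variable [DecidableEq I] [DecidableEq J]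

/-- The dimensions of internal morphism objects form an eigenvector of the fusion matrices. -/
theorem sum_finrank_mul_homDim (hS : IsIrr S) (hM : IsIrr M) {A A' : D} [ExactPairing A A'] {d : ℝ}
    (h : IsBalanced A A' d) (sA : Module.finrank ℂ (A ⟶ A) = 1) (y : ℳ) (i : J) :
    ∑ j, (Module.finrank ℂ (M j ⟶ A ⊙ₗ M i) : ℂ) * homDim S y (M j) =
      scalar (unitAct (dagger (ε_ A A') ≫ ε_ A A') (M i)) * homDim S y (M i) := by
  have := hM.finiteDimensional
  -- Both sums compute dim Hom(A ⊙ i, b ⊙ y): the left one through the constituents of A ⊙ i, the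
  -- right one by bending A and decomposing A' ⊗ b.
  have h1 : ∀ b, ∑ j, Module.finrank ℂ (M j ⟶ A ⊙ₗ M i) * Module.finrank ℂ (M j ⟶ S b ⊙ₗ y) =
      ∑ c, Module.finrank ℂ (S b ⟶ A ⊗ S c) * Module.finrank ℂ (M i ⟶ S c ⊙ₗ y) := by
    intro b
    let _ := conjPairing A A'
    calc _ = Module.finrank ℂ (A ⊙ₗ M i ⟶ S b ⊙ₗ y) := by
          rw [hM.finrank_hom]
          refine Finset.sum_congr rfl fun j _ => ?_
          rw [finrank_hom_comm (Y := A ⊙ₗ M i) (hM.simple j), mul_comm]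
      _ = Module.finrank ℂ (M i ⟶ (A' ⊗ S b) ⊙ₗ y) := by
          rw [← finrank_bend A' A]
          exact (Linear.homCongr ℂ (Iso.refl (M i)) (αₗ A' (S b) y)).finrank_eq.symm
      _ = _ := by
          rw [finrank_action_eq_sum hS hM]
          refine Finset.sum_congr rfl fun c _ => ?_
          rw [← finrank_whiskerLeft A' A, hS.finrank_hom_symm]
  have h2 : ∀ c, (∑ b, (qdim (S b) : ℂ) * Module.finrank ℂ (S b ⟶ A ⊗ S c)) *
      Module.finrank ℂ (M i ⟶ S c ⊙ₗ y) =
      scalar (unitAct (dagger (ε_ A A') ≫ ε_ A A') (M i)) *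
        (qdim (S c) * Module.finrank ℂ (M i ⟶ S c ⊙ₗ y)) := by
    intro c
    rw [sum_qdim_mul_finrank hS h sA c]
    -- The loop of A acts on c and on M i by the same scalar only when a nonzero vertex connects
    -- them; otherwise the term has multiplicity zero.
    by_cases h0 : ∃ f : M i ⟶ S c ⊙ₗ y, f ≠ 0
    · obtain ⟨f, hf⟩ := h0
      rw [scalar_unitAct hS hM _ hf, mul_assoc]
    · push Not at h0
      have : Subsingleton (M i ⟶ S c ⊙ₗ y) := ⟨fun f g => by rw [h0 f, h0 g]⟩
      rw [Module.finrank_zero_of_subsingleton]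
      simp
  calc _ = ∑ b, (qdim (S b) : ℂ) * ((∑ j, Module.finrank ℂ (M j ⟶ A ⊙ₗ M i) *
        Module.finrank ℂ (M j ⟶ S b ⊙ₗ y) : ℕ) : ℂ) := by
        simp only [homDim, Complex.ofReal_sum, Finset.mul_sum, Nat.cast_sum]
        rw [Finset.sum_comm]
        refine Finset.sum_congr rfl fun b _ => Finset.sum_congr rfl fun j _ => ?_
        push_cast; ring
    _ = ∑ c, (∑ b, (qdim (S b) : ℂ) * Module.finrank ℂ (S b ⟶ A ⊗ S c)) *
        Module.finrank ℂ (M i ⟶ S c ⊙ₗ y) := by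
        simp only [h1, Nat.cast_sum, Finset.mul_sum, Finset.sum_mul]
        rw [Finset.sum_comm]
        refine Finset.sum_congr rfl fun b _ => Finset.sum_congr rfl fun j _ => ?_
        push_cast; ring
    _ = _ := by
        simp only [h2, homDim, Complex.ofReal_sum, Finset.mul_sum]
        push_cast; rfl

/-- The simple object dual to a given one. -/
theorem exists_dual_index (hS : IsIrr S) (b : I) : ∃ c, Nonempty ((S b)ᘁ ≅ S c) := by
  have s : Module.finrank ℂ ((S b)ᘁ ⟶ (S b)ᘁ) = 1 := finrank_dual_end (A := S b) (hS.simple b)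
  by_contra! h
  have h0 : ∀ c (f : S c ⟶ (S b)ᘁ), f = 0 := by
    intro c f
    by_contra hf
    obtain ⟨e⟩ := exists_iso_of_ne_zero (hS.simple c) s f hf
    exact (h c).false e.symm
  -- If no simple object mapped nontrivially to the dual, its identity would vanish by
  -- semisimplicity.
  exact id_ne_zero s (hS.hom_ext fun c f => by rw [h0 c f]; simp)

/-- Bending replaces b by its dual and exchanges x and y; dual objects have equal dimension, and
duality permutes the simple objects. -/
theorem homDim_symm (hS : IsIrr S) (hM : IsIrr M) (x y : ℳ) : homDim S x y = homDim S y x := by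
  have := hM.finiteDimensional
  choose β hβ using exists_dual_index hS
  have inj : Function.Injective β := by
    intro b c hbc
    obtain ⟨e⟩ := hβ b
    obtain ⟨e'⟩ := hβ c
    rw [← hbc] at e'
    apply hS.eq_of_iso
    by_contra hn
    obtain ⟨f, hf⟩ := exists_mate_eq (A := S c) (B := S b) (e.trans e'.symm).hom
    have h0 : (e.trans e'.symm).hom ≠ 0 := by
      intro h
      apply id_ne_zero (finrank_dual_end (A' := (S b)ᘁ) (hS.simple b))
      rw [← (e.trans e'.symm).hom_inv_id, h, Limits.zero_comp]
    rw [← hf, Ne, mate_eq_zero_iff] at h0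
    obtain ⟨e2⟩ := exists_iso_of_ne_zero (hS.simple c) (hS.simple b) f h0
    exact hn ⟨e2.symm⟩
  have bij := Finite.injective_iff_bijective.1 inj
  rw [homDim, homDim, ← bij.sum_comp (fun b => qdim (S b) * (Module.finrank ℂ (x ⟶ S b ⊙ₗ y) : ℝ))]
  refine Finset.sum_congr rfl fun b _ => ?_
  obtain ⟨e⟩ := hβ b
  have sb := hS.simple b
  have sb' : Module.finrank ℂ ((S b)ᘁ ⟶ (S b)ᘁ) = 1 := finrank_dual_end (A := S b) sb
  have h1 : qdim (S b) = qdim (S (β b)) := by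
    obtain ⟨-, -, -, P, hP, -⟩ := exists_balanced_rightDual sb
    let _ := conjPairing (S b) (S b)ᘁ
    refine hP.conj.eq_qdim (hS.simple (β b)) sb' (f := e.inv) fun h => ?_
    apply id_ne_zero sb'
    rw [← e.hom_inv_id, h, Limits.comp_zero]
  have h2 : Module.finrank ℂ (x ⟶ S (β b) ⊙ₗ y) = Module.finrank ℂ (x ⟶ (S b)ᘁ ⊙ₗ y) := by
    refine (Linear.homCongr ℂ (Iso.refl x) ⟨e.inv ⊵ₗ y, e.hom ⊵ₗ y, ?_, ?_⟩).finrank_eq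
    · rw [← comp_actionHomLeft, e.inv_hom_id, id_actionHomLeft]
    · rw [← comp_actionHomLeft, e.hom_inv_id, id_actionHomLeft]
  rw [h1, h2, hM.finrank_hom_symm x, ← finrank_bend (S b) (S b)ᘁ]

end ModuleTrace

end BoundaryTube

end

noncomputable section

namespace BoundaryTube

open UnitaryCategory (dagger)

section ModuleTrace

open MonoidalLeftAction

variable {D ℳ I J : Type*} [Category D] [Preadditive D] [Linear ℂ D] [MonoidalCategory D]
  [UnitaryCategory D] [UnitaryMonoidal D] [Category ℳ] [Preadditive ℳ] [Linear ℂ ℳ]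
  [UnitaryCategory ℳ] [MonoidalLeftAction D ℳ] [UnitaryLeftModule D ℳ]
  [Fintype I] [Fintype J] {S : I → D} {M : J → ℳ} {A A' : D} [ExactPairing A A']

/-! ### Flipping vertices -/

variable (A') in
/-- The adjoint of the vertex obtained by bending down the leg `A`. -/
def vertexFlip {x y : ℳ} (e : x ⟶ A ⊙ₗ y) : y ⟶ A' ⊙ₗ x := dagger (bend A' e)

variable (A) in
/-- The inverse of `vertexFlip`, which is the flip for the adjoint duality maps. -/
def vertexUnflip {x y : ℳ} (g : y ⟶ A' ⊙ₗ x) : x ⟶ A ⊙ₗ y :=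
  let _ := conjPairing A A'
  vertexFlip A g

theorem dagger_flip {x y : ℳ} (e : x ⟶ A ⊙ₗ y) : dagger (vertexFlip A' e) = bend A' e :=
  UnitaryCategory.dagger_dagger _

theorem vertexFlip_sum_smul {x y : ℳ} {ι : Type*} [Fintype ι] (c : ι → ℂ) (e : ι → (x ⟶ A ⊙ₗ y)) :
    vertexFlip A' (∑ s, c s • e s) = ∑ s, conj (c s) • vertexFlip A' (e s) := by
  simp only [vertexFlip, bend, action_sum, UnitaryLeftModule.action_smul, Preadditive.sum_comp,
    Linear.smul_comp, dagger_sum, UnitaryCategory.dagger_smul]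

theorem vertexUnflip_sum_smul {x y : ℳ} {ι : Type*} [Fintype ι] (c : ι → ℂ)
    (g : ι → (y ⟶ A' ⊙ₗ x)) :
    vertexUnflip A (∑ s, c s • g s) = ∑ s, conj (c s) • vertexUnflip A (g s) :=
  let _ := conjPairing A A'
  vertexFlip_sum_smul c g

theorem dagger_evM (x : ℳ) :
    dagger (evM A A' x) = (λₗ x).inv ≫ dagger (ε_ A A') ⊵ₗ x ≫ (αₗ A' A x).hom := by
  simp only [evM, UnitaryCategory.dagger_comp, dagger_actionHomLeft, dagger_actionAssoc_inv,
    UnitaryLeftModule.dagger_actionUnit, Category.assoc]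

theorem dagger_evM_evM (x : ℳ) :
    dagger (evM A A' x) ≫ evM A A' x = unitAct (dagger (ε_ A A') ≫ ε_ A A') x := by
  rw [dagger_evM]
  simp [evM, unitAct]

/-- The adjoint of the evaluation for the adjoint duality is the original coevaluation, so the
second flip is exactly unbending. -/
theorem vertexUnflip_vertexFlip {x y : ℳ} (e : x ⟶ A ⊙ₗ y) :
    vertexUnflip A (vertexFlip A' e) = e := by
  let _ := conjPairing A A'
  change vertexFlip A (vertexFlip A' e) = e
  have h : dagger (evM A' A x) = coevM A A' x := by
    rw [dagger_evM]
    change (λₗ x).inv ≫ dagger (dagger (η_ A A')) ⊵ₗ x ≫ _ = _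
    rw [UnitaryCategory.dagger_dagger, coevM]
  rw [vertexFlip, bend, UnitaryCategory.dagger_comp, dagger_actionHomRight, dagger_flip, h]
  exact unbend_bend e

/-- The total weight of the vertexFlipped vertices on `A ⊙ i`. -/
theorem sum_scalar_flip (hM : IsIrr M) (i : J) {n : J → ℕ} (e : ∀ j, Fin (n j) → (M j ⟶ A ⊙ₗ M i))
    (he : ∀ j f, f = ∑ s, scalar (f ≫ dagger (e j s)) • e j s) :
    ∑ j, ∑ s, scalar (vertexFlip A' (e j s) ≫ dagger (vertexFlip A' (e j s))) =
      scalar (unitAct (dagger (ε_ A A') ≫ ε_ A A') (M i)) := by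
  rw [← dagger_evM_evM]
  have h1 : ∀ j s, vertexFlip A' (e j s) ≫ dagger (vertexFlip A' (e j s)) =
      dagger (evM A A' (M i)) ≫ A' ⊴ₗ (dagger (e j s) ≫ e j s) ≫ evM A A' (M i) := by
    intro j s
    rw [dagger_flip, vertexFlip, bend, UnitaryCategory.dagger_comp, dagger_actionHomRight,
      actionHomRight_comp, Category.assoc, Category.assoc]
  -- The vertices resolve the identity of A ⊙ i, so the sum of bubbles collapses to the loop of A.
  have h2 := congrArg
    (fun φ => scalar (dagger (evM A A' (M i)) ≫ A' ⊴ₗ φ ≫ evM A A' (M i))) (hM.sum_onb e he)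
  simp only [action_sum, Preadditive.sum_comp, Preadditive.comp_sum, scalar_sum, ← h1,
    actionHomRight_id, Category.id_comp] at h2
  exact h2

section Block

variable {x y : ℳ} (sx : Module.finrank ℂ (x ⟶ x) = 1) (sy : Module.finrank ℂ (y ⟶ y) = 1)
  {n m : ℕ} {e : Fin n → (x ⟶ A ⊙ₗ y)} {g : Fin m → (y ⟶ A' ⊙ₗ x)}
include sx

theorem scalar_comp_dagger_eq_sum {z : ℳ} {n : ℕ} {e : Fin n → (x ⟶ z)}
    (he : ∀ f, f = ∑ s, scalar (f ≫ dagger (e s)) • e s) (f : x ⟶ z) :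
    scalar (f ≫ dagger f) = ∑ s, scalar (f ≫ dagger (e s)) * conj (scalar (f ≫ dagger (e s))) := by
  conv_lhs => enter [1, 2]; rw [he f]
  simp only [dagger_sum, UnitaryCategory.dagger_smul, Preadditive.comp_sum, Linear.comp_smul,
    scalar_sum, scalar_smul]
  exact Finset.sum_congr rfl fun s _ => mul_comm _ _

include sy

/-- The weighted distance between the two vertexFlips on a block of vertices. -/
theorem sum_normSq_flip (he1 : ∀ s t, e s ≫ dagger (e t) = if s = t then 𝟙 x else 0)
    (he : ∀ f, f = ∑ s, scalar (f ≫ dagger (e s)) • e s)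
    (hg : ∀ f, f = ∑ s, scalar (f ≫ dagger (g s)) • g s)
    (c : Fin m → (x ⟶ A ⊙ₗ y))
    (hc : c = fun r => vertexUnflip A (g r))
    (v w : ℝ) :
    ((∑ s, ∑ r, Complex.normSq (v * scalar (vertexFlip A' (e s) ≫ dagger (g r)) -
      w * scalar (c r ≫ dagger (e s))) : ℝ) : ℂ) =
      v ^ 2 * ∑ s, scalar (vertexFlip A' (e s) ≫ dagger (vertexFlip A' (e s))) +
      w ^ 2 * ∑ r, scalar (c r ≫ dagger (c r)) - 2 * v * w * n := by
  -- The matrices of the flip and of its inverse are inverse up to conjugation. The diagonal entries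
  -- computed here give the term -2vwn after expanding the square.
  have h1 : ∀ s, ∑ r, conj (scalar (vertexFlip A' (e s) ≫ dagger (g r))) * scalar (c r ≫ dagger (e s)) =
      1 := by
    intro s
    have h2 : e s = ∑ r, conj (scalar (vertexFlip A' (e s) ≫ dagger (g r))) • c r := by
      conv_lhs => rw [← vertexUnflip_vertexFlip (A' := A') (e s), hg (vertexFlip A' (e s))]
      rw [vertexUnflip_sum_smul, hc]
    calc _ = scalar ((∑ r, conj (scalar (vertexFlip A' (e s) ≫ dagger (g r))) • c r) ≫ dagger (e s)) := by
          simp only [Preadditive.sum_comp, Linear.smul_comp, scalar_sum, scalar_smul]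
      _ = 1 := by rw [← h2, he1, if_pos rfl, scalar_id sx]
  have h1' : ∀ s, ∑ r, scalar (vertexFlip A' (e s) ≫ dagger (g r)) * conj (scalar (c r ≫ dagger (e s))) =
      1 := by
    intro s
    have := congrArg conj (h1 s)
    simpa using this
  have h3 : ∀ s r, (Complex.normSq (v * scalar (vertexFlip A' (e s) ≫ dagger (g r)) -
      w * scalar (c r ≫ dagger (e s))) : ℂ) =
      v ^ 2 * (scalar (vertexFlip A' (e s) ≫ dagger (g r)) *
        conj (scalar (vertexFlip A' (e s) ≫ dagger (g r)))) +
      w ^ 2 * (scalar (c r ≫ dagger (e s)) * conj (scalar (c r ≫ dagger (e s)))) -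
      v * w * (conj (scalar (vertexFlip A' (e s) ≫ dagger (g r))) * scalar (c r ≫ dagger (e s))) -
      v * w * (scalar (vertexFlip A' (e s) ≫ dagger (g r)) * conj (scalar (c r ≫ dagger (e s)))) := by
    intro s r
    rw [Complex.normSq_eq_conj_mul_self]
    simp only [map_sub, map_mul, Complex.conj_ofReal]
    ring
  simp only [Complex.ofReal_sum, h3, Finset.sum_sub_distrib, Finset.sum_add_distrib,
    ← Finset.mul_sum, h1, h1']
  rw [Finset.sum_comm (f := fun s r => scalar (c r ≫ dagger (e s)) * _)]
  simp only [← scalar_comp_dagger_eq_sum sy hg, ← scalar_comp_dagger_eq_sum sx he]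
  simp
  ring

/-- A relation between matrix entries of the flip and of its inverse extends sesquilinearly from
bases to all vertices. -/
theorem scalar_flip_of_block
    (he : ∀ f, f = ∑ s, scalar (f ≫ dagger (e s)) • e s)
    (hg : ∀ f, f = ∑ s, scalar (f ≫ dagger (g s)) • g s) {v w : ℂ}
    (h : ∀ s r, v * scalar (vertexFlip A' (e s) ≫ dagger (g r)) = w * scalar (
      vertexUnflip A (g r) ≫ dagger (e s)))
    (f k : x ⟶ A ⊙ₗ y) :
    v * scalar (vertexFlip A' f ≫ dagger (vertexFlip A' k)) = w * scalar (k ≫ dagger f) := by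
  have h1 : ∀ s, v * scalar (vertexFlip A' (e s) ≫ dagger (vertexFlip A' k)) = w * scalar (k ≫ dagger (e s)) := by
    intro s
    have h2 : k = ∑ r, conj (scalar (vertexFlip A' k ≫ dagger (g r))) •
        vertexUnflip A (g r) := by
      conv_lhs => rw [← vertexUnflip_vertexFlip (A' := A') k, hg (vertexFlip A' k)]
      rw [vertexUnflip_sum_smul]
    conv_rhs => rw [h2]
    conv_lhs => rw [hg (vertexFlip A' k)]
    simp only [dagger_sum, UnitaryCategory.dagger_smul, Preadditive.comp_sum, Linear.comp_smul,
      Preadditive.sum_comp, Linear.smul_comp, scalar_sum, scalar_smul, Finset.mul_sum]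
    refine Finset.sum_congr rfl fun r _ => ?_
    linear_combination conj (scalar (vertexFlip A' k ≫ dagger (g r))) * h s r
  conv_lhs => rw [he f, vertexFlip_sum_smul]
  conv_rhs => rw [he f]
  simp only [dagger_sum, UnitaryCategory.dagger_smul, Preadditive.comp_sum, Linear.comp_smul,
    Preadditive.sum_comp, Linear.smul_comp, scalar_sum, scalar_smul, Finset.mul_sum]
  refine Finset.sum_congr rfl fun s _ => ?_
  linear_combination conj (scalar (f ≫ dagger (e s))) * h1 s

end Block

/-! ### The module trace. -/

variable [RigidCategory D] [MonoidalPreadditive D] [MonoidalLinear ℂ D]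
  [DecidableEq I] [DecidableEq J]

/-- Flipping is a multiple of an antiunitary, with the multiple prescribed by the dimensions. -/
theorem homDim_mul_scalar_flip (hS : IsIrr S) (hM : IsIrr M) {d : ℝ} (h : IsBalanced A A' d)
    (sA : Module.finrank ℂ (A ⟶ A) = 1) (z : ℳ) (i j : J) (f k : M j ⟶ A ⊙ₗ M i) :
    (homDim S z (M i) : ℂ) * scalar (vertexFlip A' f ≫ dagger (vertexFlip A' k)) =
      homDim S z (M j) * scalar (k ≫ dagger f) := by
  have := hM.finiteDimensional
  have sA' : Module.finrank ℂ (A' ⟶ A') = 1 := finrank_dual_end (A := A) sA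
  choose e he1 he2 using fun i j => exists_onb (X := M j) (Y := A ⊙ₗ M i) (hM.simple j)
  choose g hg1 hg2 using fun i j => exists_onb (X := M i) (Y := A' ⊙ₗ M j) (hM.simple i)
  let v : J → ℝ := fun i => homDim S z (M i)
  let c : ∀ i j, Fin (Module.finrank ℂ (M i ⟶ A' ⊙ₗ M j)) → (M j ⟶ A ⊙ₗ M i) := fun i j r =>
    vertexUnflip A (g i j r)
  have hdim : ∀ i j, Module.finrank ℂ (M j ⟶ A ⊙ₗ M i) = Module.finrank ℂ (M i ⟶ A' ⊙ₗ M j) := by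
    intro i j
    rw [finrank_bend A A', hM.finrank_hom_symm]
  -- The dimensions v form an eigenvector for A; the eigenvalue is rewritten as the total weight of
  -- the flipped vertices at i.
  have hT : ∀ i, ∑ j, (Module.finrank ℂ (M j ⟶ A ⊙ₗ M i) : ℂ) * v j =
      (∑ j, ∑ s, scalar (vertexFlip A' (e i j s) ≫ dagger (vertexFlip A' (e i j s)))) * v i := by
    intro i
    rw [sum_scalar_flip hM i (e i) (he2 i)]
    exact sum_finrank_mul_homDim hS hM h sA z i
  -- The same identity for A' with the adjoint duality, so that the inverse flips appear.
  have hT' : ∀ j, ∑ i, (Module.finrank ℂ (M j ⟶ A ⊙ₗ M i) : ℂ) * v i =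
      (∑ i, ∑ r, scalar (c i j r ≫ dagger (c i j r))) * v j := by
    intro j
    let _ := conjPairing A A'
    have h1 := sum_scalar_flip (A' := A) hM j (fun i => g i j) fun i => hg2 i j
    change ∑ i, ∑ r, scalar (c i j r ≫ dagger (c i j r)) = _ at h1
    simp only [hdim, h1]
    exact sum_finrank_mul_homDim hS hM h.conj sA' z j
  -- The squared distance between the flip and its inverse on one block, weighted by v i and v j.
  let N : J → J → ℝ := fun i j => ∑ s, ∑ r,
    Complex.normSq (v i * scalar (vertexFlip A' (e i j s) ≫ dagger (g i j r)) -
      v j * scalar (c i j r ≫ dagger (e i j s)))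
  have hN : ∀ i j, (N i j : ℂ) =
      v i ^ 2 * ∑ s, scalar (vertexFlip A' (e i j s) ≫ dagger (vertexFlip A' (e i j s))) +
      v j ^ 2 * ∑ r, scalar (c i j r ≫ dagger (c i j r)) -
      2 * v i * v j * Module.finrank ℂ (M j ⟶ A ⊙ₗ M i) := fun i j =>
    sum_normSq_flip (hM.simple j) (hM.simple i) (he1 i j) (he2 i j) (hg2 i j) (c i j) rfl (v i) (v j)
  -- By the two eigenvector equations each square term sums to ∑ v i v j n_ij, where n_ij is the
  -- multiplicity of M j in A ⊙ M i; the cross term subtracts this twice. Every nonnegative block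
  -- therefore vanishes.
  have hsum : ∑ i, ∑ j, N i j = 0 := by
    have h0 : ((∑ i, ∑ j, N i j : ℝ) : ℂ) = 0 := by
      simp only [Complex.ofReal_sum, hN, Finset.sum_sub_distrib, Finset.sum_add_distrib]
      rw [Finset.sum_comm (f := fun i j => (v j : ℂ) ^ 2 * _)]
      simp only [← Finset.mul_sum]
      have e1 : ∀ i, (v i : ℂ) ^ 2 *
          ∑ j, ∑ s, scalar (vertexFlip A' (e i j s) ≫ dagger (vertexFlip A' (e i j s))) =
          ∑ j, (v i : ℂ) * v j * Module.finrank ℂ (M j ⟶ A ⊙ₗ M i) := by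
        intro i
        rw [sq, mul_assoc, mul_comm (v i : ℂ) (∑ _, _), ← hT, Finset.mul_sum]
        exact Finset.sum_congr rfl fun j _ => by ring
      have e2 : ∀ j, (v j : ℂ) ^ 2 * ∑ i, ∑ r, scalar (c i j r ≫ dagger (c i j r)) =
          ∑ i, (v i : ℂ) * v j * Module.finrank ℂ (M j ⟶ A ⊙ₗ M i) := by
        intro j
        rw [sq, mul_assoc, mul_comm (v j : ℂ) (∑ _, _), ← hT', Finset.mul_sum]
        exact Finset.sum_congr rfl fun i _ => by ring
      simp only [e1, e2]
      rw [Finset.sum_comm (f := fun j i => (v i : ℂ) * v j * _), ← Finset.sum_add_distrib,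
        ← Finset.sum_sub_distrib]
      refine Finset.sum_eq_zero fun i _ => ?_
      rw [← Finset.sum_add_distrib, ← Finset.sum_sub_distrib]
      exact Finset.sum_eq_zero fun j _ => by ring
    exact_mod_cast h0
  have N0 : ∀ i j, 0 ≤ N i j := fun i j =>
    Finset.sum_nonneg fun s _ => Finset.sum_nonneg fun r _ => Complex.normSq_nonneg _
  have hz : N i j = 0 := by
    have h1 := (Finset.sum_eq_zero_iff_of_nonneg
      (fun i _ => Finset.sum_nonneg fun j _ => N0 i j)).1 hsum i (Finset.mem_univ i)
    exact (Finset.sum_eq_zero_iff_of_nonneg (fun j _ => N0 i j)).1 h1 j (Finset.mem_univ j)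
  refine scalar_flip_of_block (hM.simple j) (hM.simple i) (he2 i j) (hg2 i j) (fun s r => ?_) f k
  have h1 := (Finset.sum_eq_zero_iff_of_nonneg
    (fun s _ => Finset.sum_nonneg fun r _ => Complex.normSq_nonneg _)).1 hz s (Finset.mem_univ s)
  have h2 := (Finset.sum_eq_zero_iff_of_nonneg
    (fun r _ => Complex.normSq_nonneg _)).1 h1 r (Finset.mem_univ r)
  exact sub_eq_zero.1 (Complex.normSq_eq_zero.1 h2)

/-- M i occurs in 1 ⊙ M i, so some simple b occurring in the unit contributes a positive term. -/
theorem homDim_self_pos (hS : IsIrr S) (hM : IsIrr M) (i : J) : 0 < homDim S (M i) (M i) := by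
  have h1 : Module.finrank ℂ (M i ⟶ 𝟙_ D ⊙ₗ M i) = 1 := by
    rw [← hM.simple i]
    exact (Linear.homCongr ℂ (Iso.refl (M i)) (λₗ[D] (M i))).finrank_eq
  rw [finrank_action_eq_sum hS hM] at h1
  obtain ⟨b, -, hb⟩ := Finset.exists_ne_zero_of_sum_ne_zero (h1.trans_ne one_ne_zero)
  refine Finset.sum_pos' (fun b _ => mul_nonneg (qdim_pos (hS.simple b)).le (Nat.cast_nonneg _))
    ⟨b, Finset.mem_univ b, mul_pos (qdim_pos (hS.simple b)) ?_⟩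
  exact_mod_cast Nat.pos_of_ne_zero (mul_ne_zero_iff.1 hb).2

theorem leftDim_eq (hM : IsIrr M) (i : J) : leftDim S M i = Real.sqrt (homDim S (M i) (M i)) := by
  rw [leftDim, homDim]
  congr 1
  exact Finset.sum_congr rfl fun b _ => by rw [hM.finrank_hom_symm]

theorem leftDim_pos (hS : IsIrr S) (hM : IsIrr M) (i : J) : 0 < leftDim S M i := by
  rw [leftDim_eq hM]
  exact Real.sqrt_pos.2 (homDim_self_pos hS hM i)

/-- The module trace: bending both vertices of a bubble multiplies it by a ratio of dimensions. -/
theorem leftDim_mul_scalar_bend (hS : IsIrr S) (hM : IsIrr M) {d : ℝ} (h : IsBalanced A A' d)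
    (sA : Module.finrank ℂ (A ⟶ A) = 1) {i j : J} (ν : M j ⟶ A ⊙ₗ M i) (ζ : A ⊙ₗ M i ⟶ M j) :
    (leftDim S M i : ℂ) * scalar (dagger (evM A A' (M i)) ≫ A' ⊴ₗ ζ ≫ bend A' ν) =
      leftDim S M j * scalar (ν ≫ ζ) := by
  -- Any z gives an admissible weight vector; comparing two choices fixes its normalisation.
  have key : ∀ z : ℳ, (homDim S z (M i) : ℂ) *
      scalar (dagger (evM A A' (M i)) ≫ A' ⊴ₗ ζ ≫ bend A' ν) =
      homDim S z (M j) * scalar (ν ≫ ζ) := by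
    intro z
    have h1 := homDim_mul_scalar_flip hS hM h sA z i j (dagger ζ) ν
    rw [dagger_flip, vertexFlip, bend, UnitaryCategory.dagger_comp, dagger_actionHomRight,
      UnitaryCategory.dagger_dagger, Category.assoc] at h1
    exact h1
  have h1 := key (M i)
  have h2 := key (M j)
  rw [homDim_symm hS hM (M j) (M i)] at h2
  rw [leftDim_eq hM, leftDim_eq hM]
  have a0 := homDim_self_pos hS hM i
  have b0 := homDim_self_pos hS hM j
  have p0 := homDim_nonneg hS (M i) (M j)
  generalize homDim S (M i) (M i) = a at *
  generalize homDim S (M j) (M j) = b at *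
  generalize homDim S (M i) (M j) = p at *
  generalize scalar (dagger (evM A A' (M i)) ≫ A' ⊴ₗ ζ ≫ bend A' ν) = X at *
  generalize scalar (ν ≫ ζ) = Y at *
  have ha : (a : ℂ) ≠ 0 := by exact_mod_cast a0.ne'
  by_cases hY : Y = 0
  · subst hY
    have hX : X = 0 := by simpa [ha] using h1
    simp [hX]
  -- With a, b the self-dimensions and p the mixed one, z = M i and z = M j give a X = p Y and p X =
  -- b Y. Hence p = √a √b, and the ratio X / Y becomes √b / √a.
  · have h3 : (p * p : ℂ) = a * b := by
      apply mul_right_cancel₀ hY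
      linear_combination (a : ℂ) * h2 - p * h1
    have h4 : p * p = a * b := by exact_mod_cast h3
    have h5 : p = Real.sqrt a * Real.sqrt b := by
      rw [← Real.sqrt_mul a0.le, ← h4, Real.sqrt_mul_self p0]
    have h6 : (a : ℂ) = Real.sqrt a * Real.sqrt a := by
      exact_mod_cast (Real.mul_self_sqrt a0.le).symm
    have h7 : (Real.sqrt a : ℂ) ≠ 0 := by exact_mod_cast (Real.sqrt_pos.2 a0).ne'
    rw [h5, h6] at h1
    push_cast at h1
    apply mul_left_cancel₀ h7
    linear_combination h1

end ModuleTrace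

end BoundaryTube

end

noncomputable section

namespace BoundaryTube

open UnitaryCategory (dagger)

/-! ### The structure maps on diagrams with simple walls -/

theorem kron_self {C J : Type*} [Category C] [Preadditive C] [DecidableEq J] (M : J → C) (x : J) :
    kron M x x = 𝟙 (M x) := by simp [kron]

section VertexBasis

variable {C : Type*} [Category C] [Preadditive C] [Linear ℂ C] [UnitaryCategory C]
  {X Z : C} {Y : ℝ}

/-- Orthogonal expansion: every basis vertex has squared norm Y, which explains the factor Y⁻¹ here
and in the coefficient of Δ. -/
theorem VertexBasis.sum_smul (B : VertexBasis X Z Y) (hX : Module.finrank ℂ (X ⟶ X) = 1)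
    (hY : Y ≠ 0) (f : X ⟶ Z) :
    ∑ s, ((Y⁻¹ : ℝ) : ℂ) • scalar (f ≫ dagger (B.vec s)) • B.vec s = f := by
  have hf : f ∈ Submodule.span ℂ (Set.range B.vec) := B.complete ▸ Submodule.mem_top
  obtain ⟨c, rfl⟩ := (Submodule.mem_span_range_iff_exists_fun ℂ).1 hf
  refine Finset.sum_congr rfl fun s _ => ?_
  rw [Preadditive.sum_comp, scalar_sum, Finset.sum_eq_single s]
  · have h : (Y : ℂ) ≠ 0 := by exact_mod_cast hY
    rw [Linear.smul_comp, B.normalised, if_pos rfl, smul_smul, smul_smul, scalar_smul_id hX]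
    congr 1
    push_cast
    field_simp
  · intro t _ ht
    rw [Linear.smul_comp, B.normalised, if_neg ht, smul_zero, scalar_zero]
  · simp

theorem VertexBasis.sum_smul_dagger (B : VertexBasis X Z Y) (hX : Module.finrank ℂ (X ⟶ X) = 1)
    (hY : Y ≠ 0) (g : Z ⟶ X) :
    ∑ s, ((Y⁻¹ : ℝ) : ℂ) • scalar (B.vec s ≫ g) • dagger (B.vec s) = g := by
  have h := congrArg dagger (B.sum_smul hX hY (dagger g))
  simpa only [dagger_sum, UnitaryCategory.dagger_smul, ← scalar_dagger hX, Complex.conj_ofReal,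
    UnitaryCategory.dagger_comp, UnitaryCategory.dagger_dagger] using h

end VertexBasis

section LeftStructure

open Fam MonoidalLeftAction

variable {D ℳ I J : Type*} [Category D] [Preadditive D] [Linear ℂ D] [MonoidalCategory D]
  [UnitaryCategory D] [Category ℳ] [Preadditive ℳ] [Linear ℂ ℳ]
  [UnitaryCategory ℳ] [MonoidalLeftAction D ℳ] [UnitaryLeftModule D ℳ]
  [Fintype I] [DecidableEq I] [Fintype J] [DecidableEq J] {S : I → D} {M : J → ℳ}

/-- A splitting vertex as a matrix. -/
abbrev singleVert (M : J → ℳ) {A : D} {d e : J} (ν : M d ⟶ A ⊙ₗ M e) : Vert M A :=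
  single (X := fam M) (Y := A ⊙ₗ fam M) d e ν

/-- A fusion vertex as a matrix. -/
abbrev singleCovert (M : J → ℳ) {A : D} {f g : J} (ζ : A ⊙ₗ M f ⟶ M g) : Covert M A :=
  single (X := A ⊙ₗ fam M) (Y := fam M) f g ζ

theorem action_kron (A : D) (i j : J) :
    kron (A ⊙ₗ fam M).obj i j = A ⊴ₗ kron M i j := by
  by_cases h : i = j
  · subst h
    rw [kron_self, kron_self, actionHomRight_id]; rfl
  · simp [kron, h]

theorem diag_eq_sum {X Y : Fam J ℳ} (φ : ∀ j : J, X.obj j ⟶ Y.obj j) :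
    diag φ = ∑ j, single j j (φ j) := by
  rw [← sum_single (diag φ)]
  refine Finset.sum_congr rfl fun i _ => ?_
  rw [Finset.sum_eq_single i]
  · simp
  · intro j _ h
    rw [diag_ne _ h.symm, map_zero]
  · simp

section Simple

variable [hS : Fact (IsIrr S)]

theorem leftDiagram_eq_arc (a : I) {d e f g : J} (ν : M d ⟶ S a ⊙ₗ M e) (ζ : S a ⊙ₗ M f ⟶ M g) :
    leftDiagram S M a ν ζ = arc S M (S a) (singleVert M ν) (singleCovert M ζ) := by
  rw [leftDiagram_eq_simpleArc, simpleArc_eq_arc]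

theorem leftArc_eq_arc {A : D} (t : Decomposition S A) {d e f g : J} (ν : M d ⟶ A ⊙ₗ M e)
    (ζ : A ⊙ₗ M f ⟶ M g) :
    leftArc S M t ν ζ = arc S M A (singleVert M ν) (singleCovert M ζ) := by
  rw [← arcOf_eq_arc t, arcOf_apply, leftArc]
  refine Finset.sum_congr rfl fun s _ => ?_
  rw [leftDiagram_eq_simpleArc, actionHomLeft_eq, actionHomLeft_eq, single_comp_diag,
    diag_comp_single]

theorem tubeOne_eq_sum (t : Decomposition S (𝟙_ D)) :
    tubeOne S M = ∑ x, ∑ y, leftArc S M t (λₗ (M x)).inv (λₗ (M y)).hom := by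
  rw [tubeOne_eq, actionUnit_inv, actionUnit_hom, diag_eq_sum, diag_eq_sum]
  simp only [map_sum, LinearMap.sum_apply, leftArc_eq_arc]
  rw [Finset.sum_comm]

theorem singleVert_mul {A B : D} {d e d' e' : J} (ν : M d ⟶ A ⊙ₗ M e) (ν' : M d' ⟶ B ⊙ₗ M e') :
    vertMul (singleVert M ν) (singleVert M ν') =
      singleVert M (ν ≫ A ⊴ₗ (kron M e d' ≫ ν') ≫ (αₗ A B (M e')).inv) := by
  rw [vertMul_apply, actionHomRight_single, actionAssoc_inv, single_comp_diag, single_comp_single,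
    action_kron, actionHomRight_comp, Category.assoc]

theorem singleCovert_mul {A B : D} {f g f' g' : J} (ζ : A ⊙ₗ M f ⟶ M g) (ζ' : B ⊙ₗ M f' ⟶ M g') :
    covertMul (singleCovert M ζ) (singleCovert M ζ') =
      singleCovert M ((αₗ A B (M f')).hom ≫ A ⊴ₗ (ζ' ≫ kron M g' f) ≫ ζ) := by
  rw [covertMul_apply, actionHomRight_single, actionAssoc_hom, single_comp_single,
    diag_comp_single, action_kron, actionHomRight_comp, Category.assoc]

theorem wallTrace_comp_single {Y : Fam J ℳ} (ν : fam M ⟶ Y) (i j : J) (g : Y.obj i ⟶ M j) :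
    wallTrace M (ν ≫ single i j g) = scalar (ent ν j i ≫ g) := by
  rw [wallTrace_apply, Finset.sum_eq_single j]
  · rw [Fam.comp_apply, Finset.sum_eq_single i]
    · rw [single_same]
    · intro k _ hk
      rw [single_ne_left hk, Limits.comp_zero]
    · simp
  · intro k _ hk
    rw [Fam.comp_apply, Finset.sum_eq_zero, scalar_zero]
    intro l _
    rw [single_ne_right _ _ hk, Limits.comp_zero]
  · simp

theorem wallTrace_single_comp {Y : Fam J ℳ} (i j : J) (f : M i ⟶ Y.obj j) (ζ : Y ⟶ fam M) :
    wallTrace M ((single i j f : fam M ⟶ Y) ≫ ζ) = scalar (f ≫ ent ζ j i) := by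
  rw [wallTrace_apply, Finset.sum_eq_single i]
  · rw [single_comp, single_same]
  · intro k _ hk
    rw [single_comp, single_ne_left hk, scalar_zero]
  · simp

theorem ent_single {X Y : Fam J ℳ} (i j k l : J) (f : X.obj i ⟶ Y.obj j) :
    ent (single i j f : X ⟶ Y) k l = kron X.obj k i ≫ f ≫ kron Y.obj j l := by
  by_cases hk : k = i
  · subst hk
    by_cases hl : l = j
    · subst hl
      simp [kron_self]
    · rw [single_ne_right _ _ hl]
      simp [kron, Ne.symm hl]
  · rw [single_ne_left hk]
    simp [kron, hk]

theorem tubeCounit_leftDiagram (a : I) {d e f g : J} (ν : M d ⟶ S a ⊙ₗ M e)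
    (ζ : S a ⊙ₗ M f ⟶ M g) :
    tubeCounit S M (leftDiagram S M a ν ζ) =
      scalar (ν ≫ S a ⊴ₗ kron M e f ≫ ζ ≫ kron M g d) := by
  rw [leftDiagram_eq_arc, tubeCounit_arc, wallTrace_single_comp, ent_single, action_kron]

end Simple

variable [hS : Fact (IsIrr S)] [hM : Fact (IsIrr M)]

/-- Normalised vertex bases as a dual pair. -/
theorem isDualPair_of_vertexBasis (a : I) {N : J → J → ℝ} (hN : ∀ i j, N i j ≠ 0)
    (B : ∀ i j : J, VertexBasis (M j) (S a ⊙ₗ M i) (N i j)) :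
    IsDualPair (wallPairing M (S a ⊙ₗ fam M))
      (fun p : Σ i j, Fin (B i j).n =>
        (((N p.1 p.2.1)⁻¹ : ℝ) : ℂ) • singleVert M ((B p.1 p.2.1).vec p.2.2))
      (fun p => singleCovert M (dagger ((B p.1 p.2.1).vec p.2.2))) := by
  constructor
  · intro ν
    simp only [Fintype.sum_sigma, wallPairing_apply, wallTrace_comp_single]
    rw [Finset.sum_comm]
    conv_rhs => rw [← sum_single ν]
    refine Finset.sum_congr rfl fun j _ => Finset.sum_congr rfl fun i _ => ?_
    conv_rhs => rw [← (B i j).sum_smul (hM.out.simple j) (hN i j) (ent ν j i)]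
    simp only [map_sum, map_smul]
    exact Finset.sum_congr rfl fun s _ => smul_comm _ _ _
  · intro ζ
    simp only [Fintype.sum_sigma, map_smul, LinearMap.smul_apply, wallPairing_apply,
      wallTrace_single_comp]
    conv_rhs => rw [← sum_single ζ]
    refine Finset.sum_congr rfl fun i _ => Finset.sum_congr rfl fun j _ => ?_
    conv_rhs => rw [← (B i j).sum_smul_dagger (hM.out.simple j) (hN i j) (ent ζ i j)]
    simp only [map_sum, map_smul]
    exact Finset.sum_congr rfl fun s _ => by rw [smul_eq_mul, mul_smul]

theorem evM_fam (A A' : D) [ExactPairing A A'] (X : Fam J ℳ) :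
    evM A A' X = diag fun j => evM A A' (X.obj j) := by
  simp only [evM, actionAssoc_inv, actionHomLeft_eq, actionUnit_hom, diag_comp_diag]

theorem bend_singleVert {A : D} (A' : D) [ExactPairing A A'] {d e : J} (ν : M d ⟶ A ⊙ₗ M e) :
    bend A' (singleVert M ν) = singleCovert M (bend A' ν) := by
  rw [bend, actionHomRight_single, evM_fam, single_comp_diag]
  rfl

theorem ent_bend {A : D} (A' : D) [ExactPairing A A'] (ν : Vert M A) (i j : J) :
    ent (bend A' ν) i j = bend A' (ent ν i j) := by
  rw [bend, evM_fam, comp_diag_apply]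
  rfl

variable [UnitaryMonoidal D] [RigidCategory D] [MonoidalPreadditive D] [MonoidalLinear ℂ D]

/-- Bending up a fusion vertex with balanced duality maps. -/
theorem lift_singleCovert {A A' : D} [ExactPairing A A'] {d : ℝ} (h : IsBalanced A A' d)
    (sA : Module.finrank ℂ (A ⟶ A) = 1) {f g : J} (ζ : A ⊙ₗ M f ⟶ M g) :
    lift A' (singleCovert M ζ) = ((leftDim S M f / leftDim S M g : ℝ) : ℂ) •
      singleVert M (dagger (evM A A' (M f)) ≫ A' ⊴ₗ ζ) := by
  refine vert_ext fun η => ?_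
  obtain ⟨ν, rfl⟩ : ∃ ν : Vert M A, bend A' ν = η := ⟨unbend A η, bend_unbend η⟩
  rw [wallTrace_lift_comp_bend, wallTrace_comp_single, Linear.smul_comp, map_smul,
    wallTrace_single_comp, ent_bend, smul_eq_mul, Category.assoc]
  -- Tested against a bent vertex, the claim is the module trace identity; the ratio d_f / d_g
  -- compensates the change of the bubble.
  have h1 := leftDim_mul_scalar_bend hS.out hM.out h sA (ent ν g f) ζ
  have h2 : (leftDim S M g : ℂ) ≠ 0 := by exact_mod_cast (leftDim_pos hS.out hM.out g).ne'
  push_cast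
  field_simp
  linear_combination -h1

/-- The balanced duality maps used for `lift` differ from the given ones by μ. Bending down
contributes one factor μ and `leftBendUp` absorbs it, so the product is independent of the scaling.
-/
theorem arc_bend (a : I) (t : Decomposition S (S a)ᘁ) {d e f g : J} [P : ExactPairing (S a) (S a)ᘁ]
    (h : IsBalanced (S a) (S a)ᘁ (qdim (S a))) {μ : ℝ} (h0 : 0 < μ)
    (h1 : (μ ^ 2 : ℂ) = qdim (S a) / capLoop (S a))
    (h2 : P.evaluation' = (μ : ℂ) • (HasRightDual.exact : ExactPairing (S a) (S a)ᘁ).evaluation')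
    (ν : M d ⟶ S a ⊙ₗ M e) (ζ : S a ⊙ₗ M f ⟶ M g) :
    arc S M (S a)ᘁ (lift (S a)ᘁ (singleCovert M ζ)) (bend (S a)ᘁ (singleVert M ν)) =
      ((leftDim S M f / leftDim S M g : ℝ) : ℂ) •
        leftArc S M t (leftBendUp ζ) (leftBendDown ν) := by
  have hμ : (μ : ℂ) ≠ 0 := by exact_mod_cast h0.ne'
  have e1 : @ExactPairing.evaluation D _ _ (S a) (S a)ᘁ P =
      (μ : ℂ) • @ExactPairing.evaluation D _ _ (S a) (S a)ᘁ HasRightDual.exact := h2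
  have e2 : bend (S a)ᘁ ν = (μ : ℂ) • leftBendDown ν := by
    rw [bend, evM, e1, UnitaryLeftModule.smul_action, leftBendDown]
    simp only [Linear.smul_comp, Linear.comp_smul]
  have e3 : leftBendUp ζ = (μ : ℂ) • (dagger (evM (S a) (S a)ᘁ (M f)) ≫ (S a)ᘁ ⊴ₗ ζ) := by
    rw [dagger_evM, e1, leftBendUp, leftCup, ← h1, UnitaryCategory.dagger_smul,
      UnitaryLeftModule.smul_action, UnitaryLeftModule.smul_action, Complex.conj_ofReal, sq]
    simp only [Linear.smul_comp, Linear.comp_smul, Category.assoc, smul_smul]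
  rw [lift_singleCovert (S := S) h (hS.out.simple a), bend_singleVert, leftArc_eq_arc, e2, e3]
  simp only [singleVert, singleCovert, map_smul, LinearMap.smul_apply]
  rw [smul_comm]

variable (S M) in
/-- The tube algebra carries the diagrammatic structure maps. -/
theorem isLeftTubeStructure : IsLeftTubeStructure S M (tubeCStar S M) where
  one_eq := tubeOne_eq_sum
  mul_eq a a' t d e f g d' e' f' g' ν ζ ν' ζ' := by
    change tubeMul S M _ _ = _
    rw [leftDiagram_eq_arc, leftDiagram_eq_arc, tubeMul_arc, singleVert_mul, singleCovert_mul,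
      leftArc_eq_arc]
  counit_eq a d e f g ν ζ := by
    change tubeCounit S M _ • _ = _
    rw [tubeCounit_leftDiagram, ← eq_scalar_smul_id (hM.out.simple d)]
  counit_normalised a x y B s t := by
    change tubeCounit S M _ = _
    rw [tubeCounit_leftDiagram, kron_self, kron_self, actionHomRight_id, Category.id_comp,
      Category.comp_id, B.normalised]
    split_ifs
    · rw [scalar_smul_id (hM.out.simple y)]
    · rw [scalar_zero]
  comul_eq a B d e f g ν ζ := by
    change tubeComul S M _ = _
    have h0 : ∀ i, 0 < leftDim S M i := leftDim_pos hS.out hM.out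
    have hq := qdim_pos (hS.out.simple a)
    have hN : ∀ i j, leftNorm S M a i j ≠ 0 := fun i j =>
      (Real.sqrt_pos.2 (div_pos (mul_pos hq (h0 i)) (h0 j))).ne'
    -- The dual basis of the vertices σ† consists of σ divided by its norm √(d_a d_i / d_j), which
    -- is the stated coefficient of Δ.
    have hN' : ∀ i j, (leftNorm S M a i j)⁻¹ =
        Real.sqrt (leftDim S M j / (qdim (S a) * leftDim S M i)) := fun i j => by
      rw [leftNorm, ← Real.sqrt_inv, inv_div]
    rw [leftDiagram_eq_arc, tubeComul_arc (isDualPair_of_vertexBasis a hN B)]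
    simp only [Fintype.sum_sigma, map_smul, LinearMap.smul_apply, TensorProduct.smul_tmul', hN',
      leftDiagram_eq_arc]
  antipode_eq a t d e f g ν ζ := by
    change tubeAntipode S M _ = _
    obtain ⟨μ, h0, h1, P, h, h2⟩ := exists_balanced_rightDual (hS.out.simple a)
    rw [leftDiagram_eq_arc, tubeAntipode_arc (S a)ᘁ, arc_bend a t h h0 h1 h2]
  star_eq a t d e f g ν ζ := by
    change tubeStar S M _ = _
    obtain ⟨μ, h0, h1, P, h, h2⟩ := exists_balanced_rightDual (hS.out.simple a)
    rw [leftDiagram_eq_arc, tubeStar_arc (S a)ᘁ, dag_single, dag_single,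
      arc_bend a t h h0 h1 h2]

end LeftStructure

end BoundaryTube

end

noncomputable section

namespace BoundaryTube

open UnitaryCategory (dagger)

/-! ### The reversed monoidal category -/

/-- The category `D` with the reversed tensor product. -/
structure Rev (D : Type*) where
  of ::
  un : D

namespace Rev

variable {D : Type*} [Category D]

instance : Category (Rev D) where
  Hom X Y := X.un ⟶ Y.un
  id X := 𝟙 X.un
  comp f g := CategoryStruct.comp (obj := D) f g
  id_comp := fun f => Category.id_comp (obj := D) f
  comp_id := fun f => Category.comp_id (obj := D) f
  assoc := fun f g h => Category.assoc (obj := D) f g h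

instance [Preadditive D] : Preadditive (Rev D) where
  homGroup X Y := inferInstanceAs (AddCommGroup (X.un ⟶ Y.un))
  add_comp := fun P Q R f f' g => Preadditive.add_comp P.un Q.un R.un f f' g
  comp_add := fun P Q R f g g' => Preadditive.comp_add P.un Q.un R.un f g g'

instance [Preadditive D] [Linear ℂ D] : Linear ℂ (Rev D) where
  homModule X Y := inferInstanceAs (Module ℂ (X.un ⟶ Y.un))
  smul_comp := fun X Y Z r f g => Linear.smul_comp X.un Y.un Z.un r f g
  comp_smul := fun X Y Z f r g => Linear.comp_smul X.un Y.un Z.un f r g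

instance [MonoidalCategory D] : MonoidalCategory (Rev D) where
  tensorObj X Y := ⟨Y.un ⊗ X.un⟩
  whiskerLeft X _ _ f := MonoidalCategoryStruct.whiskerRight (C := D) f X.un
  whiskerRight f X := MonoidalCategoryStruct.whiskerLeft (C := D) X.un f
  tensorHom f g := MonoidalCategoryStruct.tensorHom (C := D) g f
  tensorUnit := ⟨𝟙_ D⟩
  associator X Y Z := ⟨(α_ Z.un Y.un X.un).inv, (α_ Z.un Y.un X.un).hom,
    (α_ Z.un Y.un X.un).inv_hom_id, (α_ Z.un Y.un X.un).hom_inv_id⟩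
  leftUnitor X := ⟨(ρ_ X.un).hom, (ρ_ X.un).inv, (ρ_ X.un).hom_inv_id, (ρ_ X.un).inv_hom_id⟩
  rightUnitor X := ⟨(λ_ X.un).hom, (λ_ X.un).inv, (λ_ X.un).hom_inv_id, (λ_ X.un).inv_hom_id⟩
  tensorHom_def := fun f g => tensorHom_def' (C := D) g f
  id_tensorHom_id := fun X Y => id_tensorHom_id Y.un X.un
  tensorHom_comp_tensorHom := fun f₁ f₂ g₁ g₂ => tensorHom_comp_tensorHom (C := D) f₂ f₁ g₂ g₁
  whiskerLeft_id := fun X Y => id_whiskerRight Y.un X.un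
  id_whiskerRight := fun X Y => whiskerLeft_id Y.un X.un
  associator_naturality := fun f g h => associator_inv_naturality (C := D) h g f
  leftUnitor_naturality := fun f => rightUnitor_naturality (C := D) f
  rightUnitor_naturality := fun f => leftUnitor_naturality (C := D) f
  pentagon := fun W X Y Z => pentagon_inv (C := D) (W := Z.un) (X := Y.un) (Y := X.un) (Z := W.un)
  triangle := fun X Y => triangle_assoc_comp_right Y.un X.un

/-- A dual pair of `D`, in the reversed order. -/
@[reducible]
def pairing [MonoidalCategory D] (B A : D) [ExactPairing B A] :
    ExactPairing (⟨A⟩ : Rev D) (⟨B⟩ : Rev D) where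
  coevaluation' := η_ B A
  evaluation' := ε_ B A
  coevaluation_evaluation' := ExactPairing.evaluation_coevaluation B A
  evaluation_coevaluation' := ExactPairing.coevaluation_evaluation B A

/-- Reversing the tensor product exchanges left and right duals, so bending in `Rev D` uses the left
duals of D, as required for arcs on the right. -/
instance [MonoidalCategory D] [RigidCategory D] : RigidCategory (Rev D) where
  rightDual X := { rightDual := ⟨ᘁX.un⟩, exact := pairing (ᘁX.un) X.un }
  leftDual X := { leftDual := ⟨X.unᘁ⟩, exact := pairing X.un X.unᘁ }

section Unitary

variable [Preadditive D] [Linear ℂ D]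

instance [UnitaryCategory D] : UnitaryCategory (Rev D) where
  dagger f := UnitaryCategory.dagger (C := D) f
  dagger_dagger f := UnitaryCategory.dagger_dagger (C := D) f
  dagger_id X := UnitaryCategory.dagger_id X.un
  dagger_comp f g := UnitaryCategory.dagger_comp (C := D) f g
  dagger_add f g := UnitaryCategory.dagger_add (C := D) f g
  dagger_smul c f := UnitaryCategory.dagger_smul (C := D) c f
  eq_zero_of_comp_dagger f h := UnitaryCategory.eq_zero_of_comp_dagger (C := D) f h
  comp_dagger_pos f := UnitaryCategory.comp_dagger_pos (C := D) f

variable [MonoidalCategory D]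

instance [MonoidalPreadditive D] : MonoidalPreadditive (Rev D) where
  whiskerLeft_zero := fun {X Y Z} => MonoidalPreadditive.zero_whiskerRight (C := D) (X := X.un) (Y := Y.un) (Z := Z.un)
  zero_whiskerRight := fun {X Y Z} => MonoidalPreadditive.whiskerLeft_zero (C := D) (X := X.un) (Y := Y.un) (Z := Z.un)
  whiskerLeft_add := fun f g => MonoidalPreadditive.add_whiskerRight (C := D) f g
  add_whiskerRight := fun f g => MonoidalPreadditive.whiskerLeft_add (C := D) f g

instance [MonoidalPreadditive D] [MonoidalLinear ℂ D] : MonoidalLinear ℂ (Rev D) where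
  whiskerLeft_smul := fun X _ _ r f => MonoidalLinear.smul_whiskerRight (C := D) r f X.un
  smul_whiskerRight := fun r _ _ f X => MonoidalLinear.whiskerLeft_smul (C := D) X.un r f

variable [UnitaryCategory D]

instance [UnitaryMonoidal D] : UnitaryMonoidal (Rev D) where
  dagger_tensor f g := UnitaryMonoidal.dagger_tensor (D := D) g f
  dagger_associator X Y Z := dagger_associator_inv Z.un Y.un X.un
  dagger_leftUnitor X := UnitaryMonoidal.dagger_rightUnitor X.un
  dagger_rightUnitor X := UnitaryMonoidal.dagger_leftUnitor X.un

end Unitary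

section Action

variable [MonoidalCategory D] {𝒩 : Type*} [Category 𝒩] [MonoidalRightAction D 𝒩]

instance : MonoidalLeftAction (Rev D) 𝒩 where
  actionObj c d := d ⊙ᵣ c.un
  actionHomLeft f d := MonoidalRightActionStruct.actionHomRight (C := D) d f
  actionHomRight c _ _ f := f ⊵ᵣ c.un
  actionHom f g := MonoidalRightActionStruct.actionHom (C := D) g f
  actionAssocIso c c' d := αᵣ d c'.un c.un
  actionUnitIso d := ρᵣ[D] d
  actionHom_def := fun f g => MonoidalRightAction.actionHom_def' (C := D) g f
  actionHomRight_id := fun c d => MonoidalRightAction.id_actionHomLeft (C := D) c.un d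
  id_actionHomLeft := fun c d => MonoidalRightAction.actionHomRight_id (C := D) c.un d
  actionHom_comp := fun f₁ f₂ g₁ g₂ => MonoidalRightAction.actionHom_comp (C := D) g₁ g₂ f₁ f₂
  actionAssocIso_hom_naturality := fun f g h =>
    MonoidalRightAction.actionAssocIso_hom_naturality (C := D) h g f
  actionUnitIso_hom_naturality := fun f =>
    MonoidalRightAction.actionUnitIso_hom_naturality (C := D) f
  whiskerLeft_actionHomLeft := fun c _ _ f d =>
    MonoidalRightAction.actionHomRight_whiskerRight (C := D) f c.un d
  whiskerRight_actionHomLeft := fun c f d =>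
    MonoidalRightAction.whiskerRight_actionHomLeft (C := D) c.un f d
  -- The associator of the reversed category is the inverse of the original one, so the coherence
  -- law is used after composing with that inverse.
  associator_actionHom := fun c₁ c₂ c₃ d => by
    simpa only [MonoidalRightAction.actionHomRight_inv_hom_assoc] using!
      ((d ⊴ᵣ (α_ c₃.un c₂.un c₁.un).inv) ≫=
        MonoidalRightAction.actionHom_associator c₃.un c₂.un c₁.un d).symm
  leftUnitor_actionHom := fun c d => MonoidalRightAction.actionHom_rightUnitor c.un d
  rightUnitor_actionHom := fun c d => MonoidalRightAction.actionHom_leftUnitor c.un d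

end Action

end Rev

end BoundaryTube

end

noncomputable section

namespace BoundaryTube

open UnitaryCategory (dagger)

/-! ### The right boundary tube algebra as a left one over the reversed category -/

namespace Rev

section Dimension

variable {D : Type*} [Category D] [Preadditive D] [Linear ℂ D] [MonoidalCategory D]
  [MonoidalPreadditive D] [MonoidalLinear ℂ D] [UnitaryCategory D] [UnitaryMonoidal D]

/-- The adjoint duality followed by reversal exchanges the two loops twice, so each clause is the
corresponding clause for A. -/
theorem isBalanced {A A' : D} [ExactPairing A A'] {d : ℝ} (h : IsBalanced A A' d) :
    @IsBalanced (Rev D) _ _ _ _ _ ⟨A⟩ ⟨A'⟩ (@pairing D _ _ A' A (conjPairing A A')) d := by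
  let _ := conjPairing A A'
  let _ := pairing A' A
  refine ⟨h.pos, ?_, ?_⟩
  · change unitLeft (dagger (dagger (η_ A A')) ≫ dagger (η_ A A')) A = _
    rw [UnitaryCategory.dagger_dagger]
    exact h.coev
  · change unitRight (dagger (ε_ A A') ≫ dagger (dagger (ε_ A A'))) A = _
    rw [UnitaryCategory.dagger_dagger]
    exact h.ev

variable [RigidCategory D]

/-- `qdim` over the reversed category is computed from the left dual of A. Invariance of the
dimension under the choice of balanced dual identifies it with the value from the right dual. -/
theorem qdim_eq {A : D} (sA : Module.finrank ℂ (A ⟶ A) = 1) : qdim (⟨A⟩ : Rev D) = qdim A := by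
  obtain ⟨-, -, -, P, h, -⟩ := exists_balanced_rightDual sA
  let _ := P
  let _ := conjPairing A Aᘁ
  let _ := pairing Aᘁ A
  exact ((isBalanced h).eq_qdim (A := (⟨A⟩ : Rev D)) sA sA (f := 𝟙 _) (id_ne_zero sA)).symm

theorem leftCup_eq {A : D} (sA : Module.finrank ℂ (A ⟶ A) = 1) :
    leftCup (⟨A⟩ : Rev D) = rightCup A := by
  rw [leftCup, qdim_eq sA]
  rfl

end Dimension

section Irr

variable {C I : Type*} [Category C] [Preadditive C] {S : I → C}

/-- A decomposition, in the reversed category. -/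
def decomposition {A : C} (t : Decomposition S A) :
    Decomposition (fun b => (⟨S b⟩ : Rev C)) ⟨A⟩ where
  n := t.n
  label := t.label
  inc := t.inc
  proj := t.proj
  inc_proj := t.inc_proj
  inc_proj_of_ne := t.inc_proj_of_ne
  sum_proj_inc := t.sum_proj_inc

theorem isIrr [Linear ℂ C] (hS : IsIrr S) : IsIrr (fun b => (⟨S b⟩ : Rev C)) where
  finiteDimensional X Y := hS.finiteDimensional X.un Y.un
  simple := hS.simple
  eq_of_iso a b := fun ⟨e⟩ => hS.eq_of_iso a b ⟨⟨e.hom, e.inv, e.hom_inv_id, e.inv_hom_id⟩⟩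
  semisimple A := (hS.semisimple A.un).map decomposition

end Irr

section Module

variable {D 𝒩 : Type*} [Category D] [Preadditive D] [Linear ℂ D] [MonoidalCategory D]
  [UnitaryCategory D] [Category 𝒩] [Preadditive 𝒩] [Linear ℂ 𝒩] [UnitaryCategory 𝒩]
  [MonoidalRightAction D 𝒩]

instance [UnitaryRightModule D 𝒩] : UnitaryLeftModule (Rev D) 𝒩 where
  action_add A _ _ f g := UnitaryRightModule.add_action f g A.un
  action_smul A _ _ c f := UnitaryRightModule.smul_action c f A.un
  add_action f g x := UnitaryRightModule.action_add (D := D) x f g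
  smul_action c f x := UnitaryRightModule.action_smul (D := D) x c f
  dagger_action f g := UnitaryRightModule.dagger_action (D := D) g f
  dagger_actionAssoc A B x := UnitaryRightModule.dagger_actionAssoc x B.un A.un
  dagger_actionUnit x := UnitaryRightModule.dagger_actionUnit x

end Module

end Rev

section Transfer

variable {D 𝒩 I J : Type*} [Category D] [Preadditive D] [Linear ℂ D] [MonoidalCategory D]
  [MonoidalPreadditive D] [MonoidalLinear ℂ D] [RigidCategory D] [UnitaryCategory D]
  [UnitaryMonoidal D] [Category 𝒩] [Preadditive 𝒩] [Linear ℂ 𝒩] [UnitaryCategory 𝒩]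
  [MonoidalRightAction D 𝒩] [UnitaryRightModule D 𝒩] [Fintype I] [DecidableEq I]
  [Fintype J] [DecidableEq J] {S : I → D} {N : J → 𝒩}

theorem leftDim_rev (hS : IsIrr S) (x : J) :
    leftDim (fun b => (⟨S b⟩ : Rev D)) N x = rightDim S N x := by
  simp only [leftDim, Rev.qdim_eq (hS.simple _)]
  rfl

theorem leftNorm_rev (hS : IsIrr S) (b : I) (x y : J) :
    leftNorm (fun b => (⟨S b⟩ : Rev D)) N b x y = rightNorm S N b x y := by
  simp only [leftNorm, leftDim_rev hS, Rev.qdim_eq (hS.simple _)]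
  rfl

theorem leftBendUp_rev {A : D} (sA : Module.finrank ℂ (A ⟶ A) = 1) {x y : 𝒩} (ξ : x ⊙ᵣ A ⟶ y) :
    leftBendUp (A := (⟨A⟩ : Rev D)) ξ = rightBendUp ξ := by
  rw [leftBendUp, Rev.leftCup_eq sA]
  rfl

section Maps

variable {H : CStarWeakHopfAlgebra (RightTube S N)}
  (h : IsLeftTubeStructure (fun b => (⟨S b⟩ : Rev D)) N H) (b : I) {d e f g : J}
include h

theorem IsLeftTubeStructure.counit_rev (x y : J)
    (B : VertexBasis (N y) (N x ⊙ᵣ S b) (leftNorm (fun b => (⟨S b⟩ : Rev D)) N b x y))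
    (s t : Fin B.n) :
    H.counit (rightDiagram S N b (B.vec s) (dagger (B.vec t))) =
      if s = t then (leftNorm (fun b => (⟨S b⟩ : Rev D)) N b x y : ℂ) else 0 :=
  h.counit_normalised b x y B s t

/-- The normalisation is a variable Y because `leftNorm` over the reversed category and `rightNorm`
are equal only propositionally, and the type of the vertex bases depends on it. -/
theorem IsLeftTubeStructure.comul_rev {Y : J → J → ℝ}
    (hY : leftNorm (fun b => (⟨S b⟩ : Rev D)) N b = Y)
    (B : ∀ i j : J, VertexBasis (N j) (N i ⊙ᵣ S b) (Y i j)) (ν : N d ⟶ N e ⊙ᵣ S b) (ζ : N f ⊙ᵣ S b ⟶ N g) :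
    H.comul (rightDiagram S N b ν ζ) = ∑ i : J, ∑ j : J, ∑ s : Fin (B i j).n,
      (Real.sqrt (leftDim (fun b => (⟨S b⟩ : Rev D)) N j /
          (qdim (⟨S b⟩ : Rev D) * leftDim (fun b => (⟨S b⟩ : Rev D)) N i)) : ℂ) •
        (rightDiagram S N b ((B i j).vec s) ζ ⊗ₜ[ℂ]
          rightDiagram S N b ν (dagger ((B i j).vec s))) := by
  subst hY
  exact h.comul_eq b B ν ζ

theorem IsLeftTubeStructure.antipode_rev (t : Decomposition S (ᘁ(S b)))
    (ν : N d ⟶ N e ⊙ᵣ S b) (ζ : N f ⊙ᵣ S b ⟶ N g) :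
    H.antipode (rightDiagram S N b ν ζ) =
      ((leftDim (fun b => (⟨S b⟩ : Rev D)) N f / leftDim (fun b => (⟨S b⟩ : Rev D)) N g : ℝ) : ℂ) •
        rightArc S N t (leftBendUp (A := (⟨S b⟩ : Rev D)) ζ) (rightBendDown ν) :=
  h.antipode_eq b (Rev.decomposition t) ν ζ

theorem IsLeftTubeStructure.star_rev (t : Decomposition S (ᘁ(S b)))
    (ν : N d ⟶ N e ⊙ᵣ S b) (ζ : N f ⊙ᵣ S b ⟶ N g) :
    H.star (rightDiagram S N b ν ζ) =
      ((leftDim (fun b => (⟨S b⟩ : Rev D)) N e / leftDim (fun b => (⟨S b⟩ : Rev D)) N d : ℝ) : ℂ) •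
        rightArc S N t (leftBendUp (A := (⟨S b⟩ : Rev D)) (dagger ν))
          (rightBendDown (dagger ζ)) :=
  h.star_eq b (Rev.decomposition t) ν ζ

end Maps

/-- The diagrammatic structure maps of the left tube algebra over the reversed category are the
mirror images of those of the right tube algebra. -/
theorem IsLeftTubeStructure.right (hS : IsIrr S) {H : CStarWeakHopfAlgebra (RightTube S N)}
    (h : IsLeftTubeStructure (fun b => (⟨S b⟩ : Rev D)) N H) : IsRightTubeStructure S N H where
  one_eq t := h.one_eq (Rev.decomposition t)
  mul_eq b b' t _ _ _ _ _ _ _ _ ν ζ ν' ζ' := h.mul_eq b b' (Rev.decomposition t) ν ζ ν' ζ'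
  counit_eq b _ _ _ _ ν ζ := h.counit_eq b ν ζ
  counit_normalised b x y := by
    rw [← leftNorm_rev hS]
    exact h.counit_rev b x y
  comul_eq b B _ _ _ _ ν ζ := by
    simp only [← leftDim_rev hS, ← Rev.qdim_eq (hS.simple b)]
    exact h.comul_rev b (funext fun i => funext (leftNorm_rev hS b i)) B ν ζ
  antipode_eq b t _ _ _ _ ν ζ := by
    rw [← leftDim_rev hS, ← leftDim_rev hS, ← leftBendUp_rev (hS.simple b)]
    exact h.antipode_rev b t ν ζ
  star_eq b t _ _ _ _ ν ζ := by
    rw [← leftDim_rev hS, ← leftDim_rev hS, ← leftBendUp_rev (hS.simple b)]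
    exact h.star_rev b t ν ζ

end Transfer

end BoundaryTube

end
theorem mainTheorem7
    -- a unitary multifusion category, with representatives `S` of its simple objects
    {D : Type*} [Category D] [Preadditive D] [Linear ℂ D] [MonoidalCategory D]
    [MonoidalPreadditive D] [MonoidalLinear ℂ D] [RigidCategory D]
    [BoundaryTube.UnitaryCategory D] [BoundaryTube.UnitaryMonoidal D]
    {I : Type*} [Fintype I] [DecidableEq I] (S : I → D) (_hS : BoundaryTube.IsIrr S)
    -- a finite semisimple unitary left module category, with representatives `M`
    {ℳ : Type*} [Category ℳ] [Preadditive ℳ] [Linear ℂ ℳ] [BoundaryTube.UnitaryCategory ℳ]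
    [MonoidalLeftAction D ℳ] [BoundaryTube.UnitaryLeftModule D ℳ]
    {J : Type*} [Fintype J] [DecidableEq J] (M : J → ℳ) (_hM : BoundaryTube.IsIrr M)
    -- a finite semisimple unitary right module category, with representatives `N`
    {𝒩 : Type*} [Category 𝒩] [Preadditive 𝒩] [Linear ℂ 𝒩] [BoundaryTube.UnitaryCategory 𝒩]
    [MonoidalRightAction D 𝒩] [BoundaryTube.UnitaryRightModule D 𝒩]
    {K : Type*} [Fintype K] [DecidableEq K] (N : K → 𝒩) (_hN : BoundaryTube.IsIrr N) :
    (∃ H : BoundaryTube.CStarWeakHopfAlgebra (BoundaryTube.LeftTube S M),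
      BoundaryTube.IsLeftTubeStructure S M H) ∧
    (∃ H : BoundaryTube.CStarWeakHopfAlgebra (BoundaryTube.RightTube S N),
      BoundaryTube.IsRightTubeStructure S N H) := by
  have : Fact (BoundaryTube.IsIrr S) := ⟨_hS⟩
  have : Fact (BoundaryTube.IsIrr fun b => (⟨S b⟩ : BoundaryTube.Rev D)) :=
    ⟨BoundaryTube.Rev.isIrr _hS⟩
  have : Fact (BoundaryTube.IsIrr M) := ⟨_hM⟩
  have : Fact (BoundaryTube.IsIrr N) := ⟨_hN⟩
  exact ⟨⟨_, BoundaryTube.isLeftTubeStructure S M⟩,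
    ⟨_, (BoundaryTube.isLeftTubeStructure (fun b => (⟨S b⟩ : BoundaryTube.Rev D)) N).right _hS⟩⟩
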